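/- Let $c\in\mathbb C\setminus(-\infty,0]$, and let powers of $c$ be taken with $\arg c\in(-\pi,\pi)$. Let $\mathcal L_c$ be the operator in $L_2(\mathbb R_+)$ given by $$\mathcal L_c y=-y''+cxy,\qquad \mathfrak D(\mathcal L_c)=\{y\in L_2(\mathbb R_+):\ y\in W^2_{2,\mathrm{loc}}[0,\infty),\ -y''+cxy\in L_2(\mathbb R_+),\ y(0)=0\}.$$ Let $\mathrm{Ai}$ be the Airy function, i.e. the entire solution of $y''=zy$ with $\mathrm{Ai}(0)=\frac{1}{3^{2/3}\Gamma(2/3)}$, $\mathrm{Ai}'(0)=-\frac{1}{3^{1/3}\Gamma(1/3)}$. The zeros of $\mathrm{Ai}$ in $\mathbb C$ are exactly the numbers $-t_n$, $n=1,2,\dots$, where $0<t_1<t_2<\cdots$ is a sequence (not depending on $c$) with $$t_n=\Big[\tfrac{3\pi}{2}\big(n-\tfrac14\big)\Big]^{2/3}+O(n^{-4/3}),\qquad n\to\infty.$$ For every $\lambda$ in the resolvent set of $\mathcal L_c$ the resolvent $(\mathcal L_c-\lambda I)^{-1}$ is a compact operator. The spectrum of $\mathcal L_c$ is discrete (it has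 no accumulation points in $\mathbb C$ and consists of eigenvalues of finite algebraic multiplicity), and it is exactly the set of the numbers $$\lambda_n=t_n c^{2/3},\qquad n=1,2,\dots$$ Each $\lambda_n$ is a simple eigenvalue (of algebraic multiplicity one), with the eigenfunction $y_n(x)=\mathrm{Ai}(-t_n+c^{1/3}x)\in L_2(\mathbb R_+)$. -/

import Mathlib

open MeasureTheory Set Filter Topology

noncomputable section

namespace AirySpectrum

/-! ### The Airy function -/

/-- Taylor coefficients at `0` of the solution of `y'' = z y` with
`y(0) = 1 / (3^(2/3) Γ(2/3))`, `y'(0) = -1 / (3^(1/3) Γ(1/3))`. -/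
def airyCoeff : ℕ → ℂ
  | 0 => ((1 / ((3 : ℝ) ^ (2 / 3 : ℝ) * Real.Gamma (2 / 3)) : ℝ) : ℂ)
  | 1 => ((-(1 / ((3 : ℝ) ^ (1 / 3 : ℝ) * Real.Gamma (1 / 3))) : ℝ) : ℂ)
  | 2 => 0
  | n + 3 => airyCoeff n / (((n : ℂ) + 2) * ((n : ℂ) + 3))

/-- The Airy function `Ai`, as an everywhere convergent power series. -/
def airyAi (z : ℂ) : ℂ := ∑' n : ℕ, airyCoeff n * z ^ n

/-! The next lemmas check that `airyAi` is entire and solves the initial value problem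
that characterizes the Airy function. -/

theorem airyCoeff_bound (r : ℝ) (hr : 0 ≤ r) : ∃ C : ℝ, ∀ n, ‖airyCoeff n‖ * r ^ n ≤ C := by
  obtain ⟨N, hN⟩ := exists_nat_ge (r ^ 3)
  refine ⟨∑ k ∈ Finset.range (N + 3), ‖airyCoeff k‖ * r ^ k, fun n => ?_⟩
  induction n using Nat.strong_induction_on with
  | _ n ih =>
    rcases lt_or_ge n (N + 3) with h | h
    · exact Finset.single_le_sum (f := fun k => ‖airyCoeff k‖ * r ^ k)
        (fun i _ => by positivity) (Finset.mem_range.2 h)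
    · obtain ⟨m, rfl⟩ : ∃ m, n = m + 3 := ⟨n - 3, by omega⟩
      refine le_trans ?_ (ih m (by omega))
      have hm : (N : ℝ) ≤ m := by exact_mod_cast (by omega : N ≤ m)
      have e : ‖((m : ℂ) + 2) * ((m : ℂ) + 3)‖ = ((m : ℝ) + 2) * (m + 3) := by
        rw [norm_mul]
        congr 1
        · exact_mod_cast Complex.norm_natCast (m + 2)
        · exact_mod_cast Complex.norm_natCast (m + 3)
      rw [airyCoeff, norm_div, e, div_mul_eq_mul_div, div_le_iff₀ (by positivity), pow_add,
        ← mul_assoc]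
      refine mul_le_mul_of_nonneg_left ?_ (by positivity)
      nlinarith [(Nat.cast_nonneg m : (0 : ℝ) ≤ m)]

theorem summable_airyCoeff (r : ℝ) (hr : 0 ≤ r) : Summable fun n => ‖airyCoeff n‖ * r ^ n := by
  obtain ⟨C, hC⟩ := airyCoeff_bound (2 * r) (by positivity)
  refine Summable.of_nonneg_of_le (fun n => by positivity) (fun n => ?_)
    (summable_geometric_two.mul_left C)
  have := hC n
  rw [mul_pow] at this
  have h2 : (0 : ℝ) < 2 ^ n := by positivity
  rw [one_div, inv_pow, ← div_eq_mul_inv, le_div_iff₀ h2]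
  linarith

theorem hasDerivAt_series (a : ℕ → ℂ) (ha : ∀ r : ℝ, 0 ≤ r → Summable fun n => ‖a n‖ * r ^ n) :
    (∀ r : ℝ, 0 ≤ r → Summable fun n : ℕ => ‖((n : ℂ) + 1) * a (n + 1)‖ * r ^ n) ∧
    ∀ z : ℂ, HasDerivAt (fun w => ∑' n, a n * w ^ n) (∑' n : ℕ, ((n : ℂ) + 1) * a (n + 1) * z ^ n)
      z := by
  have hb : ∀ r : ℝ, 0 ≤ r → Summable fun n : ℕ => ‖((n : ℂ) + 1) * a (n + 1)‖ * r ^ n := by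
    intro r hr
    refine Summable.of_nonneg_of_le (fun n => by positivity) (fun n => ?_)
      ((summable_nat_add_iff 1).2 (ha (2 * (r + 1)) (by positivity)))
    have e : ‖(n : ℂ) + 1‖ = (n : ℝ) + 1 := by exact_mod_cast Complex.norm_natCast (n + 1)
    have h1 : (n : ℝ) + 1 ≤ 2 ^ (n + 1) := by exact_mod_cast (Nat.lt_two_pow_self (n := n + 1)).le
    have h2 : r ^ n ≤ (r + 1) ^ (n + 1) :=
      (pow_le_pow_left₀ hr (by linarith) n).trans (pow_le_pow_right₀ (by linarith) (by omega))
    rw [norm_mul, e, mul_pow]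
    calc ((n : ℝ) + 1) * ‖a (n + 1)‖ * r ^ n = ‖a (n + 1)‖ * (((n : ℝ) + 1) * r ^ n) := by ring
      _ ≤ ‖a (n + 1)‖ * (2 ^ (n + 1) * (r + 1) ^ (n + 1)) := by gcongr
  refine ⟨hb, fun z => ?_⟩
  have hz : z ∈ Metric.ball (0 : ℂ) (‖z‖ + 1) := by simp
  have hle : ∀ (i : ℕ) (w : ℂ), w ∈ Metric.ball (0 : ℂ) (‖z‖ + 1) →
      ‖a i * w ^ i‖ ≤ ‖a i‖ * (‖z‖ + 1) ^ i := by
    intro i w hw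
    rw [norm_mul, norm_pow]
    have : ‖w‖ ≤ ‖z‖ + 1 := by simpa using (mem_ball_zero_iff.1 hw).le
    gcongr
  have hs := ha (‖z‖ + 1) (by positivity)
  have hd : ∀ i : ℕ, DifferentiableOn ℂ (fun w => a i * w ^ i) (Metric.ball (0 : ℂ) (‖z‖ + 1)) :=
    fun i => by fun_prop
  have h1 := Complex.differentiableOn_tsum_of_summable_norm hs hd Metric.isOpen_ball hle
  have h2 := Complex.hasSum_deriv_of_summable_norm hs hd Metric.isOpen_ball hle hz
  have h3 := (h1.differentiableAt (Metric.isOpen_ball.mem_nhds hz)).hasDerivAt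
  have h4 := (hasSum_nat_add_iff' 1).2 h2
  simp only [Finset.range_one, Finset.sum_singleton, pow_zero, mul_one, deriv_const, sub_zero] at h4
  rw [← h4.tsum_eq] at h3
  rwa [tsum_congr fun n : ℕ => show deriv (fun w => a (n + 1) * w ^ (n + 1)) z =
    ((n : ℂ) + 1) * a (n + 1) * z ^ n from by
      rw [deriv_const_mul_field, deriv_pow_field]; push_cast; ring] at h3

/-- `airyAi` is entire, satisfies `Ai'' = z Ai`, and has the initial values of the Airy function. -/
theorem airyAi_spec :
    Differentiable ℂ airyAi ∧ (∀ z, deriv (deriv airyAi) z = z * airyAi z) ∧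
    airyAi 0 = ((1 / ((3 : ℝ) ^ (2 / 3 : ℝ) * Real.Gamma (2 / 3)) : ℝ) : ℂ) ∧
    deriv airyAi 0 = ((-(1 / ((3 : ℝ) ^ (1 / 3 : ℝ) * Real.Gamma (1 / 3))) : ℝ) : ℂ) := by
  obtain ⟨hb, h1⟩ := hasDerivAt_series _ summable_airyCoeff
  obtain ⟨hb2, h2⟩ := hasDerivAt_series _ hb
  have hd : deriv airyAi = fun z => ∑' n : ℕ, ((n : ℂ) + 1) * airyCoeff (n + 1) * z ^ n :=
    funext fun z => (h1 z).deriv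
  refine ⟨fun z => (h1 z).differentiableAt, fun z => ?_, ?_, ?_⟩
  · rw [hd, (h2 z).deriv, Summable.tsum_eq_zero_add, airyAi, ← tsum_mul_left]
    · simp only [airyCoeff, Nat.cast_zero, mul_zero, zero_mul, zero_add]
      refine tsum_congr fun n => ?_
      have e2 : (n : ℂ) + 2 ≠ 0 := by exact_mod_cast (by omega : n + 2 ≠ 0)
      have e3 : (n : ℂ) + 3 ≠ 0 := by exact_mod_cast (by omega : n + 3 ≠ 0)
      push_cast
      rw [show (n : ℂ) + 1 + 1 = n + 2 by ring, show (n : ℂ) + 2 + 1 = n + 3 by ring]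
      field_simp
      ring
    · refine Summable.of_norm ?_
      refine (hb2 ‖z‖ (norm_nonneg z)).congr fun n => ?_
      rw [norm_mul _ (z ^ n), norm_pow]
  · rw [airyAi, tsum_eq_single 0 (fun n hn => by simp [hn])]
    simp [airyCoeff]
  · rw [hd]
    dsimp only
    rw [tsum_eq_single 0 (fun n hn => by simp [hn])]
    simp [airyCoeff]

/-! ### The operator `L_c` -/

/-- The Hilbert space `L₂(ℝ₊)`. -/
abbrev L2HalfLine : Type := Lp ℂ 2 (volume.restrict (Ioi (0 : ℝ)))

/-- `u` belongs to `W²₂` on every segment `[0, b]`, with derivative `u₁` and second derivative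
`u₂`: `u` and `u₁` are locally absolutely continuous on `[0, ∞)` with `u' = u₁`, `u₁' = u₂`, and
`u₂` is locally square integrable on `[0, ∞)`. -/
structure IsW22Loc (u u₁ u₂ : ℝ → ℂ) : Prop where
  memLp : ∀ b : ℝ, MemLp u₂ 2 (volume.restrict (Ioc 0 b))
  eq_integral_one : ∀ x : ℝ, 0 ≤ x → u x = u 0 + ∫ t in (0 : ℝ)..x, u₁ t
  eq_integral_two : ∀ x : ℝ, 0 ≤ x → u₁ x = u₁ 0 + ∫ t in (0 : ℝ)..x, u₂ t

/-- The pair `(y, f)` lies in the graph of `L_c`: `y ∈ L₂(ℝ₊)` has a representative `u ∈ W²₂,loc`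
with `u(0) = 0`, and `f ∈ L₂(ℝ₊)` is `-u'' + c x u`. -/
def AiryRel (c : ℂ) (y f : L2HalfLine) : Prop :=
  ∃ u u₁ u₂ : ℝ → ℂ, IsW22Loc u u₁ u₂ ∧ u 0 = 0 ∧
    y =ᵐ[volume.restrict (Ioi 0)] u ∧
    f =ᵐ[volume.restrict (Ioi 0)] fun x => -u₂ x + c * x * u x

theorem IsW22Loc.intervalIntegrable_two {u u₁ u₂ : ℝ → ℂ} (h : IsW22Loc u u₁ u₂) {x : ℝ}
    (hx : 0 ≤ x) : IntervalIntegrable u₂ volume 0 x :=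
  (intervalIntegrable_iff_integrableOn_Ioc_of_le hx).2 ((h.memLp x).integrable (by norm_num))

/-- A function given by `g(0)` plus a primitive is continuous on `[0, ∞)`. -/
theorem continuousOn_of_primitive {g G : ℝ → ℂ}
    (hi : ∀ x : ℝ, 0 ≤ x → IntervalIntegrable G volume 0 x)
    (hg : ∀ x : ℝ, 0 ≤ x → g x = g 0 + ∫ t in (0 : ℝ)..x, G t) (b : ℝ) (hb : 0 ≤ b) :
    ContinuousOn g (Icc 0 b) := by
  have h : ContinuousOn (fun x => g 0 + ∫ t in (0 : ℝ)..x, G t) (Icc 0 b) := by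
    refine continuousOn_const.add ?_
    have := intervalIntegral.continuousOn_primitive_interval (μ := volume) (f := G) (a := 0) (b := b)
      ((intervalIntegrable_iff' ).1 (hi b hb))
    rwa [uIcc_of_le hb] at this
  exact h.congr fun x hx => hg x hx.1

theorem IsW22Loc.continuousOn_one {u u₁ u₂ : ℝ → ℂ} (h : IsW22Loc u u₁ u₂) (b : ℝ) (hb : 0 ≤ b) :
    ContinuousOn u₁ (Icc 0 b) :=
  continuousOn_of_primitive (fun _ hx => h.intervalIntegrable_two hx) h.eq_integral_two b hb

theorem IsW22Loc.intervalIntegrable_one {u u₁ u₂ : ℝ → ℂ} (h : IsW22Loc u u₁ u₂) {x : ℝ}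
    (hx : 0 ≤ x) : IntervalIntegrable u₁ volume 0 x :=
  ContinuousOn.intervalIntegrable (by rw [uIcc_of_le hx]; exact h.continuousOn_one x hx)

theorem IsW22Loc.continuousOn_zero {u u₁ u₂ : ℝ → ℂ} (h : IsW22Loc u u₁ u₂) (b : ℝ) (hb : 0 ≤ b) :
    ContinuousOn u (Icc 0 b) :=
  continuousOn_of_primitive (fun _ hx => h.intervalIntegrable_one hx) h.eq_integral_one b hb

theorem IsW22Loc.add {u u₁ u₂ v v₁ v₂ : ℝ → ℂ} (h : IsW22Loc u u₁ u₂) (k : IsW22Loc v v₁ v₂) :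
    IsW22Loc (u + v) (u₁ + v₁) (u₂ + v₂) where
  memLp b := (h.memLp b).add (k.memLp b)
  eq_integral_one x hx := by
    have := intervalIntegral.integral_add (h.intervalIntegrable_one hx) (k.intervalIntegrable_one hx)
    simp only [Pi.add_apply]
    rw [this, h.eq_integral_one x hx, k.eq_integral_one x hx]
    ring
  eq_integral_two x hx := by
    have := intervalIntegral.integral_add (h.intervalIntegrable_two hx) (k.intervalIntegrable_two hx)
    simp only [Pi.add_apply]
    rw [this, h.eq_integral_two x hx, k.eq_integral_two x hx]
    ring

theorem IsW22Loc.smul {u u₁ u₂ : ℝ → ℂ} (h : IsW22Loc u u₁ u₂) (a : ℂ) :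
    IsW22Loc (a • u) (a • u₁) (a • u₂) where
  memLp b := (h.memLp b).const_smul a
  eq_integral_one x hx := by
    simp only [Pi.smul_apply, smul_eq_mul]
    rw [intervalIntegral.integral_const_mul, h.eq_integral_one x hx]
    ring
  eq_integral_two x hx := by
    simp only [Pi.smul_apply, smul_eq_mul]
    rw [intervalIntegral.integral_const_mul, h.eq_integral_two x hx]
    ring

/-- The graph of `L_c`. -/
def airyGraph (c : ℂ) : Submodule ℂ (L2HalfLine × L2HalfLine) where
  carrier := {p | AiryRel c p.1 p.2}
  zero_mem' := by
    refine ⟨0, 0, 0, ⟨fun b => MemLp.zero, by simp, by simp⟩, rfl, Lp.coeFn_zero _ _ _, ?_⟩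
    filter_upwards [Lp.coeFn_zero ℂ 2 (volume.restrict (Ioi (0 : ℝ)))] with x hx
    simpa using hx
  add_mem' := by
    rintro ⟨y, f⟩ ⟨z, g⟩ ⟨u, u₁, u₂, hu, hu0, hy, hf⟩ ⟨v, v₁, v₂, hv, hv0, hz, hg⟩
    refine ⟨_, _, _, hu.add hv, by simp [hu0, hv0], ?_, ?_⟩
    · filter_upwards [Lp.coeFn_add y z, hy, hz] with x h1 h2 h3
      simp_all
    · filter_upwards [Lp.coeFn_add f g, hf, hg] with x h1 h2 h3
      simp only [Prod.mk_add_mk, h1, Pi.add_apply] at *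
      rw [h2, h3]
      ring
  smul_mem' := by
    rintro a ⟨y, f⟩ ⟨u, u₁, u₂, hu, hu0, hy, hf⟩
    refine ⟨_, _, _, hu.smul a, by simp [hu0], ?_, ?_⟩
    · filter_upwards [Lp.coeFn_smul a y, hy] with x h1 h2
      simp_all
    · filter_upwards [Lp.coeFn_smul a f, hf] with x h1 h2
      simp only [Prod.smul_mk, h1, Pi.smul_apply, smul_eq_mul] at *
      rw [h2]
      ring

/-- If all the integrals of `G` over `[0, x]` vanish, then `G = 0` a.e. on `(0, ∞)`. -/
theorem ae_zero_of_primitive_zero {G : ℝ → ℂ}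
    (hi : ∀ x : ℝ, 0 ≤ x → IntervalIntegrable G volume 0 x)
    (h0 : ∀ x : ℝ, 0 ≤ x → ∫ t in (0 : ℝ)..x, G t = 0) :
    ∀ᵐ x ∂(volume.restrict (Ioi (0 : ℝ))), G x = 0 := by
  have key : ∀ n : ℕ, ∀ᵐ x ∂volume, x ∈ Ioo (0 : ℝ) n → G x = 0 := by
    intro n
    have hn : (0 : ℝ) ≤ n := Nat.cast_nonneg n
    filter_upwards [(hi n hn).ae_hasDerivAt_integral] with x hx hxn
    have hm : x ∈ uIcc (0 : ℝ) n := by rw [uIcc_of_le hn]; exact Ioo_subset_Icc_self hxn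
    have h1 := hx hm 0 left_mem_uIcc
    have h2 : HasDerivAt (fun y => ∫ t in (0 : ℝ)..y, G t) 0 x := by
      refine (hasDerivAt_const x (0 : ℂ)).congr_of_eventuallyEq ?_
      filter_upwards [Ioi_mem_nhds hxn.1] with y hy
      exact h0 y hy.le
    exact h1.unique h2
  rw [ae_restrict_iff' measurableSet_Ioi]
  filter_upwards [ae_all_iff.2 key] with x hx hx0
  obtain ⟨n, hn⟩ := exists_nat_gt x
  exact hx n ⟨hx0, hn⟩

/-- A function continuous on every `[0, b]` that vanishes a.e. on `(0, ∞)` vanishes on `[0, ∞)`. -/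
theorem zero_of_ae_zero {g : ℝ → ℂ} (hg : ∀ b : ℝ, 0 ≤ b → ContinuousOn g (Icc 0 b))
    (h : ∀ᵐ x ∂(volume.restrict (Ioi (0 : ℝ))), g x = 0) (x : ℝ) (hx : 0 ≤ x) : g x = 0 := by
  have h1 : g =ᵐ[volume.restrict (Icc 0 (x + 1))] fun _ => (0 : ℂ) := by
    rw [← restrict_Ioc_eq_restrict_Icc]
    exact ae_mono (Measure.restrict_mono (fun _ ht => ht.1) le_rfl) h
  exact Measure.eqOn_Icc_of_ae_eq volume (by linarith) h1 (hg _ (by linarith)) continuousOn_const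
    ⟨hx, by linarith⟩

/-- The graph is single-valued: `L_c y` does not depend on the representative. -/
theorem airyGraph_singleValued (c : ℂ) :
    ∀ p ∈ airyGraph c, p.1 = 0 → p.2 = 0 := by
  rintro ⟨y, f⟩ ⟨u, u₁, u₂, hu, hu0, hy, hf⟩ (rfl : y = 0)
  have hu' : ∀ x : ℝ, 0 ≤ x → u x = 0 := by
    refine zero_of_ae_zero hu.continuousOn_zero ?_
    filter_upwards [hy, Lp.coeFn_zero ℂ 2 (volume.restrict (Ioi (0 : ℝ)))] with x h1 h2
    rw [← h1, h2, Pi.zero_apply]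
  have hu1 : ∀ x : ℝ, 0 ≤ x → u₁ x = 0 := by
    refine zero_of_ae_zero hu.continuousOn_one
      (ae_zero_of_primitive_zero (fun _ hx => hu.intervalIntegrable_one hx) fun x hx => ?_)
    have := hu.eq_integral_one x hx
    rwa [hu' x hx, hu0, zero_add, eq_comm] at this
  have hu2 := ae_zero_of_primitive_zero (fun _ hx => hu.intervalIntegrable_two hx) fun x hx => by
    have := hu.eq_integral_two x hx
    rwa [hu1 x hx, hu1 0 le_rfl, zero_add, eq_comm] at this
  refine Lp.ext ?_
  filter_upwards [hf, hu2, Lp.coeFn_zero ℂ 2 (volume.restrict (Ioi (0 : ℝ))),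
    ae_restrict_mem measurableSet_Ioi] with x h1 h2 h3 h4
  rw [h1, h2, h3, hu' x (le_of_lt h4)]
  simp

/-- The operator `L_c = -d²/dx² + c x` in `L₂(ℝ₊)` with the Dirichlet condition at zero, on the
domain `{y ∈ L₂(ℝ₊) : y ∈ W²₂,loc, -y'' + c x y ∈ L₂(ℝ₊), y(0) = 0}`. -/
def airyOperator (c : ℂ) : L2HalfLine →ₗ.[ℂ] L2HalfLine := (airyGraph c).toLinearPMap

theorem airyOperator_graph (c : ℂ) : (airyOperator c).graph = airyGraph c :=
  Submodule.toLinearPMap_graph_eq _ (airyGraph_singleValued c)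

theorem mem_airyOperator_domain_iff (c : ℂ) (y : L2HalfLine) :
    y ∈ (airyOperator c).domain ↔ ∃ f, AiryRel c y f := by
  rw [LinearPMap.mem_domain_iff, airyOperator_graph]
  rfl

theorem airyOperator_apply_eq_iff (c : ℂ) (y : (airyOperator c).domain) (f : L2HalfLine) :
    airyOperator c y = f ↔ AiryRel c y f := by
  constructor
  · rintro rfl
    have := (airyOperator c).mem_graph y
    rwa [airyOperator_graph] at this
  · intro h
    have h2 : ((y : L2HalfLine), f) ∈ (airyOperator c).graph := by
      rw [airyOperator_graph]; exact h
    exact ((airyOperator c).mem_graph_snd_inj' ((airyOperator c).mem_graph y) h2 rfl)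

/-! ### Spectral notions for unbounded operators -/

section Spectral

variable {E : Type*} [NormedAddCommGroup E] [NormedSpace ℂ E]

/-- `R` is the resolvent `(T - z I)⁻¹`: a bounded everywhere defined operator, inverse to
`T - z I : D(T) → E`. -/
def IsResolventAt (T : E →ₗ.[ℂ] E) (z : ℂ) (R : E →L[ℂ] E) : Prop :=
  (∀ f : E, ∃ h : R f ∈ T.domain, T ⟨R f, h⟩ - z • R f = f) ∧
    ∀ y : T.domain, R (T y - z • (y : E)) = y

/-- The resolvent set of `T`. -/
def resolventSet (T : E →ₗ.[ℂ] E) : Set ℂ := {z | ∃ R : E →L[ℂ] E, IsResolventAt T z R}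

/-- The spectrum of `T`. -/
def spectrum (T : E →ₗ.[ℂ] E) : Set ℂ := (resolventSet T)ᶜ

/-- `y` is an eigenvector of `T` with eigenvalue `z`. -/
def IsEigenvector (T : E →ₗ.[ℂ] E) (z : ℂ) (y : E) : Prop :=
  y ≠ 0 ∧ ∃ h : y ∈ T.domain, T ⟨y, h⟩ = z • y

/-- `rootSpaceOfOrder T z k` is the kernel of `(T - z I)^k`, on its natural domain. -/
def rootSpaceOfOrder (T : E →ₗ.[ℂ] E) (z : ℂ) : ℕ → Submodule ℂ E
  | 0 => ⊥
  | k + 1 => ((rootSpaceOfOrder T z k).comap (T.toFun - z • T.domain.subtype)).map T.domain.subtype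

/-- The root subspace: all eigenvectors and associated vectors of `T` at `z`. Its dimension is the
algebraic multiplicity of `z`. -/
def rootSpace (T : E →ₗ.[ℂ] E) (z : ℂ) : Submodule ℂ E := ⨆ k, rootSpaceOfOrder T z k

/-- `z` is a simple eigenvalue of `T`: it is an eigenvalue of algebraic multiplicity one. -/
def IsSimpleEigenvalue (T : E →ₗ.[ℂ] E) (z : ℂ) : Prop :=
  (∃ y, IsEigenvector T z y) ∧ Module.finrank ℂ (rootSpace T z) = 1

/-- The spectrum of `T` is discrete: it has no accumulation points in `ℂ`, and every point of it
is an eigenvalue of finite algebraic multiplicity. -/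
def HasDiscreteSpectrum (T : E →ₗ.[ℂ] E) : Prop :=
  (∀ z : ℂ, ¬ AccPt z (𝓟 (spectrum T))) ∧
    ∀ z ∈ spectrum T, (∃ y, IsEigenvector T z y) ∧ FiniteDimensional ℂ (rootSpace T z)

end Spectral

end AirySpectrum

end

noncomputable section

namespace AirySpectrum

/-! Write c = β⁶ with |arg β| < π/6. The substitution z = z₀ + β²x turns -y'' + cxy = λy into the
Airy equation, with λ = -β⁴z₀. The solution ψ(x) = Ai(z₀ + β²x) decays exponentially because Re β
and Re β³ are positive. Pairing with it bilinearly (`green_identity`) gives ∫ψ·(L_c - λ)u =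
Ai(z₀)u'(0) when u(0) = 0. Hence a solution of (L_c - λ)u = 0 vanishes if Ai(z₀) ≠ 0 and is a
multiple of ψ if Ai(z₀) = 0 (`AiryRel.eigen`). An associated vector would force ∫ψ² = 0, but this
integral is Ai'(z₀)²/β² ≠ 0 (`integral_decaying_sq`).

For the resolvent, L_c is inverted at λ = 0 by a Green kernel made of Ai(β²x) and Ai(β²x) - Ai(γ²x),
where γ³ = -β³. Bounds of order exp(∓(2/3)Re(β³)x^{3/2}) make the kernel square integrable, so the
inverse is Hilbert-Schmidt (`exists_compact_inverse`). The Fredholm alternative then produces the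
resolvent at every λ that is not an eigenvalue (`exists_isResolventAt`).

The analysis of Ai rests on the formula Ai(w²) = k·exp(-2w³/3)·∫exp(-wv² - iv³/3)dv for Re w > 0
(`exists_airyAi_eq_saddle`). Both sides solve the same equation in w², so their Wronskian is
constant. It tends to zero along the positive axis, where the right side decays and Ai with its
derivative is bounded (`airyAi_bounded`, from a different integral representation). The formula
gives decay along rays and, after comparison with a Gaussian integral, asymptotics with an error
term.

An energy argument puts the zeros on the negative axis (`airyAi_zero_re_im`). There the connection
formula yields Ai(-x) = 2|Ai(x·exp(iπ/3))|·cos θ(x). The phase θ increases strictly from -π/3 and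
equals (2/3)x^{3/2} - π/4 + O(x^{-3/2}). Its branch is fixed by following a continuous logarithm of
Ai along an arc from the positive axis, where Ai is real (`airyLog_asymptotic`). Solving θ(t) = (n -
1/2)π gives the n-th zero with the right index and the stated error (`exists_airy_zeros`). -/

/-! ### Primitives of locally integrable functions on the half-line -/

/-- `F` is a primitive on `[0, ∞)` of the locally integrable function `f`. -/
def IsPrimitive (F f : ℝ → ℂ) : Prop :=
  ∀ x : ℝ, 0 ≤ x → IntervalIntegrable f volume 0 x ∧ F x = F 0 + ∫ t in (0 : ℝ)..x, f t

/-- Reduces to real integrands: real and imaginary parts have absolutely continuous primitives, and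
these are recombined with the constants 1 and i. -/
theorem absolutelyContinuous_primitive {f : ℝ → ℂ} {b : ℝ}
    (hf : IntervalIntegrable f volume 0 b) :
    AbsolutelyContinuousOnInterval (fun x => ∫ t in (0 : ℝ)..x, f t) 0 b := by
  have hre : IntervalIntegrable (fun t => (f t).re) volume 0 b := ⟨hf.1.re, hf.2.re⟩
  have him : IntervalIntegrable (fun t => (f t).im) volume 0 b := ⟨hf.1.im, hf.2.im⟩
  have hc (z : ℂ) : AbsolutelyContinuousOnInterval (fun _ : ℝ => z) 0 b :=
    (LipschitzWith.const z).lipschitzOnWith.absolutelyContinuousOnInterval (K := 0)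
  have key := ((hre.absolutelyContinuousOnInterval_intervalIntegral (c := 0) (by simp)).smul
    (hc 1)).add ((him.absolutelyContinuousOnInterval_intervalIntegral (c := 0) (by simp)).smul
      (hc Complex.I))
  have e : (fun x => ∫ t in (0 : ℝ)..x, (f t).re) • (fun _ : ℝ => (1 : ℂ)) +
      (fun x => ∫ t in (0 : ℝ)..x, (f t).im) • (fun _ : ℝ => Complex.I) =
      fun x => (((∫ t in (0 : ℝ)..x, (f t).re : ℝ) : ℂ) +
        ((∫ t in (0 : ℝ)..x, (f t).im : ℝ) : ℂ) * Complex.I) := by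
    ext x
    simp
  rw [e] at key
  have hv : ∀ x ∈ uIcc 0 b, ∫ t in (0 : ℝ)..x, f t =
      ((∫ t in (0 : ℝ)..x, (f t).re : ℝ) : ℂ) +
        ((∫ t in (0 : ℝ)..x, (f t).im : ℝ) : ℂ) * Complex.I := fun x hx => by
    have hs : uIcc 0 x ⊆ uIcc 0 b := uIcc_subset_uIcc left_mem_uIcc hx
    rw [← intervalIntegral.integral_ofReal, ← intervalIntegral.integral_ofReal,
      ← intervalIntegral.integral_mul_const, ← intervalIntegral.integral_add]
    · exact intervalIntegral.integral_congr fun t _ => (Complex.re_add_im (f t)).symm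
    · have h := hre.mono_set hs
      exact ⟨h.1.ofReal, h.2.ofReal⟩
    · have h := him.mono_set hs
      exact IntervalIntegrable.mul_const ⟨h.1.ofReal, h.2.ofReal⟩ _
  -- Only endpoints inside the interval enter the sums that define absolute continuity, so agreement
  -- of the two functions there is enough.
  refine squeeze_zero' (Eventually.of_forall fun _ => Finset.sum_nonneg fun _ _ => dist_nonneg)
    ?_ key
  refine Eventually.mono (mem_inf_of_right (mem_principal_self _)) fun E hE => le_of_eq ?_
  refine Finset.sum_congr rfl fun i hi => ?_
  simp only
  rw [hv _ (hE.1 i hi).1, hv _ (hE.1 i hi).2]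

theorem IsPrimitive.continuousOn {F f : ℝ → ℂ} (h : IsPrimitive F f) : ContinuousOn F (Ici 0) := by
  intro x hx
  have hx : (0 : ℝ) ≤ x := hx
  have := continuousOn_of_primitive (fun x hx => (h x hx).1) (fun x hx => (h x hx).2) (x + 1)
    (by linarith) x ⟨hx, by linarith⟩
  refine this.mono_of_mem_nhdsWithin ?_
  rw [mem_nhdsWithin]
  exact ⟨Iio (x + 1), isOpen_Iio, by simp, fun y hy => ⟨hy.2, le_of_lt hy.1⟩⟩

/-- Leibniz rule. -/
theorem IsPrimitive.mul {F f G g : ℝ → ℂ} (hF : IsPrimitive F f) (hG : IsPrimitive G g) :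
    IsPrimitive (fun x => F x * G x) (fun x => f x * G x + F x * g x) := by
  have hint : ∀ b : ℝ, 0 ≤ b →
      IntervalIntegrable (fun x => f x * G x + F x * g x) volume 0 b := by
    intro b hb
    have hs : uIcc 0 b ⊆ Ici (0 : ℝ) := by rw [uIcc_of_le hb]; exact Icc_subset_Ici_self
    exact ((hF b hb).1.mul_continuousOn (hG.continuousOn.mono hs)).add
      ((hG b hb).1.continuousOn_mul (hF.continuousOn.mono hs))
  refine fun b hb => ⟨hint b hb, ?_⟩
  have hc (z : ℂ) : AbsolutelyContinuousOnInterval (fun _ : ℝ => z) 0 b :=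
    (LipschitzWith.const z).lipschitzOnWith.absolutelyContinuousOnInterval (K := 0)
  have hFa := (hc (F 0)).add (absolutelyContinuous_primitive (hF b hb).1)
  have hGa := (hc (G 0)).add (absolutelyContinuous_primitive (hG b hb).1)
  have hH := (hFa.smul hGa).sub (absolutelyContinuous_primitive (hint b hb))
  -- The product minus the candidate primitive is absolutely continuous with zero derivative almost
  -- everywhere, hence constant. Comparing its values at 0 and b gives the formula.
  obtain ⟨C, hC⟩ := hH.const_of_ae_hasDerivAt_zero (by
    filter_upwards [(hF b hb).1.ae_hasDerivAt_integral, (hG b hb).1.ae_hasDerivAt_integral,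
      (hint b hb).ae_hasDerivAt_integral] with x h1 h2 h3 hx
    have hx0 : 0 ≤ x := by rw [uIcc_of_le hb] at hx; exact hx.1
    have h0 : (0 : ℝ) ∈ uIcc 0 b := left_mem_uIcc
    have := (((h1 hx 0 h0).const_add (F 0)).mul ((h2 hx 0 h0).const_add (G 0))).sub (h3 hx 0 h0)
    rw [← (hF x hx0).2, ← (hG x hx0).2, sub_self] at this
    exact this)
  have e0 := hC 0 left_mem_uIcc
  have e1 := hC b right_mem_uIcc
  simp only [Pi.sub_apply, Pi.mul_apply, Pi.add_apply, smul_eq_mul,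
    intervalIntegral.integral_same, add_zero, sub_zero] at e0 e1
  rw [← (hF b hb).2, ← (hG b hb).2, ← e0] at e1
  simp only
  rw [← e1]
  ring

theorem IsPrimitive.add {F f G g : ℝ → ℂ} (hF : IsPrimitive F f) (hG : IsPrimitive G g) :
    IsPrimitive (fun x => F x + G x) (fun x => f x + g x) := fun x hx => by
  refine ⟨(hF x hx).1.add (hG x hx).1, ?_⟩
  rw [intervalIntegral.integral_add (hF x hx).1 (hG x hx).1]
  simp only
  rw [(hF x hx).2, (hG x hx).2]
  ring

theorem IsPrimitive.const_mul {F f : ℝ → ℂ} (hF : IsPrimitive F f) (a : ℂ) :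
    IsPrimitive (fun x => a * F x) (fun x => a * f x) := fun x hx => by
  refine ⟨(hF x hx).1.const_mul a, ?_⟩
  rw [intervalIntegral.integral_const_mul]
  simp only
  rw [(hF x hx).2]
  ring

theorem IsPrimitive.sub {F f G g : ℝ → ℂ} (hF : IsPrimitive F f) (hG : IsPrimitive G g) :
    IsPrimitive (fun x => F x - G x) (fun x => f x - g x) := fun x hx => by
  refine ⟨(hF x hx).1.sub (hG x hx).1, ?_⟩
  rw [intervalIntegral.integral_sub (hF x hx).1 (hG x hx).1]
  simp only
  rw [(hF x hx).2, (hG x hx).2]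
  ring

theorem IsPrimitive.congr {F f g : ℝ → ℂ} (hF : IsPrimitive F f)
    (h : ∀ᵐ x ∂(volume.restrict (Ioi (0 : ℝ))), f x = g x) : IsPrimitive F g := fun x hx => by
  have h1 : f =ᵐ[volume.restrict (uIoc 0 x)] g := by
    rw [uIoc_of_le hx]
    exact ae_mono (Measure.restrict_mono (fun _ ht => ht.1) le_rfl) h
  refine ⟨(hF x hx).1.congr_ae h1, ?_⟩
  rw [← intervalIntegral.integral_congr_ae_restrict h1]
  exact (hF x hx).2

theorem isPrimitive_integral {f : ℝ → ℂ} (h : ∀ x : ℝ, 0 ≤ x → IntervalIntegrable f volume 0 x) :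
    IsPrimitive (fun x => ∫ t in (0 : ℝ)..x, f t) f := fun x hx => ⟨h x hx, by simp⟩

theorem isPrimitive_const (a : ℂ) : IsPrimitive (fun _ => a) (fun _ => 0) := fun x _ =>
  ⟨intervalIntegrable_const, by simp⟩

theorem isPrimitive_of_hasDerivAt {F f : ℝ → ℂ} (h : ∀ x : ℝ, 0 ≤ x → HasDerivAt F (f x) x)
    (hf : ContinuousOn f (Ici 0)) : IsPrimitive F f := fun x hx => by
  have hi : IntervalIntegrable f volume 0 x :=
    (hf.mono (by rw [uIcc_of_le hx]; exact Icc_subset_Ici_self)).intervalIntegrable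
  refine ⟨hi, ?_⟩
  rw [intervalIntegral.integral_eq_sub_of_hasDerivAt (fun y hy => h y ?_) hi]
  · ring
  · rw [uIcc_of_le hx] at hy
    exact hy.1

theorem IsPrimitive.hasDerivWithinAt {F f : ℝ → ℂ} (hF : IsPrimitive F f)
    (hf : ContinuousOn f (Ici 0)) {x : ℝ} (hx : 0 ≤ x) : HasDerivWithinAt F (f x) (Ici x) x := by
  -- Nothing is known of `f` on negative arguments, so it is extended by the constant `f 0`; right
  -- derivatives on the half-line do not notice.
  have hc : Continuous fun y : ℝ => f (max y 0) :=
    hf.comp_continuous (by fun_prop) fun y => mem_Ici.2 (le_max_right _ _)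
  have h1 := (hc.integral_hasStrictDerivAt 0 x).hasDerivAt.const_add (F 0)
  rw [max_eq_left hx] at h1
  refine h1.hasDerivWithinAt.congr (fun y hy => ?_) ?_
  · rw [(hF y (hx.trans hy)).2]
    congr 1
    refine intervalIntegral.integral_congr fun t ht => ?_
    rw [uIcc_of_le (hx.trans hy)] at ht
    simp [ht.1]
  · rw [(hF x hx).2]
    congr 1
    refine intervalIntegral.integral_congr fun t ht => ?_
    rw [uIcc_of_le hx] at ht
    simp [ht.1]

/-! ### Uniqueness for second order linear equations -/

theorem eq_zero_of_second_order {a : ℝ} {u u₁ q : ℝ → ℂ} (hq : ContinuousOn q (Ici a))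
    (hu : ContinuousOn u (Ici a)) (hu₁ : ContinuousOn u₁ (Ici a))
    (h : ∀ x, a ≤ x → HasDerivWithinAt u (u₁ x) (Ici x) x)
    (h₁ : ∀ x, a ≤ x → HasDerivWithinAt u₁ (q x * u x) (Ici x) x)
    (h0 : u a = 0) (h01 : u₁ a = 0) {x : ℝ} (hx : a ≤ x) : u x = 0 ∧ u₁ x = 0 := by
  obtain ⟨K, hK⟩ := isCompact_Icc.exists_bound_of_continuousOn
    (hq.mono (Icc_subset_Ici_self : Icc a x ⊆ Ici a))
  have hv : ∀ t ∈ Ico a x, LipschitzOnWith (max 1 K.toNNReal)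
      (fun p : ℂ × ℂ => (p.2, q t * p.1)) univ := by
    intro t ht
    refine LipschitzWith.lipschitzOnWith (LipschitzWith.of_dist_le_mul fun p r => ?_)
    have hqt : ‖q t‖ ≤ K := hK t ⟨ht.1, ht.2.le⟩
    have hK0 : 0 ≤ K := (norm_nonneg _).trans hqt
    simp only [Prod.dist_eq, NNReal.coe_max, NNReal.coe_one, Real.coe_toNNReal _ hK0]
    refine max_le ?_ ?_
    · calc dist p.2 r.2 ≤ 1 * max (dist p.1 r.1) (dist p.2 r.2) := by simp
        _ ≤ _ := by gcongr; exact le_max_left _ _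
    · rw [dist_eq_norm, ← mul_sub, norm_mul, ← dist_eq_norm]
      gcongr
      · exact hqt.trans (le_max_right _ _)
      · exact le_max_left _ _
  have := ODE_solution_unique_of_mem_Icc_right (a := a) (b := x) (f := fun t => (u t, u₁ t))
    (g := fun _ => (0, 0)) (s := fun _ => univ) hv
    ((hu.prodMk hu₁).mono Icc_subset_Ici_self)
    (fun t ht => (h t ht.1).prodMk (h₁ t ht.1)) (fun _ _ => mem_univ _) continuousOn_const
    (fun t ht => (hasDerivWithinAt_const t (Ici t) ((0 : ℂ), (0 : ℂ))).congr_deriv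
      (by simp [Prod.ext_iff]))
    (fun _ _ => mem_univ _) (by simp [h0, h01]) ⟨hx, le_rfl⟩
  simpa using this

theorem IsPrimitive.eq_zero_of_second_order {u u₁ q : ℝ → ℂ} (hq : ContinuousOn q (Ici 0))
    (h : IsPrimitive u u₁) (h₁ : IsPrimitive u₁ fun x => q x * u x) (h0 : u 0 = 0)
    (h01 : u₁ 0 = 0) {x : ℝ} (hx : 0 ≤ x) : u x = 0 ∧ u₁ x = 0 :=
  AirySpectrum.eq_zero_of_second_order hq h.continuousOn h₁.continuousOn
    (fun _ hy => h.hasDerivWithinAt h₁.continuousOn hy)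
    (fun _ hy => h₁.hasDerivWithinAt (hq.mul h.continuousOn) hy) h0 h01 hx

/-! ### Elementary properties of the Airy function -/

theorem hasDerivAt_airyAi (z : ℂ) : HasDerivAt airyAi (deriv airyAi z) z :=
  (airyAi_spec.1 z).hasDerivAt

theorem hasDerivAt_deriv_airyAi (z : ℂ) : HasDerivAt (deriv airyAi) (z * airyAi z) z := by
  rw [← airyAi_spec.2.1 z]
  exact ((airyAi_spec.1.analyticAt z).deriv).differentiableAt.hasDerivAt

theorem continuous_airyAi : Continuous airyAi := airyAi_spec.1.continuous

theorem continuous_deriv_airyAi : Continuous (deriv airyAi) :=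
  continuous_iff_continuousAt.2 fun z => (hasDerivAt_deriv_airyAi z).continuousAt

/-- The real number `Ai 0`. -/
def airyZero : ℝ := 1 / ((3 : ℝ) ^ (2 / 3 : ℝ) * Real.Gamma (2 / 3))

/-- The real number `-Ai' 0`. -/
def airySlope : ℝ := 1 / ((3 : ℝ) ^ (1 / 3 : ℝ) * Real.Gamma (1 / 3))

theorem airyZero_pos : 0 < airyZero := by
  have := Real.Gamma_pos_of_pos (show (0 : ℝ) < 2 / 3 by norm_num)
  unfold airyZero
  positivity

theorem airySlope_pos : 0 < airySlope := by
  have := Real.Gamma_pos_of_pos (show (0 : ℝ) < 1 / 3 by norm_num)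
  unfold airySlope
  positivity

theorem airyAi_zero : airyAi 0 = airyZero := airyAi_spec.2.2.1

theorem deriv_airyAi_zero : deriv airyAi 0 = -(airySlope : ℂ) := by
  rw [airyAi_spec.2.2.2, airySlope]
  push_cast
  rfl

theorem hasDerivAt_airyAi_line (z₀ κ : ℂ) (x : ℝ) :
    HasDerivAt (fun x : ℝ => airyAi (z₀ + κ * x)) (κ * deriv airyAi (z₀ + κ * x)) x := by
  have h : HasDerivAt (fun x : ℝ => z₀ + κ * x) κ x := by
    simpa using ((hasDerivAt_id x).ofReal_comp.const_mul κ).const_add z₀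
  exact ((hasDerivAt_airyAi (z₀ + κ * x)).comp x h).congr_deriv (mul_comm _ _)

theorem hasDerivAt_deriv_airyAi_line (z₀ κ : ℂ) (x : ℝ) :
    HasDerivAt (fun x : ℝ => κ * deriv airyAi (z₀ + κ * x))
      (κ ^ 2 * (z₀ + κ * x) * airyAi (z₀ + κ * x)) x := by
  have h : HasDerivAt (fun x : ℝ => z₀ + κ * x) κ x := by
    simpa using ((hasDerivAt_id x).ofReal_comp.const_mul κ).const_add z₀
  refine (((hasDerivAt_deriv_airyAi (z₀ + κ * x)).comp x h).const_mul κ).congr_deriv ?_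
  ring

theorem isPrimitive_airyAi_line (z₀ κ : ℂ) :
    IsPrimitive (fun x : ℝ => airyAi (z₀ + κ * x)) fun x => κ * deriv airyAi (z₀ + κ * x) :=
  isPrimitive_of_hasDerivAt (fun x _ => hasDerivAt_airyAi_line z₀ κ x)
    (fun x _ => (hasDerivAt_deriv_airyAi_line z₀ κ x).continuousAt.continuousWithinAt)

theorem isPrimitive_deriv_airyAi_line (z₀ κ : ℂ) :
    IsPrimitive (fun x : ℝ => κ * deriv airyAi (z₀ + κ * x))
      fun x => κ ^ 2 * (z₀ + κ * x) * airyAi (z₀ + κ * x) := by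
  refine isPrimitive_of_hasDerivAt (fun x _ => hasDerivAt_deriv_airyAi_line z₀ κ x) ?_
  have := continuous_airyAi
  exact Continuous.continuousOn (by fun_prop)

/-- An entire solution of the Airy equation with zero initial data vanishes. -/
theorem eq_zero_of_airy_equation {g g₁ : ℂ → ℂ} (h : ∀ z, HasDerivAt g (g₁ z) z)
    (h₁ : ∀ z, HasDerivAt g₁ (z * g z) z) {z₀ : ℂ} (h0 : g z₀ = 0) (h01 : g₁ z₀ = 0) (z : ℂ) :
    g z = 0 := by
  -- Restriction to the segment from `z₀` to `z` turns the complex equation into one along a real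
  -- variable.
  have hl : ∀ x : ℝ, HasDerivAt (fun x : ℝ => z₀ + (z - z₀) * x) (z - z₀) x := fun x => by
    simpa using ((hasDerivAt_id x).ofReal_comp.const_mul (z - z₀)).const_add z₀
  have hu : ∀ x : ℝ, HasDerivAt (fun x : ℝ => g (z₀ + (z - z₀) * x))
      ((z - z₀) * g₁ (z₀ + (z - z₀) * x)) x := fun x => by
    exact ((h (z₀ + (z - z₀) * x)).comp x (hl x)).congr_deriv (mul_comm _ _)
  have hu₁ : ∀ x : ℝ, HasDerivAt (fun x : ℝ => (z - z₀) * g₁ (z₀ + (z - z₀) * x))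
      ((z - z₀) ^ 2 * (z₀ + (z - z₀) * x) * g (z₀ + (z - z₀) * x)) x := fun x => by
    exact (((h₁ (z₀ + (z - z₀) * x)).comp x (hl x)).const_mul (z - z₀)).congr_deriv (by ring)
  have := (eq_zero_of_second_order (a := 0) (q := fun x => (z - z₀) ^ 2 * (z₀ + (z - z₀) * x))
    (Continuous.continuousOn (by fun_prop))
    (fun x _ => (hu x).continuousAt.continuousWithinAt)
    (fun x _ => (hu₁ x).continuousAt.continuousWithinAt)
    (fun x _ => (hu x).hasDerivWithinAt) (fun x _ => (hu₁ x).hasDerivWithinAt)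
    (by simpa using h0) (by simp [h01]) zero_le_one).1
  simpa using this

/-- A double zero would make Ai vanish identically, against Ai(0) > 0. -/
theorem deriv_airyAi_ne_zero {z : ℂ} (h : airyAi z = 0) : deriv airyAi z ≠ 0 := fun h1 => by
  have := eq_zero_of_airy_equation hasDerivAt_airyAi hasDerivAt_deriv_airyAi h h1 0
  rw [airyAi_zero] at this
  exact airyZero_pos.ne' (by exact_mod_cast this)

/-- Ai is real on the real axis. -/
theorem airyAi_conj (z : ℂ) : airyAi (starRingEnd ℂ z) = starRingEnd ℂ (airyAi z) := by
  have hc : ∀ n, starRingEnd ℂ (airyCoeff n) = airyCoeff n := by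
    intro n
    induction n using Nat.strong_induction_on with
    | _ n ih =>
      match n, ih with
      | 0, _ => exact Complex.conj_ofReal _
      | 1, _ => exact Complex.conj_ofReal _
      | 2, _ => simp [airyCoeff]
      | n + 3, ih => rw [airyCoeff, map_div₀, ih n (by omega)]; simp [Complex.conj_ofNat]
  simp only [airyAi]
  rw [Complex.conj_tsum]
  exact tsum_congr fun n => by rw [map_mul, map_pow, hc]

/-- The three rotated Airy functions are linearly dependent. -/
theorem airyAi_connection {w : ℂ} (hw : w ^ 2 + w + 1 = 0) (z : ℂ) :
    airyAi z + w * airyAi (w * z) + w ^ 2 * airyAi (w ^ 2 * z) = 0 := by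
  have h3 : w ^ 3 = 1 := by linear_combination (w - 1) * hw
  have hl : ∀ (a z : ℂ), HasDerivAt (fun z => a * z) a z := fun a z => by
    simpa using (hasDerivAt_id z).const_mul a
  have hA : ∀ (a z : ℂ), HasDerivAt (fun z => airyAi (a * z)) (deriv airyAi (a * z) * a) z :=
    fun a z => (hasDerivAt_airyAi (a * z)).comp z (hl a z)
  have hB : ∀ (a z : ℂ), HasDerivAt (fun z => deriv airyAi (a * z))
      (a * z * airyAi (a * z) * a) z :=
    fun a z => (hasDerivAt_deriv_airyAi (a * z)).comp z (hl a z)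
  -- Rotation by a cube root of unity preserves the Airy equation, and both initial data of the sum
  -- contain the factor 1 + w + w².
  refine eq_zero_of_airy_equation (z₀ := 0)
    (g := fun z => airyAi z + w * airyAi (w * z) + w ^ 2 * airyAi (w ^ 2 * z))
    (g₁ := fun z => deriv airyAi z + w * (deriv airyAi (w * z) * w) +
      w ^ 2 * (deriv airyAi (w ^ 2 * z) * w ^ 2))
    (fun z => ((hasDerivAt_airyAi z).add ((hA w z).const_mul w)).add
      ((hA (w ^ 2) z).const_mul (w ^ 2))) (fun z => ?_) ?_ ?_ z
  · refine (((hasDerivAt_deriv_airyAi z).add (((hB w z).mul_const w).const_mul w)).add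
      (((hB (w ^ 2) z).mul_const (w ^ 2)).const_mul (w ^ 2))).congr_deriv ?_
    linear_combination -(-w * airyAi (w * z) * z - z * w ^ 2 * airyAi (w ^ 2 * z) * (w ^ 3 + 1)) * h3
  · simp only [mul_zero]
    linear_combination airyAi 0 * hw
  · simp only [mul_zero]
    linear_combination deriv airyAi 0 * hw + deriv airyAi 0 * w * h3

/-! ### Laplace type integrals -/

theorem norm_cexp_neg_mul (w : ℂ) (r : ℝ) :
    ‖Complex.exp (-w * r)‖ = Real.exp (-w.re * r) := by
  rw [Complex.norm_exp]
  simp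

theorem integrable_laplace {μ : Measure ℝ} {f : ℝ → ℂ} {p : ℝ → ℝ} (hp : Measurable p)
    (hf : AEStronglyMeasurable f μ) {w : ℂ}
    (hi : Integrable (fun v => ‖f v‖ * Real.exp (-w.re * p v)) μ) :
    Integrable (fun v => f v * Complex.exp (-w * p v)) μ := by
  refine hi.mono' (hf.mul (by fun_prop)) (Eventually.of_forall fun v => ?_)
  rw [norm_mul, norm_cexp_neg_mul]

/-- Differentiation under the integral: for a strictly between `a₀` and Re w, the exponential at a
dominates on the half-plane Re z > a because p ≥ 0. -/
theorem hasDerivAt_laplace {μ : Measure ℝ} {f : ℝ → ℂ} {p : ℝ → ℝ} {a₀ : ℝ} (hp : Measurable p)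
    (hp0 : ∀ᵐ v ∂μ, 0 ≤ p v) (hf : AEStronglyMeasurable f μ)
    (hi : ∀ a > a₀, Integrable (fun v => ‖f v‖ * Real.exp (-a * p v)) μ)
    (hi' : ∀ a > a₀, Integrable (fun v => ‖p v * f v‖ * Real.exp (-a * p v)) μ)
    {w : ℂ} (hw : a₀ < w.re) :
    HasDerivAt (fun w => ∫ v, f v * Complex.exp (-w * p v) ∂μ)
      (-∫ v, p v * f v * Complex.exp (-w * p v) ∂μ) w := by
  obtain ⟨a, ha0, ha⟩ := exists_between hw
  have hs : {z : ℂ | a < z.re} ∈ 𝓝 w :=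
    (isOpen_lt continuous_const Complex.continuous_re).mem_nhds ha
  have key := (hasDerivAt_integral_of_dominated_loc_of_deriv_le (μ := μ)
    (F := fun w v => f v * Complex.exp (-w * p v))
    (F' := fun w v => -(p v * f v * Complex.exp (-w * p v))) (x₀ := w)
    (bound := fun v => ‖p v * f v‖ * Real.exp (-a * p v)) hs ?_ ?_ ?_ ?_ (hi' a ha0) ?_).2
  · rwa [integral_neg] at key
  · exact Eventually.of_forall fun z => hf.mul (by fun_prop)
  · exact integrable_laplace hp hf (hi _ hw)
  · exact ((AEStronglyMeasurable.mul (by fun_prop) hf).mul (by fun_prop)).neg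
  · filter_upwards [hp0] with v hv z hz
    have hz : a < z.re := hz
    rw [norm_neg, norm_mul, norm_cexp_neg_mul]
    gcongr
  · filter_upwards with v z hz
    have h1 : HasDerivAt (fun w : ℂ => -w * p v) (-(p v : ℂ)) z := by
      simpa using (hasDerivAt_id z).neg.mul_const (p v : ℂ)
    exact (h1.cexp.const_mul (f v)).congr_deriv (by ring)

/-! ### The integrals over the half-line -/

theorem integrableOn_pow_mul_exp_neg (n : ℕ) :
    IntegrableOn (fun s : ℝ => s ^ n * Real.exp (-s)) (Ioi 0) := by
  have := integrableOn_rpow_mul_exp_neg_mul_rpow (p := 1) (s := n) (b := 1)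
    (by have : (0 : ℝ) ≤ n := Nat.cast_nonneg n
        linarith) one_pos one_pos
  simpa using this

/-- Lets the cubic exponent absorb any linear one: s ≥ 3m + 1 already gives s² ≥ 3m, and smaller s
are covered by the constant. -/
theorem linear_le_cube_add (m : ℝ) (hm : 0 ≤ m) {s : ℝ} (hs : 0 ≤ s) :
    m * s ≤ s ^ 3 / 3 + m * (3 * m + 1) := by
  rcases le_total s (3 * m + 1) with h | h
  · have := mul_le_mul_of_nonneg_left h hm
    have : 0 ≤ s ^ 3 / 3 := by positivity
    linarith
  · have h2 : 3 * m ≤ s ^ 2 := by nlinarith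
    nlinarith [mul_nonneg hm (by positivity : (0 : ℝ) ≤ 3 * m + 1)]

theorem integrableOn_cubic (n : ℕ) (a : ℝ) :
    IntegrableOn (fun s : ℝ => ‖((s : ℂ) ^ n * (Real.exp (-(s ^ 3 / 3)) : ℂ))‖ *
      Real.exp (-a * s)) (Ioi 0) := by
  -- This slope leaves one factor exp(-s) after the cubic has absorbed the rest.
  set m := |1 - a|
  refine ((integrableOn_pow_mul_exp_neg n).const_mul (Real.exp (m * (3 * m + 1)))).mono'
    (Continuous.aestronglyMeasurable (by fun_prop)) ?_
  filter_upwards [ae_restrict_mem measurableSet_Ioi] with s hs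
  have hs0 : 0 ≤ s := le_of_lt hs
  rw [norm_mul, norm_norm, norm_mul, norm_pow, Complex.norm_real, Complex.norm_real,
    Real.norm_of_nonneg hs0, Real.norm_of_nonneg (Real.exp_nonneg _),
    Real.norm_of_nonneg (Real.exp_nonneg _), mul_assoc, ← Real.exp_add, mul_left_comm,
    ← Real.exp_add]
  refine mul_le_mul_of_nonneg_left (Real.exp_le_exp.2 ?_) (by positivity)
  have h1 := linear_le_cube_add m (abs_nonneg _) hs0
  have h2 : (1 - a) * s ≤ m * s := by gcongr; exact le_abs_self _
  linarith

/-- The integrals `∫₀^∞ sⁿ exp (-s³/3 - z s) ds`. -/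
def cubicMoment (n : ℕ) (z : ℂ) : ℂ :=
  ∫ s in Ioi (0 : ℝ), (s : ℂ) ^ n * (Real.exp (-(s ^ 3 / 3)) : ℂ) * Complex.exp (-z * s)

theorem hasDerivAt_cubicMoment (n : ℕ) (z : ℂ) :
    HasDerivAt (cubicMoment n) (-cubicMoment (n + 1) z) z := by
  have := hasDerivAt_laplace (μ := volume.restrict (Ioi (0 : ℝ))) (p := fun s => s)
    (f := fun s : ℝ => (s : ℂ) ^ n * (Real.exp (-(s ^ 3 / 3)) : ℂ)) (a₀ := z.re - 1) measurable_id
    ((ae_restrict_mem measurableSet_Ioi).mono fun s hs => le_of_lt hs)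
    (Continuous.aestronglyMeasurable (by fun_prop)) (fun a _ => integrableOn_cubic n a)
    (fun a _ => by
      refine (integrableOn_cubic (n + 1) a).congr (Eventually.of_forall fun s => ?_)
      simp only [pow_succ']
      rw [mul_assoc]) (w := z) (by linarith)
  refine this.congr_deriv ?_
  rw [cubicMoment]
  congr 2
  ext s
  ring

theorem integrableOn_cubicMoment (n : ℕ) (z : ℂ) :
    IntegrableOn (fun s : ℝ => (s : ℂ) ^ n * (Real.exp (-(s ^ 3 / 3)) : ℂ) * Complex.exp (-z * s))
      (Ioi 0) :=
  integrable_laplace (p := fun s => s) measurable_id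
    (Continuous.aestronglyMeasurable (by fun_prop)) (integrableOn_cubic n z.re)

theorem norm_cubicMoment_le (n : ℕ) {z : ℂ} (hz : 0 ≤ z.re) :
    ‖cubicMoment n z‖ ≤ ∫ s in Ioi (0 : ℝ), ‖(s : ℂ) ^ n * (Real.exp (-(s ^ 3 / 3)) : ℂ)‖ := by
  refine norm_integral_le_of_norm_le ?_ ?_
  · have := integrableOn_cubic n 0
    simp only [neg_zero, zero_mul, Real.exp_zero, mul_one] at this
    exact this
  · filter_upwards [ae_restrict_mem measurableSet_Ioi] with s hs
    rw [norm_mul, norm_cexp_neg_mul]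
    refine mul_le_of_le_one_right (norm_nonneg _) (Real.exp_le_one_iff.2 ?_)
    have hs : 0 < s := hs
    nlinarith

/-- The derivative of exp(-s³/3 - zs) integrates to -1 over the half-line. Thus the moment of order
zero solves the inhomogeneous equation y'' + zy = 1. -/
theorem cubicMoment_relation (z : ℂ) : cubicMoment 2 z + z * cubicMoment 0 z = 1 := by
  have hd : ∀ s : ℝ, HasDerivAt
      (fun s : ℝ => (Real.exp (-(s ^ 3 / 3)) : ℂ) * Complex.exp (-z * s))
      (-((s : ℂ) ^ 2 * (Real.exp (-(s ^ 3 / 3)) : ℂ) * Complex.exp (-z * s) +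
        z * ((s : ℂ) ^ 0 * (Real.exp (-(s ^ 3 / 3)) : ℂ) * Complex.exp (-z * s)))) s := fun s => by
    have h1 : HasDerivAt (fun s : ℝ => -(s ^ 3 / 3)) (-(s ^ 2)) s :=
      (((hasDerivAt_pow 3 s).div_const 3).neg).congr_deriv (by norm_num)
    have h2 : HasDerivAt (fun s : ℝ => -z * (s : ℂ)) (-z) s := by
      simpa using ((hasDerivAt_id s).ofReal_comp.const_mul (-z))
    refine ((h1.exp.ofReal_comp).mul h2.cexp).congr_deriv ?_
    push_cast
    ring
  have hint := ((integrableOn_cubicMoment 2 z).add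
    ((integrableOn_cubicMoment 0 z).const_mul z)).neg
  have hint0 := integrableOn_cubicMoment 0 z
  have ht := tendsto_zero_of_hasDerivAt_of_integrableOn_Ioi (fun s _ => hd s) hint
    (by simpa using hint0)
  have := integral_Ioi_of_hasDerivAt_of_tendsto' (fun s _ => hd s) hint ht
  rw [integral_neg, integral_add (integrableOn_cubicMoment 2 z)
    ((integrableOn_cubicMoment 0 z).const_mul z), integral_const_mul] at this
  simp only [cubicMoment]
  have e : (Real.exp (-((0 : ℝ) ^ 3 / 3)) : ℂ) * Complex.exp (-z * ((0 : ℝ) : ℂ)) = 1 := by simp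
  rw [e] at this
  linear_combination -this

theorem cubicMoment_at_zero (n : ℕ) : cubicMoment n 0 =
    ((1 / 3 : ℝ) ^ (-((n : ℝ) + 1) / 3) * (1 / 3) * Real.Gamma (((n : ℝ) + 1) / 3) : ℝ) := by
  rw [← integral_rpow_mul_exp_neg_mul_rpow (p := 3) (q := n) (b := 1 / 3) (by norm_num)
    (by have : (0 : ℝ) ≤ n := Nat.cast_nonneg n
        linarith) (by norm_num), ← integral_complex_ofReal, cubicMoment]
  refine setIntegral_congr_fun measurableSet_Ioi fun s _ => ?_
  simp only [neg_zero, zero_mul, Complex.exp_zero, mul_one, Real.rpow_natCast]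
  rw [show (3 : ℝ) = ((3 : ℕ) : ℝ) by norm_num, Real.rpow_natCast]
  push_cast
  congr 2
  ring

/-- The moments of orders zero and one at the origin are in the ratio of the Airy data. -/
theorem cubicMoment_ratio : cubicMoment 0 0 * airySlope = cubicMoment 1 0 * airyZero := by
  rw [cubicMoment_at_zero, cubicMoment_at_zero, airySlope, airyZero]
  norm_cast
  have h1 := Real.Gamma_pos_of_pos (show (0 : ℝ) < 1 / 3 by norm_num)
  have h2 := Real.Gamma_pos_of_pos (show (0 : ℝ) < 2 / 3 by norm_num)
  have e1 : (1 / 3 : ℝ) ^ (-1 / 3 : ℝ) = 3 ^ (1 / 3 : ℝ) := by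
    rw [one_div, Real.inv_rpow (by norm_num), ← Real.rpow_neg (by norm_num)]
    norm_num
  have e2 : (1 / 3 : ℝ) ^ (-2 / 3 : ℝ) = 3 ^ (2 / 3 : ℝ) := by
    rw [one_div, Real.inv_rpow (by norm_num), ← Real.rpow_neg (by norm_num)]
    norm_num
  push_cast
  rw [e1, e2]
  field_simp

theorem cubicMoment_zero_ne : cubicMoment 0 0 ≠ 0 := by
  have h1 := Real.Gamma_pos_of_pos (show (0 : ℝ) < ((0 : ℕ) + 1) / 3 by norm_num)
  rw [cubicMoment_at_zero, Complex.ofReal_ne_zero]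
  positivity

/-- The Airy function and its derivative are bounded on the positive half-line. -/
theorem airyAi_bounded : ∃ M : ℝ, ∀ x : ℝ, 0 ≤ x → ‖airyAi x‖ ≤ M ∧ ‖deriv airyAi x‖ ≤ M := by
  -- The numbers `o` and `p` are exp(±iπ/3): they satisfy a³ = -1 and have positive real part. The
  -- first fact turns y'' + zy = 1 into an Airy type equation, the second keeps the moments bounded
  -- on the positive axis.
  set o : ℂ := ⟨1 / 2, √3 / 2⟩ with ho
  set p : ℂ := ⟨1 / 2, -(√3 / 2)⟩ with hp
  have h3 : √3 * √3 = 3 := Real.mul_self_sqrt (by norm_num)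
  have hop : o + p = 1 := by
    apply Complex.ext <;> simp [ho, hp] <;> norm_num
  have hm : o * p = 1 := by
    apply Complex.ext <;> simp [ho, hp] <;> nlinarith
  have hne : o - p ≠ 0 := by
    intro h
    have := congrArg Complex.im h
    simp [ho, hp] at this
  have ho2 : o ^ 2 = o - 1 := by linear_combination o * hop - hm
  have hp2 : p ^ 2 = p - 1 := by linear_combination p * hop - hm
  have hl : ∀ (a z : ℂ), HasDerivAt (fun z => a * z) a z := fun a z => by
    simpa using (hasDerivAt_id z).const_mul a
  have hc : ∀ (n : ℕ) (a z : ℂ), HasDerivAt (fun z => cubicMoment n (a * z))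
      (-cubicMoment (n + 1) (a * z) * a) z := fun n a z =>
    (hasDerivAt_cubicMoment n (a * z)).comp z (hl a z)
  -- Each a·M₀(az) with a³ = -1 satisfies y'' = zy - 1, so the inhomogeneities cancel in the
  -- difference.
  set D : ℂ → ℂ := fun z => o * cubicMoment 0 (o * z) - p * cubicMoment 0 (p * z) with hD
  set D₁ : ℂ → ℂ := fun z => -(o ^ 2 * cubicMoment 1 (o * z)) + p ^ 2 * cubicMoment 1 (p * z)
    with hD₁
  have hd : ∀ z, HasDerivAt D (D₁ z) z := fun z =>
    (((hc 0 o z).const_mul o).sub ((hc 0 p z).const_mul p)).congr_deriv (by simp only [hD₁]; ring)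
  have hd₁ : ∀ z, HasDerivAt D₁ (z * D z) z := fun z => by
    refine (((hc 1 o z).const_mul (o ^ 2)).neg.add ((hc 1 p z).const_mul (p ^ 2))).congr_deriv ?_
    have e1 := cubicMoment_relation (o * z)
    have e2 := cubicMoment_relation (p * z)
    have ho3 : o ^ 3 = -1 := by linear_combination (o + 1) * ho2
    have hp3 : p ^ 3 = -1 := by linear_combination (p + 1) * hp2
    simp only [hD]
    linear_combination cubicMoment 2 (o * z) * ho3 - cubicMoment 2 (p * z) * hp3 - e1 + e2
  have hD0 : D 0 = (o - p) * cubicMoment 0 0 := by simp only [hD, mul_zero]; ring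
  have hD0' : D 0 ≠ 0 := by rw [hD0]; exact mul_ne_zero hne cubicMoment_zero_ne
  have hD10 : D₁ 0 = -((o - p) * cubicMoment 1 0) := by
    simp only [hD₁, mul_zero, ho2, hp2]; ring
  -- The factor Ai(0)/D(0) matches the values at the origin; the Gamma function ratio in
  -- `cubicMoment_ratio` then matches the derivatives.
  have hz := eq_zero_of_airy_equation (g := fun z => airyAi z - airyZero / D 0 * D z)
    (g₁ := fun z => deriv airyAi z - airyZero / D 0 * D₁ z) (z₀ := 0)
    (fun z => (hasDerivAt_airyAi z).sub ((hd z).const_mul _))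
    (fun z => ((hasDerivAt_deriv_airyAi z).sub ((hd₁ z).const_mul _)).congr_deriv (by ring))
    (by simp only [airyAi_zero]; field_simp; ring)
    (by
      simp only [deriv_airyAi_zero]
      rw [hD10, hD0]
      have := cubicMoment_ratio
      have h0 := cubicMoment_zero_ne
      field_simp
      linear_combination -this)
  have hA : airyAi = fun z => airyZero / D 0 * D z := funext fun z => sub_eq_zero.1 (hz z)
  have hA1 : deriv airyAi = fun z => airyZero / D 0 * D₁ z := by
    rw [hA]; exact funext fun z => ((hd z).const_mul _).deriv
  have hb : ∀ n, ∃ K : ℝ, 0 ≤ K ∧ ∀ x : ℝ, 0 ≤ x → ‖cubicMoment n (o * x)‖ ≤ K ∧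
      ‖cubicMoment n (p * x)‖ ≤ K := fun n =>
    ⟨_, integral_nonneg fun s => norm_nonneg _, fun x hx =>
      ⟨norm_cubicMoment_le n (by simp [ho]; positivity),
        norm_cubicMoment_le n (by simp [hp]; positivity)⟩⟩
  obtain ⟨K₀, hK0, h0⟩ := hb 0
  obtain ⟨K₁, hK1, h1⟩ := hb 1
  set A := ‖(airyZero : ℂ) / D 0‖
  refine ⟨A * (‖o‖ * K₀ + ‖p‖ * K₀) + A * (‖o ^ 2‖ * K₁ + ‖p ^ 2‖ * K₁), fun x hx => ⟨?_, ?_⟩⟩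
  · rw [hA]
    simp only [hD]
    refine (norm_mul_le _ _).trans (le_add_of_le_of_nonneg ?_ (by positivity))
    refine mul_le_mul_of_nonneg_left ?_ (norm_nonneg _)
    refine (norm_sub_le _ _).trans ?_
    rw [norm_mul, norm_mul]
    gcongr
    exacts [(h0 x hx).1, (h0 x hx).2]
  · rw [hA1]
    simp only [hD₁]
    refine (norm_mul_le _ _).trans (le_add_of_nonneg_of_le (by positivity) ?_)
    refine mul_le_mul_of_nonneg_left ?_ (norm_nonneg _)
    refine (norm_add_le _ _).trans ?_
    rw [norm_neg, norm_mul, norm_mul]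
    gcongr
    exacts [(h1 x hx).1, (h1 x hx).2]

/-! ### The saddle point integrals -/

theorem integrable_pow_mul_exp_neg_mul_sq (n : ℕ) {a : ℝ} (ha : 0 < a) :
    Integrable fun v : ℝ => v ^ n * Real.exp (-a * v ^ 2) := by
  have := integrable_rpow_mul_exp_neg_mul_sq (b := a) ha (s := n)
    (by have : (0 : ℝ) ≤ n := Nat.cast_nonneg n
        linarith)
  simpa using this

/-- The unimodular factor `exp (-i v³/3)`. -/
def cubicPhase (v : ℝ) : ℂ := Complex.exp (-(Complex.I * (v : ℂ) ^ 3 / 3))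

theorem continuous_cubicPhase : Continuous cubicPhase := by
  unfold cubicPhase
  fun_prop

theorem norm_cubicPhase (v : ℝ) : ‖cubicPhase v‖ = 1 := by
  rw [cubicPhase, show -(Complex.I * (v : ℂ) ^ 3 / 3) = ((-(v ^ 3 / 3) : ℝ) : ℂ) * Complex.I by
    push_cast; ring]
  exact Complex.norm_exp_ofReal_mul_I _

theorem integrable_saddle_norm (n : ℕ) {a : ℝ} (ha : 0 < a) :
    Integrable fun v : ℝ => ‖(v : ℂ) ^ n * cubicPhase v‖ * Real.exp (-a * v ^ 2) := by
  refine (integrable_pow_mul_exp_neg_mul_sq n ha).norm.congr (Eventually.of_forall fun v => ?_)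
  simp [norm_cubicPhase]

/-- The integrals `∫ vⁿ exp (-w v² - i v³/3) dv` over the real line. -/
def saddleMoment (n : ℕ) (w : ℂ) : ℂ :=
  ∫ v : ℝ, (v : ℂ) ^ n * cubicPhase v * Complex.exp (-w * (v ^ 2 : ℝ))

theorem integrable_saddleMoment (n : ℕ) {w : ℂ} (hw : 0 < w.re) :
    Integrable fun v : ℝ => (v : ℂ) ^ n * cubicPhase v * Complex.exp (-w * (v ^ 2 : ℝ)) :=
  integrable_laplace (p := fun v => v ^ 2) (by fun_prop)
    (Continuous.aestronglyMeasurable (by have := continuous_cubicPhase; fun_prop))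
    (integrable_saddle_norm n hw)

theorem hasDerivAt_saddleMoment (n : ℕ) {w : ℂ} (hw : 0 < w.re) :
    HasDerivAt (saddleMoment n) (-saddleMoment (n + 2) w) w := by
  have := hasDerivAt_laplace (μ := volume) (p := fun v => v ^ 2)
    (f := fun v : ℝ => (v : ℂ) ^ n * cubicPhase v) (a₀ := 0) (by fun_prop)
    (Eventually.of_forall fun v => by positivity)
    (Continuous.aestronglyMeasurable (by have := continuous_cubicPhase; fun_prop))
    (fun a ha => integrable_saddle_norm n ha)
    (fun a ha => by
      refine (integrable_saddle_norm (n + 2) ha).congr (Eventually.of_forall fun s => ?_)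
      simp only
      congr 2
      push_cast
      ring) hw
  refine this.congr_deriv ?_
  rw [saddleMoment]
  congr 2
  ext v
  push_cast
  ring

/-- The derivative of the integrand of order n integrates to zero over the line. For n = 0 the
truncated index n - 1 is harmless because its coefficient vanishes. -/
theorem saddleMoment_relation (n : ℕ) {w : ℂ} (hw : 0 < w.re) :
    n * saddleMoment (n - 1) w - 2 * w * saddleMoment (n + 1) w -
      Complex.I * saddleMoment (n + 2) w = 0 := by
  have hd : ∀ v : ℝ, HasDerivAt
      (fun v : ℝ => (v : ℂ) ^ n * cubicPhase v * Complex.exp (-w * (v ^ 2 : ℝ)))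
      (n * ((v : ℂ) ^ (n - 1) * cubicPhase v * Complex.exp (-w * (v ^ 2 : ℝ))) -
        2 * w * ((v : ℂ) ^ (n + 1) * cubicPhase v * Complex.exp (-w * (v ^ 2 : ℝ))) -
        Complex.I * ((v : ℂ) ^ (n + 2) * cubicPhase v * Complex.exp (-w * (v ^ 2 : ℝ)))) v := by
    intro v
    have h0 : HasDerivAt (fun v : ℝ => (v : ℂ)) 1 v := (hasDerivAt_id v).ofReal_comp
    have h3 : HasDerivAt (fun v : ℝ => -(Complex.I * (v : ℂ) ^ 3 / 3)) (-(Complex.I * v ^ 2)) v :=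
      (((h0.pow 3).const_mul Complex.I).div_const 3).neg.congr_deriv (by push_cast; ring)
    have h1 : HasDerivAt cubicPhase (cubicPhase v * -(Complex.I * v ^ 2)) v := h3.cexp
    have h2 : HasDerivAt (fun v : ℝ => -w * ((v ^ 2 : ℝ) : ℂ)) (-w * (2 * v)) v :=
      (((hasDerivAt_pow 2 v).ofReal_comp).const_mul (-w)).congr_deriv (by push_cast; ring)
    refine (((h0.pow n).mul h1).mul h2.cexp).congr_deriv ?_
    simp only [Pi.mul_apply, Pi.pow_apply]
    ring
  have i1 := (integrable_saddleMoment (n - 1) hw).const_mul (n : ℂ)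
  have i2 := (integrable_saddleMoment (n + 1) hw).const_mul (2 * w)
  have i3 := (integrable_saddleMoment (n + 2) hw).const_mul Complex.I
  have := integral_eq_zero_of_hasDerivAt_of_integrable hd ((i1.sub i2).sub i3)
    (integrable_saddleMoment n hw)
  have e := integral_sub (i1.sub i2) i3
  simp only [Pi.sub_apply] at e
  rw [e, integral_sub i1 i2, integral_const_mul, integral_const_mul, integral_const_mul] at this
  exact this

theorem norm_saddleMoment_le (n : ℕ) {w : ℂ} (hw : 0 < w.re) :
    ‖saddleMoment n w‖ ≤ ∫ v : ℝ, |v| ^ n * Real.exp (-w.re * v ^ 2) := by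
  refine norm_integral_le_of_norm_le ?_ (Eventually.of_forall fun v => ?_)
  · exact (integrable_pow_mul_exp_neg_mul_sq n hw).norm.congr
      (Eventually.of_forall fun v => by simp)
  · rw [norm_mul, norm_mul, norm_cubicPhase, norm_cexp_neg_mul]
    simp

theorem norm_saddleMoment_zero_le {w : ℂ} (hw : 0 < w.re) :
    ‖saddleMoment 0 w‖ ≤ √(Real.pi / w.re) := by
  have := norm_saddleMoment_le 0 hw
  simpa only [pow_zero, one_mul, integral_gaussian] using this

theorem norm_saddleMoment_antitone (n : ℕ) {a : ℝ} (ha : 0 < a) {w : ℂ} (hw : a ≤ w.re) :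
    ‖saddleMoment n w‖ ≤ ∫ v : ℝ, |v| ^ n * Real.exp (-a * v ^ 2) := by
  have hi : ∀ b > 0, Integrable fun v : ℝ => |v| ^ n * Real.exp (-b * v ^ 2) := fun b hb =>
    (integrable_pow_mul_exp_neg_mul_sq n hb).norm.congr (Eventually.of_forall fun v => by simp)
  refine (norm_saddleMoment_le n (ha.trans_le hw)).trans
    (integral_mono (hi _ (ha.trans_le hw)) (hi _ ha) fun v => ?_)
  simp only
  gcongr

theorem integral_abs_pow_mul_exp_scale (n : ℕ) {a : ℝ} (ha : 0 < a) :
    ∫ v : ℝ, |v| ^ n * Real.exp (-a * v ^ 2) =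
      (√a)⁻¹ ^ (n + 1) * ∫ v : ℝ, |v| ^ n * Real.exp (-v ^ 2) := by
  have hs : 0 < √a := Real.sqrt_pos.2 ha
  have := Measure.integral_comp_mul_left (fun v : ℝ => |v| ^ n * Real.exp (-v ^ 2)) (√a)
  rw [smul_eq_mul, abs_of_pos (inv_pos.2 hs)] at this
  rw [pow_succ, mul_assoc, ← this, ← integral_const_mul]
  congr 1
  ext v
  rw [abs_mul, abs_of_pos hs, mul_pow, mul_pow, Real.sq_sqrt ha.le, inv_pow]
  field_simp

/-- The leading term of `∫ exp (-w v² - i v³/3) dv` at infinity. -/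
theorem norm_saddleMoment_sub_gaussian_le : ∃ K : ℝ, 0 < K ∧ ∀ w : ℂ, 0 < w.re →
    ‖saddleMoment 0 w - (Real.pi / w) ^ (1 / 2 : ℂ)‖ ≤ K * (√w.re)⁻¹ ^ 7 := by
  set I₆ := ∫ v : ℝ, |v| ^ 6 * Real.exp (-v ^ 2)
  have hI : 0 ≤ I₆ := integral_nonneg fun v => by positivity
  -- The bound 1 - cos(v³/3) ≤ v⁶/18 gives the constant and, after rescaling, the power 7 = 6 + 1;
  -- the summand 1 only ensures positivity.
  refine ⟨I₆ / 18 + 1, by positivity, fun w hw => ?_⟩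
  have hg : Integrable fun v : ℝ => Complex.exp (-w * (v ^ 2 : ℝ)) := by
    simpa only [one_mul] using integrable_laplace (μ := volume) (f := fun _ => 1) (p := fun v => v ^ 2) (w := w)
      (by fun_prop) (by fun_prop) (by simpa using integrable_pow_mul_exp_neg_mul_sq 0 hw)
  have h1 := integrable_saddleMoment 0 hw
  have h2 := h1.comp_neg
  -- Averaging over v and -v replaces the phase by a cosine, whose distance to 1 is quadratic in v³.
  -- A direct estimate of the phase would lose half of the decay.
  have e1 : saddleMoment 0 w = ∫ v : ℝ, (Real.cos (v ^ 3 / 3) : ℂ) *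
      Complex.exp (-w * (v ^ 2 : ℝ)) := by
    have := integral_neg_eq_self (μ := volume) (fun v : ℝ => (v : ℂ) ^ 0 * cubicPhase v *
      Complex.exp (-w * (v ^ 2 : ℝ)))
    have h3 := integral_add h1 h2
    rw [this] at h3
    change _ = saddleMoment 0 w + saddleMoment 0 w at h3
    have : saddleMoment 0 w = (1 / 2 : ℂ) * (saddleMoment 0 w + saddleMoment 0 w) := by ring
    rw [this, ← h3, ← integral_const_mul]
    congr 1
    ext v
    have : (Real.cos (v ^ 3 / 3) : ℂ) = (cubicPhase v + cubicPhase (-v)) / 2 := by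
      rw [Complex.ofReal_cos, Complex.cos, cubicPhase, cubicPhase]
      push_cast
      rw [add_comm]
      congr 3 <;> ring_nf
    rw [this]
    push_cast
    ring_nf
  have e2 : ∫ v : ℝ, Complex.exp (-w * (v ^ 2 : ℝ)) = (Real.pi / w) ^ (1 / 2 : ℂ) := by
    rw [← integral_gaussian_complex hw]
    simp
  have hcos : Integrable fun v : ℝ => (Real.cos (v ^ 3 / 3) : ℂ) *
      Complex.exp (-w * (v ^ 2 : ℝ)) := by
    refine hg.norm.mono' (Continuous.aestronglyMeasurable (by fun_prop))
      (Eventually.of_forall fun v => ?_)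
    rw [norm_mul, Complex.norm_real]
    exact mul_le_of_le_one_left (norm_nonneg _) (Real.abs_cos_le_one _)
  rw [e1, ← e2, ← integral_sub hcos hg]
  have hi : Integrable fun v : ℝ => 1 / 18 * (|v| ^ 6 * Real.exp (-w.re * v ^ 2)) :=
    ((integrable_pow_mul_exp_neg_mul_sq 6 hw).norm.congr
      (Eventually.of_forall fun v => by simp)).const_mul _
  refine (norm_integral_le_of_norm_le hi (Eventually.of_forall fun v => ?_)).trans ?_
  · rw [← sub_one_mul, norm_mul, norm_cexp_neg_mul, ← mul_assoc, ← Complex.ofReal_one,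
      ← Complex.ofReal_sub, Complex.norm_real, Real.norm_eq_abs]
    refine mul_le_mul_of_nonneg_right ?_ (Real.exp_nonneg _)
    rw [abs_sub_comm, abs_of_nonneg (by linarith [Real.cos_le_one (v ^ 3 / 3)])]
    have := Real.one_sub_sq_div_two_le_cos (x := v ^ 3 / 3)
    have e : |v| ^ 6 = v ^ 6 := by rw [show 6 = 2 * 3 by norm_num, pow_mul, pow_mul, sq_abs]
    rw [e]
    nlinarith
  · rw [integral_const_mul, integral_abs_pow_mul_exp_scale 6 hw]
    have : 0 ≤ (√w.re)⁻¹ ^ 7 := by positivity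
    nlinarith

/-! ### The saddle point representation of the Airy function -/

/-- `exp (-2 w³/3)` times the saddle point integral. -/
def saddle (w : ℂ) : ℂ := Complex.exp (-(2 / 3 * w ^ 3)) * saddleMoment 0 w

/-- The derivative of `saddle` with respect to `w²`. -/
def saddleDeriv (w : ℂ) : ℂ :=
  Complex.exp (-(2 / 3 * w ^ 3)) * (-(w * saddleMoment 0 w) - Complex.I * saddleMoment 1 w)

theorem hasDerivAt_exp_cube (w : ℂ) : HasDerivAt (fun w : ℂ => Complex.exp (-(2 / 3 * w ^ 3)))
    (Complex.exp (-(2 / 3 * w ^ 3)) * (-(2 * w ^ 2))) w :=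
  ((((hasDerivAt_id w).pow 3).const_mul (2 / 3 : ℂ)).neg.congr_deriv (by simp; ring)).cexp

theorem hasDerivAt_saddle {w : ℂ} (hw : 0 < w.re) :
    HasDerivAt saddle (2 * w * saddleDeriv w) w := by
  refine ((hasDerivAt_exp_cube w).mul (hasDerivAt_saddleMoment 0 hw)).congr_deriv ?_
  have h0 := saddleMoment_relation 0 hw
  simp only [Nat.cast_zero, zero_mul, zero_add, zero_sub] at h0 ⊢
  rw [saddleDeriv]
  linear_combination (-Complex.I * Complex.exp (-(2 / 3 * w ^ 3))) * h0 -
    saddleMoment 2 w * Complex.exp (-(2 / 3 * w ^ 3)) * Complex.I_sq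

/-- Since d/dw = 2w·d/dz for z = w², this and `hasDerivAt_saddle` say that the saddle integral
solves the Airy equation in z. The moment relations of orders 0 and 1 eliminate the higher moments.
-/
theorem hasDerivAt_saddleDeriv {w : ℂ} (hw : 0 < w.re) :
    HasDerivAt saddleDeriv (2 * w ^ 3 * saddle w) w := by
  refine ((hasDerivAt_exp_cube w).mul
    ((((hasDerivAt_id w).mul (hasDerivAt_saddleMoment 0 hw)).neg).sub
      ((hasDerivAt_saddleMoment 1 hw).const_mul Complex.I))).congr_deriv ?_
  have h0 := saddleMoment_relation 0 hw
  have h1 := saddleMoment_relation 1 hw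
  simp only [Nat.cast_zero, zero_mul, zero_add, zero_sub, Nat.cast_one, one_mul, id_eq, Pi.mul_apply,
    Pi.sub_apply, Pi.neg_apply, Nat.sub_self, Nat.reduceAdd] at h0 h1 ⊢
  rw [saddle]
  linear_combination (-Complex.exp (-(2 / 3 * w ^ 3))) * h1 +
    (-Complex.I * w * Complex.exp (-(2 / 3 * w ^ 3))) * h0 -
    saddleMoment 2 w * Complex.exp (-(2 / 3 * w ^ 3)) * w * Complex.I_sq

theorem hasDerivAt_airyAi_sq (w : ℂ) :
    HasDerivAt (fun w => airyAi (w ^ 2)) (2 * w * deriv airyAi (w ^ 2)) w := by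
  have h : HasDerivAt (fun w : ℂ => w ^ 2) (2 * w) w := by simpa using hasDerivAt_pow 2 w
  exact ((hasDerivAt_airyAi (w ^ 2)).comp w h).congr_deriv (mul_comm _ _)

theorem hasDerivAt_deriv_airyAi_sq (w : ℂ) :
    HasDerivAt (fun w => deriv airyAi (w ^ 2)) (2 * w ^ 3 * airyAi (w ^ 2)) w := by
  have h : HasDerivAt (fun w : ℂ => w ^ 2) (2 * w) w := by simpa using hasDerivAt_pow 2 w
  refine ((hasDerivAt_deriv_airyAi (w ^ 2)).comp w h).congr_deriv ?_
  ring

theorem isOpen_rightHalfPlane : IsOpen {w : ℂ | 0 < w.re} :=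
  isOpen_lt continuous_const Complex.continuous_re

theorem convex_rightHalfPlane : Convex ℝ {w : ℂ | 0 < w.re} := convex_halfSpace_re_gt 0

theorem tendsto_exp_cube_mul :
    Tendsto (fun r : ℝ => Real.exp (-(2 / 3 * r ^ 3)) * (r + 1)) atTop (𝓝 0) := by
  have h1 : Tendsto (fun r : ℝ => 2 * (r * Real.exp (-r))) atTop (𝓝 0) := by
    simpa using (Real.tendsto_pow_mul_exp_neg_atTop_nhds_zero 1).const_mul 2
  refine squeeze_zero' ?_ ?_ h1
  · filter_upwards [eventually_ge_atTop 0] with r hr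
    positivity
  · filter_upwards [eventually_ge_atTop 2] with r hr
    have e : Real.exp (-(2 / 3 * r ^ 3)) ≤ Real.exp (-r) := Real.exp_le_exp.2 (by nlinarith [sq_nonneg r])
    have : r + 1 ≤ 2 * r := by linarith
    calc _ ≤ Real.exp (-r) * (2 * r) := by gcongr
      _ = _ := by ring

/-- The Wronskian of the Airy function and the saddle point integral vanishes. -/
theorem saddle_wronskian {w : ℂ} (hw : 0 < w.re) :
    airyAi (w ^ 2) * saddleDeriv w - deriv airyAi (w ^ 2) * saddle w = 0 := by
  set W : ℂ → ℂ := fun w => airyAi (w ^ 2) * saddleDeriv w - deriv airyAi (w ^ 2) * saddle w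
  have hd : ∀ w ∈ {w : ℂ | 0 < w.re}, HasDerivAt W 0 w := fun w hw =>
    (((hasDerivAt_airyAi_sq w).mul (hasDerivAt_saddleDeriv hw)).sub
      ((hasDerivAt_deriv_airyAi_sq w).mul (hasDerivAt_saddle hw))).congr_deriv (by ring)
  -- The right half-plane is connected, so W takes the same value at w and at every positive real
  -- point.
  have hconst : ∀ r : ℝ, 0 < r → W r = W w := fun r hr =>
    isOpen_rightHalfPlane.is_const_of_deriv_eq_zero convex_rightHalfPlane.isPreconnected
      (fun z hz => (hd z hz).differentiableAt.differentiableWithinAt)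
      (fun z hz => (hd z hz).deriv) (by simpa using hr) hw
  obtain ⟨M, hM⟩ := airyAi_bounded
  set K₀ := ∫ v : ℝ, |v| ^ 0 * Real.exp (-1 * v ^ 2)
  set K₁ := ∫ v : ℝ, |v| ^ 1 * Real.exp (-1 * v ^ 2)
  have hK0 : 0 ≤ K₀ := integral_nonneg fun v => by positivity
  have hK1 : 0 ≤ K₁ := integral_nonneg fun v => by positivity
  have hM0 : 0 ≤ M := (norm_nonneg _).trans (hM 0 le_rfl).1
  -- On the positive axis Ai and Ai' are bounded, while both saddle functions carry the factor
  -- exp(-2r³/3).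
  have hlim : Tendsto (fun r : ℝ => W r) atTop (𝓝 0) := by
    refine squeeze_zero_norm' (a := fun r : ℝ => M * (K₀ + K₁) * 2 *
      (Real.exp (-(2 / 3 * r ^ 3)) * (r + 1))) ?_ (by simpa using tendsto_exp_cube_mul.const_mul _)
    filter_upwards [eventually_ge_atTop 1] with r hr
    have b0 : ‖saddleMoment 0 r‖ ≤ K₀ := norm_saddleMoment_antitone 0 one_pos (by simpa using hr)
    have b1 : ‖saddleMoment 1 r‖ ≤ K₁ := norm_saddleMoment_antitone 1 one_pos (by simpa using hr)
    obtain ⟨a0, a1⟩ := hM (r ^ 2) (by positivity)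
    push_cast at a0 a1
    have e : ‖Complex.exp (-(2 / 3 * (r : ℂ) ^ 3))‖ = Real.exp (-(2 / 3 * r ^ 3)) := by
      rw [show -(2 / 3 * (r : ℂ) ^ 3) = ((-(2 / 3 * r ^ 3) : ℝ) : ℂ) by push_cast; ring,
        ← Complex.ofReal_exp, Complex.norm_real, Real.norm_of_nonneg (Real.exp_nonneg _)]
    have s0 : ‖saddle r‖ ≤ Real.exp (-(2 / 3 * r ^ 3)) * K₀ := by
      rw [saddle, norm_mul, e]
      gcongr
    have s1 : ‖saddleDeriv r‖ ≤ Real.exp (-(2 / 3 * r ^ 3)) * (r * K₀ + K₁) := by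
      rw [saddleDeriv, norm_mul, e]
      gcongr
      refine (norm_sub_le _ _).trans ?_
      rw [norm_neg, norm_mul, norm_mul, Complex.norm_I, one_mul, Complex.norm_real,
        Real.norm_of_nonneg (by linarith)]
      gcongr
    calc ‖W r‖ ≤ M * (Real.exp (-(2 / 3 * r ^ 3)) * (r * K₀ + K₁)) +
          M * (Real.exp (-(2 / 3 * r ^ 3)) * K₀) := by
          refine (norm_sub_le _ _).trans ?_
          rw [norm_mul, norm_mul]
          gcongr
      _ = M * Real.exp (-(2 / 3 * r ^ 3)) * (r * K₀ + K₁ + K₀) := by ring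
      _ ≤ M * Real.exp (-(2 / 3 * r ^ 3)) * ((K₀ + K₁) * 2 * (r + 1)) := by
          gcongr
          nlinarith [mul_nonneg hK1 (by linarith : (0 : ℝ) ≤ r), mul_nonneg hK0 (by linarith : (0 : ℝ) ≤ r)]
      _ = _ := by ring
  have hlim' : Tendsto (fun r : ℝ => W r) atTop (𝓝 (W w)) :=
    tendsto_const_nhds.congr' ((eventually_gt_atTop 0).mono fun r hr => (hconst r hr).symm)
  exact tendsto_nhds_unique hlim' hlim

theorem sqrt_pi_div_ofReal {r : ℝ} (hr : 0 < r) :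
    ((Real.pi : ℂ) / r) ^ (1 / 2 : ℂ) = (√(Real.pi / r) : ℝ) := by
  rw [Real.sqrt_eq_rpow, Complex.ofReal_cpow (by positivity)]
  push_cast
  rfl

/-- The Gaussian term √(π/r) dominates the error of order r^{-7/2}. This supplies a point where the
saddle integral does not vanish. -/
theorem eventually_saddleMoment_re_pos : ∀ᶠ r : ℝ in atTop, 0 < (saddleMoment 0 r).re := by
  obtain ⟨K, hK, h⟩ := norm_saddleMoment_sub_gaussian_le
  filter_upwards [eventually_gt_atTop 1, eventually_gt_atTop K] with r hr1 hrK
  have hr0 : 0 < r := by linarith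
  have h1 := h r (by simpa using hr0)
  rw [sqrt_pi_div_ofReal hr0] at h1
  have h2 := (Complex.abs_re_le_norm _).trans h1
  rw [Complex.sub_re, Complex.ofReal_re, Complex.ofReal_re] at h2
  have h3 := (abs_le.1 h2).1
  have hs : 0 < √r := Real.sqrt_pos.2 hr0
  have h4 : K * (√r)⁻¹ ^ 7 < √(Real.pi / r) := by
    rw [Real.sqrt_div' _ hr0.le, inv_pow, ← div_eq_mul_inv, div_lt_div_iff₀ (by positivity) hs]
    have hpi : 1 ≤ √Real.pi := Real.one_le_sqrt.2 (by linarith [Real.pi_gt_three])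
    have : (√r) ^ 7 = r ^ 3 * √r := by
      rw [show (√r) ^ 7 = ((√r) ^ 2) ^ 3 * √r by ring, Real.sq_sqrt hr0.le]
    rw [this]
    have hr3 : K < r ^ 3 := by nlinarith [sq_nonneg r]
    calc K * √r < r ^ 3 * √r := by gcongr
      _ ≤ _ := le_mul_of_one_le_left (by positivity) hpi
  linarith

/-- The vanishing Wronskian makes the quotient constant near a point where `saddle` is nonzero, and
the identity theorem spreads the equality over the half-plane. The constant is nonzero, since
otherwise Ai(x²) = 0 for all x > 0 and so Ai(0) = 0. -/
theorem exists_airyAi_eq_saddle : ∃ k : ℂ, k ≠ 0 ∧ ∀ w : ℂ, 0 < w.re →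
    airyAi (w ^ 2) = k * saddle w := by
  obtain ⟨r, hr, hr0⟩ := (eventually_saddleMoment_re_pos.and (eventually_gt_atTop 0)).exists
  have hB : saddle r ≠ 0 := by
    refine mul_ne_zero (Complex.exp_ne_zero _) fun h => ?_
    rw [h] at hr
    simp at hr
  have hr' : 0 < (r : ℂ).re := by simpa using hr0
  set k := airyAi ((r : ℂ) ^ 2) / saddle r with hk
  have hopen : ∀ᶠ w in 𝓝 (r : ℂ), saddle w ≠ 0 ∧ 0 < w.re :=
    ((hasDerivAt_saddle hr').continuousAt.eventually_ne hB).and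
      (isOpen_rightHalfPlane.mem_nhds hr')
  obtain ⟨ε, hε, hball⟩ := Metric.eventually_nhds_iff_ball.1 hopen
  have hloc : ∀ w ∈ Metric.ball (r : ℂ) ε, airyAi (w ^ 2) / saddle w = k := fun w hw => by
    have hd : ∀ z ∈ Metric.ball (r : ℂ) ε,
        HasDerivAt (fun w => airyAi (w ^ 2) / saddle w) 0 z := fun z hz => by
      obtain ⟨h1, h2⟩ := hball z hz
      refine ((hasDerivAt_airyAi_sq z).div (hasDerivAt_saddle h2) h1).congr_deriv ?_
      rw [div_eq_zero_iff]
      left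
      linear_combination (-2 * z) * saddle_wronskian h2
    exact Metric.isOpen_ball.is_const_of_deriv_eq_zero (convex_ball _ _).isPreconnected
      (fun z hz => (hd z hz).differentiableAt.differentiableWithinAt)
      (fun z hz => (hd z hz).deriv) hw (Metric.mem_ball_self hε)
  have hall : ∀ w : ℂ, 0 < w.re → airyAi (w ^ 2) = k * saddle w := by
    have hA : AnalyticOnNhd ℂ (fun w => airyAi (w ^ 2)) {w : ℂ | 0 < w.re} :=
      DifferentiableOn.analyticOnNhd (fun z _ =>
        (hasDerivAt_airyAi_sq z).differentiableAt.differentiableWithinAt) isOpen_rightHalfPlane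
    have hS : AnalyticOnNhd ℂ (fun w => k * saddle w) {w : ℂ | 0 < w.re} :=
      DifferentiableOn.analyticOnNhd (fun z hz =>
        ((hasDerivAt_saddle hz).const_mul k).differentiableAt.differentiableWithinAt)
        isOpen_rightHalfPlane
    exact hA.eqOn_of_preconnected_of_eventuallyEq hS convex_rightHalfPlane.isPreconnected hr'
      (Metric.eventually_nhds_iff_ball.2 ⟨ε, hε, fun w hw => by
        simp only
        rw [← hloc w hw, div_mul_cancel₀ _ (hball w hw).1]⟩)
  refine ⟨k, fun hk0 => ?_, hall⟩
  have hz : ∀ x : ℝ, 0 < x → airyAi ((x : ℂ) ^ 2) = 0 := fun x hx => by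
    rw [hall x (by simpa using hx), hk0, zero_mul]
  have hcont : Continuous fun x : ℝ => airyAi ((x : ℂ) ^ 2) := by
    have := continuous_airyAi
    fun_prop
  have h1 : Tendsto (fun x : ℝ => airyAi ((x : ℂ) ^ 2)) (𝓝[>] 0) (𝓝 (airyAi 0)) := by
    simpa using (hcont.tendsto 0).mono_left nhdsWithin_le_nhds
  have h2 : Tendsto (fun x : ℝ => airyAi ((x : ℂ) ^ 2)) (𝓝[>] 0) (𝓝 0) :=
    tendsto_const_nhds.congr' (eventually_mem_nhdsWithin.mono fun x hx => (hz x hx).symm)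
  have := tendsto_nhds_unique h1 h2
  rw [airyAi_zero] at this
  exact airyZero_pos.ne' (by exact_mod_cast this)

/-! ### Decay of the Airy function along rays -/

theorem norm_airyAi_sq_le : ∃ C : ℝ, 0 < C ∧ ∀ w : ℂ, 0 < w.re →
    ‖airyAi (w ^ 2)‖ ≤ C * Real.exp (-(2 / 3 * (w ^ 3).re)) / √w.re := by
  obtain ⟨k, hk, h⟩ := exists_airyAi_eq_saddle
  have hk' : 0 < ‖k‖ := norm_pos_iff.2 hk
  refine ⟨‖k‖ * √Real.pi, by have := Real.pi_pos; positivity, fun w hw => ?_⟩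
  rw [h w hw, saddle, norm_mul, norm_mul, Complex.norm_exp]
  have h1 := norm_saddleMoment_zero_le hw
  rw [Real.sqrt_div' _ hw.le] at h1
  have e : (-(2 / 3 * w ^ 3)).re = -(2 / 3 * (w ^ 3).re) := by
    rw [Complex.neg_re, show (2 / 3 : ℂ) = ((2 / 3 : ℝ) : ℂ) by push_cast; rfl,
      Complex.re_ofReal_mul]
  rw [e]
  calc _ ≤ ‖k‖ * (Real.exp (-(2 / 3 * (w ^ 3).re)) * (√Real.pi / √w.re)) := by gcongr
    _ = _ := by ring

/-- Decay of the Airy function in a conical neighbourhood of a ray. -/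
theorem airyAi_decay_cone {β : ℂ} (h1 : 0 < β.re) (h3 : 0 < (β ^ 3).re) :
    ∃ ρ m C : ℝ, 0 < ρ ∧ 0 < m ∧ 0 < C ∧ ∀ (x : ℝ) (z : ℂ), 1 ≤ x → ‖z - β ^ 2 * x‖ < ρ * x →
      ‖airyAi z‖ ≤ C * Real.exp (-m * x) := by
  obtain ⟨C, hC, hA⟩ := norm_airyAi_sq_le
  have hU : {b : ℂ | β.re / 2 < b.re ∧ (β ^ 3).re / 2 < (b ^ 3).re} ∈ 𝓝 β := by
    refine IsOpen.mem_nhds ((isOpen_lt continuous_const Complex.continuous_re).inter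
      (isOpen_lt continuous_const (Complex.continuous_re.comp (continuous_pow 3)))) ?_
    exact ⟨by simpa using h1, by simpa using h3⟩
  have hβ : β ≠ 0 := by rintro rfl; simp at h1
  -- Squaring is open at β ≠ 0, so every point near β² is the square of a point near β that still
  -- satisfies both positivity conditions. Scaling by √x then covers the cone.
  have hmap := (hasStrictDerivAt_pow 2 β).map_nhds_eq (by simpa using hβ)
  have himg := image_mem_map (m := fun b : ℂ => b ^ 2) hU
  rw [hmap] at himg
  obtain ⟨ρ, hρ, hball⟩ := Metric.mem_nhds_iff.1 himg
  refine ⟨ρ, (β ^ 3).re / 3, C / √(β.re / 2), hρ, by positivity,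
    by have : 0 < √(β.re / 2) := Real.sqrt_pos.2 (by positivity)
       positivity, fun x z hx hz => ?_⟩
  have hx0 : 0 < x := by linarith
  have hxc : (x : ℂ) ≠ 0 := by exact_mod_cast hx0.ne'
  obtain ⟨b, ⟨hb1, hb3⟩, hb⟩ := hball (show z / x ∈ Metric.ball (β ^ 2) ρ by
    rw [Metric.mem_ball, dist_eq_norm, show z / x - β ^ 2 = (z - β ^ 2 * x) / x by field_simp,
      norm_div, Complex.norm_real, Real.norm_of_nonneg hx0.le, div_lt_iff₀ hx0]
    exact hz)
  simp only at hb
  have hs : 1 ≤ √x := Real.one_le_sqrt.2 hx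
  have hzw : z = ((√x : ℝ) * b) ^ 2 := by
    rw [mul_pow, hb, ← Complex.ofReal_pow, Real.sq_sqrt hx0.le]
    field_simp
  have hre : ((√x : ℝ) * b).re = √x * b.re := Complex.re_ofReal_mul _ _
  have hre3 : (((√x : ℝ) * b) ^ 3).re = x * √x * (b ^ 3).re := by
    rw [mul_pow, ← Complex.ofReal_pow, Complex.re_ofReal_mul, pow_succ, Real.sq_sqrt hx0.le]
  have hb0 : 0 < b.re := by linarith
  have hw : 0 < ((√x : ℝ) * b).re := by rw [hre]; positivity
  rw [hzw]
  refine (hA _ hw).trans ?_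
  rw [hre3, hre, mul_comm (C / _), ← mul_div_assoc, mul_comm _ C]
  have hmain : x * ((β ^ 3).re / 2) ≤ x * √x * (b ^ 3).re := by
    calc x * ((β ^ 3).re / 2) ≤ x * √x * ((β ^ 3).re / 2) := by
          gcongr
          nlinarith
      _ ≤ _ := by gcongr
  have hden : β.re / 2 ≤ √x * b.re := by nlinarith
  have hd0 : 0 < √(β.re / 2) := Real.sqrt_pos.2 (by positivity)
  have hexp : -(2 / 3 * (x * √x * (b ^ 3).re)) ≤ -((β ^ 3).re / 3) * x := by linarith
  gcongr

/-- Exponential decay of the Airy function and of its derivative along shifted rays. -/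
theorem airyAi_decay_line {β : ℂ} (h1 : 0 < β.re) (h3 : 0 < (β ^ 3).re) (z₀ : ℂ) :
    ∃ C m : ℝ, 0 < C ∧ 0 < m ∧ ∀ x : ℝ, 0 ≤ x →
      ‖airyAi (z₀ + β ^ 2 * x)‖ ≤ C * Real.exp (-m * x) ∧
      ‖deriv airyAi (z₀ + β ^ 2 * x)‖ ≤ C * Real.exp (-m * x) := by
  obtain ⟨ρ, m, C, hρ, hm, hC, h⟩ := airyAi_decay_cone h1 h3
  -- Beyond X the closed unit disc about z₀ + β²x lies in the cone; the disc is needed for the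
  -- Cauchy estimate of the derivative.
  set X := max 1 ((‖z₀‖ + 2) / ρ)
  have hX1 : 1 ≤ X := le_max_left _ _
  have hX2 : ‖z₀‖ + 2 ≤ ρ * X := by
    have := le_max_right 1 ((‖z₀‖ + 2) / ρ)
    rw [div_le_iff₀ hρ] at this
    linarith
  have hfar : ∀ x, X ≤ x → ∀ z, ‖z - (z₀ + β ^ 2 * x)‖ ≤ 1 → ‖airyAi z‖ ≤ C * Real.exp (-m * x) := by
    intro x hx z hz
    refine h x z (hX1.trans hx) ?_
    calc ‖z - β ^ 2 * x‖ = ‖(z - (z₀ + β ^ 2 * x)) + z₀‖ := by ring_nf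
      _ ≤ 1 + ‖z₀‖ := (norm_add_le _ _).trans (by gcongr)
      _ < ρ * X := by linarith
      _ ≤ ρ * x := by gcongr
  have hc0 := continuous_airyAi
  have hc1 := continuous_deriv_airyAi
  obtain ⟨K₀, hK0⟩ := isCompact_Icc.exists_bound_of_continuousOn (s := Icc 0 X)
    (Continuous.continuousOn (f := fun x : ℝ => airyAi (z₀ + β ^ 2 * x)) (by fun_prop))
  obtain ⟨K₁, hK1⟩ := isCompact_Icc.exists_bound_of_continuousOn (s := Icc 0 X)
    (Continuous.continuousOn (f := fun x : ℝ => deriv airyAi (z₀ + β ^ 2 * x)) (by fun_prop))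
  have hX0 : (0 : ℝ) ≤ X := by linarith
  have hK0' : 0 ≤ K₀ := (norm_nonneg _).trans (hK0 0 ⟨le_rfl, hX0⟩)
  have hK1' : 0 ≤ K₁ := (norm_nonneg _).trans (hK1 0 ⟨le_rfl, hX0⟩)
  have hnear : ∀ x, x ≤ X → ∀ K, 0 ≤ K → K ≤ K * Real.exp (m * X) * Real.exp (-m * x) := by
    intro x hx K hK
    rw [mul_assoc, ← Real.exp_add]
    refine le_mul_of_one_le_right hK (Real.one_le_exp ?_)
    nlinarith
  refine ⟨C + K₀ * Real.exp (m * X) + K₁ * Real.exp (m * X), m, by positivity, hm,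
    fun x hx => ?_⟩
  have e0 := Real.exp_pos (-m * x)
  have eX := Real.exp_pos (m * X)
  rw [add_mul, add_mul]
  rcases le_total x X with hxX | hxX
  · have a0 := hnear x hxX K₀ hK0'
    have a1 := hnear x hxX K₁ hK1'
    have b0 := hK0 x ⟨hx, hxX⟩
    have b1 := hK1 x ⟨hx, hxX⟩
    have c0 : 0 < C * Real.exp (-m * x) := by positivity
    constructor <;> linarith
  · have a0 := hfar x hxX (z₀ + β ^ 2 * x) (by simp)
    have a1 := Complex.norm_deriv_le_of_forall_mem_sphere_norm_le (c := z₀ + β ^ 2 * x)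
      (f := airyAi) one_pos airyAi_spec.1.diffContOnCl (C := C * Real.exp (-m * x))
      (fun z hz => hfar x hxX z (by rw [← dist_eq_norm]; exact (Metric.mem_sphere.1 hz).le))
    rw [div_one] at a1
    have c0 : 0 ≤ K₀ * Real.exp (m * X) * Real.exp (-m * x) := by positivity
    have c1 : 0 ≤ K₁ * Real.exp (m * X) * Real.exp (-m * x) := by positivity
    constructor <;> linarith

/-! ### The zeros of the Airy function are real and negative -/

/-- A monotone function that starts at 0 and tends to 0 is identically zero. -/
theorem deriv_eq_zero_of_nonneg_of_tendsto {f f' : ℝ → ℝ} (h : ∀ x, HasDerivAt f (f' x) x)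
    (hf' : ∀ x, 0 ≤ x → 0 ≤ f' x) (h0 : f 0 = 0) (hlim : Tendsto f atTop (𝓝 0)) {x : ℝ}
    (hx : 0 < x) : f' x = 0 := by
  have hmono : MonotoneOn f (Ici 0) := by
    refine monotoneOn_of_deriv_nonneg (convex_Ici 0)
      (fun y _ => (h y).continuousAt.continuousWithinAt)
      (fun y _ => (h y).differentiableAt.differentiableWithinAt) fun y hy => ?_
    rw [(h y).deriv]
    exact hf' y (interior_subset hy)
  have hzero : ∀ y, 0 ≤ y → f y = 0 := fun y hy => by
    refine le_antisymm ?_ ?_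
    · exact ge_of_tendsto hlim ((eventually_ge_atTop y).mono fun z hz =>
        hmono hy (hy.trans hz) hz)
    · rw [← h0]
      exact hmono self_mem_Ici hy hy
  refine (h x).unique ((hasDerivAt_const x (0 : ℝ)).congr_of_eventuallyEq ?_)
  filter_upwards [Ioi_mem_nhds hx] with y hy
  exact hzero y (le_of_lt hy)

theorem hasDerivAt_re {f : ℝ → ℂ} {f' : ℂ} {x : ℝ} (h : HasDerivAt f f' x) :
    HasDerivAt (fun x => (f x).re) f'.re x :=
  Complex.reCLM.hasFDerivAt.comp_hasDerivAt x h

theorem hasDerivAt_im {f : ℝ → ℂ} {f' : ℂ} {x : ℝ} (h : HasDerivAt f f' x) :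
    HasDerivAt (fun x => (f x).im) f'.im x :=
  Complex.imCLM.hasFDerivAt.comp_hasDerivAt x h

/-- Energy argument with u(x) = Ai(z₀ + x): the product u'·ū vanishes at 0 and at infinity, and its
derivative is (z₀ + x)|u|² + |u'|². The imaginary part of this derivative has constant sign, which
forces Im z₀ = 0; the real part would be nonnegative if Re z₀ ≥ 0. -/
theorem airyAi_zero_re_im {z₀ : ℂ} (hz : airyAi z₀ = 0) : z₀.im = 0 ∧ z₀.re < 0 := by
  set u : ℝ → ℂ := fun x => airyAi (z₀ + 1 * x) with hu
  set v : ℝ → ℂ := fun x => 1 * deriv airyAi (z₀ + 1 * x) with hv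
  have hd : ∀ x, HasDerivAt u (v x) x := hasDerivAt_airyAi_line z₀ 1
  have hd1 : ∀ x : ℝ, HasDerivAt v ((z₀ + x) * u x) x := fun x =>
    (hasDerivAt_deriv_airyAi_line z₀ 1 x).congr_deriv (by simp [hu])
  have hN : ∀ x : ℝ, HasDerivAt (fun x => v x * starRingEnd ℂ (u x))
      ((z₀ + x) * u x * starRingEnd ℂ (u x) + v x * starRingEnd ℂ (v x)) x := fun x =>
    (hd1 x).mul (hd x).star
  obtain ⟨C, m, hC, hm, hb⟩ := airyAi_decay_line (β := 1) (by simp) (by simp) z₀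
  have hlim : Tendsto (fun x => v x * starRingEnd ℂ (u x)) atTop (𝓝 0) := by
    have h1 : Tendsto (fun x : ℝ => C * C * Real.exp (-(m * x))) atTop (𝓝 0) := by
      simpa using ((Real.tendsto_exp_neg_atTop_nhds_zero.comp
        (tendsto_id.const_mul_atTop hm)).const_mul (C * C))
    refine squeeze_zero_norm' ?_ h1
    filter_upwards [eventually_ge_atTop 0] with x hx
    have hbx := hb x hx
    simp only [one_pow] at hbx
    rw [norm_mul, RCLike.norm_conj]
    simp only [hu, hv, one_mul] at hbx ⊢
    have e1 : Real.exp (-m * x) ≤ 1 := Real.exp_le_one_iff.2 (by nlinarith)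
    have e0 := Real.exp_pos (-m * x)
    calc _ ≤ (C * Real.exp (-m * x)) * (C * Real.exp (-m * x)) := by gcongr; exacts [hbx.2, hbx.1]
      _ = C * C * Real.exp (-m * x) * Real.exp (-m * x) := by ring
      _ ≤ C * C * Real.exp (-m * x) * 1 := by gcongr
      _ = _ := by rw [mul_one, neg_mul]
  have h0 : v 0 * starRingEnd ℂ (u 0) = 0 := by simp [hu, hz]
  have hnot : ¬ (u 1 = 0 ∧ v 1 = 0) := fun ⟨h, h'⟩ =>
    deriv_airyAi_ne_zero h (by simpa [hv] using h')
  have hre : ∀ x : ℝ, HasDerivAt (fun x => (v x * starRingEnd ℂ (u x)).re)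
      ((z₀.re + x) * ‖u x‖ ^ 2 + ‖v x‖ ^ 2) x := fun x => by
    refine (hasDerivAt_re (hN x)).congr_deriv ?_
    rw [mul_assoc, Complex.mul_conj, Complex.mul_conj, Complex.normSq_eq_norm_sq,
      Complex.normSq_eq_norm_sq, Complex.add_re, Complex.re_mul_ofReal,
      Complex.ofReal_re]
    simp
  have him : ∀ x : ℝ, HasDerivAt (fun x => (v x * starRingEnd ℂ (u x)).im)
      (z₀.im * ‖u x‖ ^ 2) x := fun x => by
    refine (hasDerivAt_im (hN x)).congr_deriv ?_
    rw [mul_assoc, Complex.mul_conj, Complex.mul_conj, Complex.normSq_eq_norm_sq,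
      Complex.normSq_eq_norm_sq, Complex.add_im, Complex.im_mul_ofReal,
      Complex.ofReal_im]
    simp
  have hreal : z₀.im = 0 := by
    by_contra hne
    have hzero : ∀ x : ℝ, 0 < x → u x = 0 := fun x hx => by
      -- The extra factor Im z₀ makes the derivative nonnegative whatever the sign of Im z₀.
      have := deriv_eq_zero_of_nonneg_of_tendsto
        (f := fun x => z₀.im * (v x * starRingEnd ℂ (u x)).im)
        (f' := fun x => z₀.im * (z₀.im * ‖u x‖ ^ 2)) (fun x => (him x).const_mul _)
        (fun x _ => by rw [← mul_assoc]; exact mul_nonneg (mul_self_nonneg _) (by positivity))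
        (by simp only [h0]; simp)
        (by simpa using ((Complex.continuous_im.tendsto 0).comp hlim).const_mul z₀.im) hx
      simpa [hne] using this
    refine hnot ⟨hzero 1 one_pos, (hd 1).unique
      ((hasDerivAt_const (1 : ℝ) (0 : ℂ)).congr_of_eventuallyEq ?_)⟩
    filter_upwards [Ioi_mem_nhds (one_pos : (0 : ℝ) < 1)] with y hy
    exact hzero y hy
  refine ⟨hreal, ?_⟩
  by_contra hge
  push Not at hge
  have := deriv_eq_zero_of_nonneg_of_tendsto hre
    (fun x hx => by have : 0 ≤ z₀.re + x := by linarith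
                    positivity)
    (by simp only [h0]; simp)
    (by have := (Complex.continuous_re.tendsto 0).comp hlim
        rwa [Complex.zero_re] at this) one_pos
  -- Evaluation at x = 1 keeps the weight strictly positive even when Re z₀ = 0.
  have h1 : 0 < z₀.re + 1 := by linarith
  have h2 : (z₀.re + 1) * ‖u 1‖ ^ 2 = 0 ∧ ‖v 1‖ ^ 2 = 0 := by
    constructor <;> nlinarith [mul_nonneg h1.le (sq_nonneg ‖u 1‖), sq_nonneg ‖v 1‖]
  refine hnot ⟨?_, by simpa using h2.2⟩
  simpa [h1.ne'] using h2.1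

/-! ### A continuous logarithm of the Airy function in a sector -/

/-- The projection onto the interval `[0, π/3]`. -/
def clampAngle (φ : ℝ) : ℝ := max 0 (min φ (Real.pi / 3))

theorem continuous_clampAngle : Continuous clampAngle := by
  unfold clampAngle
  fun_prop

theorem clampAngle_mem (φ : ℝ) : clampAngle φ ∈ Icc 0 (Real.pi / 3) :=
  ⟨le_max_left _ _, max_le (by have := Real.pi_pos; positivity) (min_le_right _ _)⟩

theorem clampAngle_of_mem {φ : ℝ} (h : φ ∈ Icc 0 (Real.pi / 3)) : clampAngle φ = φ := by
  rw [clampAngle, min_eq_left h.2, max_eq_right h.1]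

theorem airyAi_sector_ne_zero {r φ : ℝ} (hr : 0 ≤ r) (hφ : φ ∈ Icc 0 (Real.pi / 3)) :
    airyAi (r * Complex.exp (φ * Complex.I)) ≠ 0 := fun h => by
  have := (airyAi_zero_re_im h).2
  rw [Complex.re_ofReal_mul, Complex.exp_ofReal_mul_I_re] at this
  have hc : 0 ≤ Real.cos φ := Real.cos_nonneg_of_mem_Icc
    ⟨by linarith [hφ.1, Real.pi_pos], by linarith [hφ.2, Real.pi_pos]⟩
  nlinarith [mul_nonneg hr hc]

/-- The logarithmic derivative of the Airy function along rays, extended continuously. -/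
def airyLogDeriv (φ s : ℝ) : ℂ :=
  Complex.exp (clampAngle φ * Complex.I) *
    deriv airyAi (max s 0 * Complex.exp (clampAngle φ * Complex.I)) /
    airyAi (max s 0 * Complex.exp (clampAngle φ * Complex.I))

theorem continuous_airyLogDeriv : Continuous (Function.uncurry airyLogDeriv) := by
  have h0 := continuous_airyAi
  have h1 := continuous_deriv_airyAi
  have h2 := continuous_clampAngle
  have hm : Continuous fun p : ℝ × ℝ => ((max p.2 0 : ℝ) : ℂ) *
      Complex.exp (clampAngle p.1 * Complex.I) := by fun_prop
  have he : Continuous fun p : ℝ × ℝ => Complex.exp (clampAngle p.1 * Complex.I) := by fun_prop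
  exact (he.mul (h1.comp hm)).div (h0.comp hm) fun p => by
    exact airyAi_sector_ne_zero (le_max_right _ _) (clampAngle_mem _)

/-- A continuous logarithm of `Ai (r exp (i φ))`. -/
def airyLog (φ r : ℝ) : ℂ := Real.log airyZero + ∫ s in (0 : ℝ)..r, airyLogDeriv φ s

theorem continuous_airyLog (r : ℝ) : Continuous fun φ => airyLog φ r :=
  continuous_const.add
    (intervalIntegral.continuous_parametric_intervalIntegral_of_continuous' continuous_airyLogDeriv 0 r)

theorem hasDerivAt_airyLog (φ r : ℝ) : HasDerivAt (airyLog φ) (airyLogDeriv φ r) r := by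
  have hc : Continuous (airyLogDeriv φ) :=
    continuous_airyLogDeriv.comp (Continuous.prodMk_right φ)
  exact (hc.integral_hasStrictDerivAt 0 r).hasDerivAt.const_add _

/-- Ai(r·exp(iφ))·exp(-`airyLog`) has zero derivative in r and equals 1 at r = 0. -/
theorem exp_airyLog {φ r : ℝ} (hφ : φ ∈ Icc 0 (Real.pi / 3)) (hr : 0 ≤ r) :
    Complex.exp (airyLog φ r) = airyAi (r * Complex.exp (φ * Complex.I)) := by
  set e := Complex.exp (φ * Complex.I) with he
  have hd : ∀ x : ℝ, 0 ≤ x → HasDerivAt (fun x : ℝ => airyAi (0 + e * x) *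
      Complex.exp (-airyLog φ x)) 0 x := fun x hx => by
    refine ((hasDerivAt_airyAi_line 0 e x).mul (hasDerivAt_airyLog φ x).neg.cexp).congr_deriv ?_
    have hne := airyAi_sector_ne_zero hx hφ
    rw [← he, mul_comm] at hne
    simp only [airyLogDeriv, clampAngle_of_mem hφ, max_eq_left hx, zero_add, ← he, mul_comm (x : ℂ) e]
    field_simp
    simp
  have hconst := constant_of_has_deriv_right_zero (a := 0) (b := r)
    (fun x hx => (hd x hx.1).continuousAt.continuousWithinAt)
    (fun x hx => (hd x hx.1).hasDerivWithinAt) r ⟨hr, le_rfl⟩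
  have h0 : airyLog φ 0 = Real.log airyZero := by simp [airyLog]
  rw [h0] at hconst
  simp only [Complex.ofReal_zero, mul_zero, add_zero, zero_add, airyAi_zero] at hconst
  rw [Complex.exp_neg, Complex.exp_neg, ← Complex.ofReal_exp, Real.exp_log airyZero_pos,
    mul_inv_cancel₀ (by exact_mod_cast airyZero_pos.ne')] at hconst
  rw [mul_comm (r : ℂ)]
  field_simp at hconst
  exact hconst.symm

theorem airyAi_ofReal_im (x : ℝ) : (airyAi x).im = 0 := by
  have := airyAi_conj x
  rw [Complex.conj_ofReal] at this
  exact Complex.conj_eq_iff_im.1 this.symm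

theorem deriv_airyAi_ofReal_im (x : ℝ) : (deriv airyAi x).im = 0 := by
  have h1 : HasDerivAt (fun y : ℝ => (airyAi (0 + 1 * y)).im) (1 * deriv airyAi (0 + 1 * x)).im x :=
    hasDerivAt_im (hasDerivAt_airyAi_line 0 1 x)
  have h2 : HasDerivAt (fun y : ℝ => (airyAi (0 + 1 * y)).im) 0 x := by
    refine (hasDerivAt_const x (0 : ℝ)).congr_of_eventuallyEq (Eventually.of_forall fun y => ?_)
    simpa using airyAi_ofReal_im y
  simpa using h1.unique h2

/-- Ai and Ai' are real on the positive axis. This anchors the branch from which the argument is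
followed along arcs. -/
theorem airyLog_zero_im (r : ℝ) : (airyLog 0 r).im = 0 := by
  have hc : clampAngle 0 = 0 := clampAngle_of_mem ⟨le_rfl, by have := Real.pi_pos; positivity⟩
  have hreal : ∀ s, airyLogDeriv 0 s = ((airyLogDeriv 0 s).re : ℂ) := fun s => by
    have h0 : airyAi ((max s 0 : ℝ) : ℂ) = ((airyAi ((max s 0 : ℝ) : ℂ)).re : ℂ) :=
      Complex.ext rfl (by simpa using airyAi_ofReal_im (max s 0))
    have h1 : deriv airyAi ((max s 0 : ℝ) : ℂ) = ((deriv airyAi ((max s 0 : ℝ) : ℂ)).re : ℂ) :=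
      Complex.ext rfl (by simpa using deriv_airyAi_ofReal_im (max s 0))
    have : airyLogDeriv 0 s = (((deriv airyAi ((max s 0 : ℝ) : ℂ)).re /
        (airyAi ((max s 0 : ℝ) : ℂ)).re : ℝ) : ℂ) := by
      rw [airyLogDeriv, hc]
      simp only [Complex.ofReal_zero, zero_mul, Complex.exp_zero, mul_one, one_mul]
      rw [Complex.ofReal_div, ← h0, ← h1]
    rw [this, Complex.ofReal_re]
  rw [airyLog, intervalIntegral.integral_congr (fun s _ => hreal s),
    intervalIntegral.integral_ofReal, ← Complex.ofReal_add, Complex.ofReal_im]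

/-- A continuous family whose exponentials lie in the right half-plane stays in the principal
strip. -/
theorem abs_im_lt_of_exp_re_pos {g : ℝ → ℂ} {b : ℝ} (hb : 0 ≤ b) (hg : ContinuousOn g (Icc 0 b))
    (h0 : (g 0).im = 0) (hpos : ∀ x ∈ Icc 0 b, 0 < (Complex.exp (g x)).re) :
    |(g b).im| < Real.pi / 2 := by
  have hcos : ∀ x ∈ Icc 0 b, Real.cos (g x).im ≠ 0 := fun x hx h => by
    have := hpos x hx
    rw [Complex.exp_re, h, mul_zero] at this
    exact lt_irrefl _ this
  have hc : ContinuousOn (fun x => (g x).im) (Icc 0 b) := Complex.continuous_im.comp_continuousOn hg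
  by_contra hge
  push Not at hge
  rcases le_abs.1 hge with h | h
  · obtain ⟨x, hx, hxe⟩ := intermediate_value_Icc hb hc
      (show Real.pi / 2 ∈ Icc (g 0).im (g b).im from ⟨by rw [h0]; positivity, h⟩)
    exact hcos x hx (by simp only at hxe; rw [hxe, Real.cos_pi_div_two])
  · obtain ⟨x, hx, hxe⟩ := intermediate_value_Icc' hb hc
      (show -(Real.pi / 2) ∈ Icc (g b).im (g 0).im from
        ⟨by linarith, by rw [h0]; have := Real.pi_pos; linarith⟩)
    exact hcos x hx (by simp only at hxe; rw [hxe, Real.cos_neg, Real.cos_pi_div_two])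

/-- Since |exp z| ≥ 1/2, the sine of Im z is at most 2δ, and Jordan's inequality with π < 4 costs
another factor 2. -/
theorem abs_im_le_of_exp_near_one {z : ℂ} {δ : ℝ} (hz : |z.im| < Real.pi / 2)
    (h : ‖Complex.exp z - 1‖ ≤ δ) (hδ : δ ≤ 1 / 2) : |z.im| ≤ 4 * δ := by
  have h1 : 1 / 2 ≤ Real.exp z.re := by
    rw [← Complex.norm_exp]
    have := norm_sub_norm_le (1 : ℂ) (Complex.exp z)
    rw [norm_sub_rev, norm_one] at this
    linarith
  have h2 : |Real.exp z.re * Real.sin z.im| ≤ δ := by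
    have := (Complex.abs_im_le_norm _).trans h
    rwa [Complex.sub_im, Complex.one_im, sub_zero, Complex.exp_im] at this
  rw [abs_mul, abs_of_pos (Real.exp_pos _)] at h2
  have h3 : |z.im| ≤ 2 * |Real.sin z.im| := by
    have := Real.mul_abs_le_abs_sin hz.le
    have hpi := Real.pi_lt_four
    have : 1 / 2 * |z.im| ≤ 2 / Real.pi * |z.im| := by
      gcongr ?_ * _
      rw [div_le_div_iff₀ (by norm_num) Real.pi_pos]
      linarith
    linarith
  nlinarith [abs_nonneg (Real.sin z.im)]

/-! ### The phase of the Airy function on the negative half-line -/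

theorem sqrt_pi_div_polar {a φ : ℝ} (ha : 0 < a) (hφ : φ ∈ Icc 0 (Real.pi / 3)) :
    ((Real.pi : ℂ) / (a * Complex.exp (φ / 2 * Complex.I))) ^ (1 / 2 : ℂ) =
      (√(Real.pi / a) : ℝ) * Complex.exp (-(φ / 4 * Complex.I)) := by
  have hpi := Real.pi_pos
  have e : (Real.pi : ℂ) / (a * Complex.exp (φ / 2 * Complex.I)) =
      ((Real.pi / a : ℝ) : ℂ) * Complex.exp (-(φ / 2 * Complex.I)) := by
    rw [Complex.exp_neg]
    push_cast
    field_simp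
  have him : (-((φ : ℂ) / 2 * Complex.I)).im = -(φ / 2) := by
    rw [show (φ : ℂ) / 2 * Complex.I = ((φ / 2 : ℝ) : ℂ) * Complex.I by push_cast; rfl]
    simp
  have hlog : Complex.log (Complex.exp (-((φ : ℂ) / 2 * Complex.I))) =
      -((φ : ℂ) / 2 * Complex.I) :=
    Complex.log_exp (by rw [him]; linarith [hφ.2]) (by rw [him]; linarith [hφ.1])
  have hpa : 0 < Real.pi / a := by positivity
  rw [e, Complex.cpow_def_of_ne_zero (mul_ne_zero (by exact_mod_cast hpa.ne')
    (Complex.exp_ne_zero _)), Complex.log_ofReal_mul hpa (Complex.exp_ne_zero _), hlog, add_mul,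
    Complex.exp_add, Real.sqrt_eq_rpow, Real.rpow_def_of_pos hpa]
  push_cast
  congr 2
  ring

/-- The branch of the logarithm of `Ai` along the ray `arg z = π/3` at infinity. -/
theorem airyLog_asymptotic : ∃ K X : ℝ, 0 < K ∧ 1 ≤ X ∧ ∀ r : ℝ, X ≤ r →
    |(airyLog (Real.pi / 3) r).im + 2 / 3 * (r * √r) + Real.pi / 12| ≤ K / (r * √r) := by
  obtain ⟨k, hk, hrep⟩ := exists_airyAi_eq_saddle
  obtain ⟨K, hK, hJ⟩ := norm_saddleMoment_sub_gaussian_le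
  have hpi := Real.pi_pos
  refine ⟨16 * (128 * K), max 1 (1024 * K), by positivity, le_max_left _ _, fun r hr => ?_⟩
  have hr1 : 1 ≤ r := (le_max_left _ _).trans hr
  have hrK : 1024 * K ≤ r := (le_max_right _ _).trans hr
  have hr0 : 0 < r := by linarith
  have hs0 : 0 < √r := Real.sqrt_pos.2 hr0
  have hs1 : 1 ≤ √r := Real.one_le_sqrt.2 hr1
  have hss : √r * √r = r := Real.mul_self_sqrt hr0.le
  have hssc : ((√r : ℝ) : ℂ) * ((√r : ℝ) : ℂ) = r := by exact_mod_cast hss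
  set q := √√r with hq
  have hq0 : 0 < q := Real.sqrt_pos.2 hs0
  have hqq : q * q = √r := Real.mul_self_sqrt hs0.le
  have hq6 : q ^ 6 = r * √r := by
    rw [show q ^ 6 = (q * q) * (q * q) * (q * q) by ring, hqq, hss]
  -- Relative size of the error in the Gaussian approximation: 128 = 2⁷ comes from √(Re w) ≥ q/2
  -- raised to the seventh power. The threshold 1024K for r makes η ≤ 1/8.
  set η := 128 * K / (r * √r) with hη
  have hη0 : 0 < η := by positivity
  have hη8 : η ≤ 1 / 8 := by
    rw [hη, div_le_iff₀ (by positivity)]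
    nlinarith
  set G := √(Real.pi / √r) with hG
  have hG1 : 1 / q ≤ G := by
    rw [hG, Real.sqrt_div' _ hs0.le]
    have : 1 ≤ √Real.pi := Real.one_le_sqrt.2 (by linarith [Real.pi_gt_three])
    gcongr
  have hG0 : 0 < G := lt_of_lt_of_le (by positivity) hG1
  set w : ℝ → ℂ := fun φ => (√r : ℝ) * Complex.exp (φ / 2 * Complex.I) with hw
  set δ : ℝ → ℂ := fun φ => saddleMoment 0 (w φ) * Complex.exp (φ / 4 * Complex.I) - G with hδ
  have hwre : ∀ φ ∈ Icc 0 (Real.pi / 3), √r / 2 ≤ (w φ).re := fun φ hφ => by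
    rw [hw]
    simp only
    rw [Complex.re_ofReal_mul, show (φ : ℂ) / 2 = ((φ / 2 : ℝ) : ℂ) by push_cast; rfl,
      Complex.exp_ofReal_mul_I_re]
    have : Real.cos (Real.pi / 3) ≤ Real.cos (φ / 2) :=
      Real.cos_le_cos_of_nonneg_of_le_pi (by linarith [hφ.1]) (by linarith) (by linarith [hφ.2])
    rw [Real.cos_pi_div_three] at this
    nlinarith
  have hδb : ∀ φ ∈ Icc 0 (Real.pi / 3), ‖δ φ‖ ≤ η * G := fun φ hφ => by
    have h1 := hwre φ hφ
    have h2 := hJ (w φ) (by linarith)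
    have e : δ φ = (saddleMoment 0 (w φ) - (Real.pi / w φ) ^ (1 / 2 : ℂ)) *
        Complex.exp (φ / 4 * Complex.I) := by
      simp only [hδ, hw]
      rw [sqrt_pi_div_polar hs0 hφ, sub_mul, mul_assoc, ← Complex.exp_add, neg_add_cancel,
        Complex.exp_zero, mul_one]
    have en : ‖Complex.exp ((φ : ℂ) / 4 * Complex.I)‖ = 1 := by
      rw [show (φ : ℂ) / 4 = ((φ / 4 : ℝ) : ℂ) by push_cast; rfl, Complex.norm_exp_ofReal_mul_I]
    rw [e, norm_mul, en, mul_one]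
    refine h2.trans ?_
    have h3 : q / 2 ≤ √(w φ).re := by
      refine Real.le_sqrt_of_sq_le ?_
      nlinarith
    calc K * (√(w φ).re)⁻¹ ^ 7 ≤ K * (q / 2)⁻¹ ^ 7 := by gcongr
      _ = 128 * K / q ^ 6 * (1 / q) := by field_simp; norm_num
      _ ≤ η * G := by rw [hq6]; gcongr
  -- The expected leading exponent is removed from the logarithm, so exp M stays near the constant
  -- kG on the whole arc. As M is continuous in φ and real at φ = 0, its imaginary part stays small
  -- up to φ = π/3, without ambiguity modulo 2π.
  set M : ℝ → ℂ := fun φ => airyLog φ r +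
    2 / 3 * (r * (√r : ℝ)) * Complex.exp (3 * φ / 2 * Complex.I) + φ / 4 * Complex.I with hM
  have hexpM : ∀ φ ∈ Icc 0 (Real.pi / 3), Complex.exp (M φ) = k * (G + δ φ) := fun φ hφ => by
    have h1 := hwre φ hφ
    have e2 : (w φ) ^ 2 = r * Complex.exp (φ * Complex.I) := by
      simp only [hw]
      rw [mul_pow, sq, hssc, ← Complex.exp_nat_mul]
      congr 2
      push_cast
      ring
    have e3 : (w φ) ^ 3 = r * (√r : ℝ) * Complex.exp (3 * φ / 2 * Complex.I) := by
      simp only [hw]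
      rw [mul_pow, pow_succ, sq, hssc, ← Complex.exp_nat_mul]
      congr 2
      push_cast
      ring
    simp only [hM]
    rw [Complex.exp_add, Complex.exp_add, exp_airyLog hφ hr0.le, ← e2, hrep _ (by linarith), saddle,
      mul_assoc (2 / 3 : ℂ), ← e3, Complex.exp_neg]
    simp only [hδ]
    field_simp
    ring
  have h0mem : (0 : ℝ) ∈ Icc 0 (Real.pi / 3) := ⟨le_rfl, by positivity⟩
  have h3mem : Real.pi / 3 ∈ Icc 0 (Real.pi / 3) := ⟨by positivity, le_rfl⟩
  have hden : G / 2 ≤ ‖(G : ℂ) + δ 0‖ := by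
    have h1 := norm_sub_norm_le (G : ℂ) (-δ 0)
    rw [norm_neg, sub_neg_eq_add, Complex.norm_real, Real.norm_of_nonneg hG0.le] at h1
    have h2 := hδb 0 h0mem
    nlinarith
  have hne : (G : ℂ) + δ 0 ≠ 0 := norm_pos_iff.1 (by linarith)
  have hnear : ∀ φ ∈ Icc 0 (Real.pi / 3), ‖Complex.exp (M φ - M 0) - 1‖ ≤ 4 * η := fun φ hφ => by
    have e : Complex.exp (M φ - M 0) - 1 = (δ φ - δ 0) / (G + δ 0) := by
      rw [Complex.exp_sub, hexpM φ hφ, hexpM 0 h0mem, mul_div_mul_left _ _ hk]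
      field_simp
      ring
    rw [e, norm_div, div_le_iff₀ (by linarith)]
    have h1 := norm_sub_le (δ φ) (δ 0)
    have h2 := hδb φ hφ
    have h3 := hδb 0 h0mem
    nlinarith
  have hcont : Continuous M := by
    have := continuous_airyLog r
    simp only [hM]
    fun_prop
  have hstrip := abs_im_lt_of_exp_re_pos (g := fun φ => M φ - M 0) h3mem.1
    (Continuous.continuousOn (by fun_prop)) (by simp) (fun φ hφ => by
      have h1 := (Complex.abs_re_le_norm _).trans (hnear φ hφ)
      rw [Complex.sub_re, Complex.one_re] at h1
      have h2 := (abs_le.1 h1).1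
      linarith)
  -- Here 4η ≤ 1/2, and the outcome 16η is the final constant.
  have hfin := abs_im_le_of_exp_near_one hstrip (hnear _ h3mem) (by linarith)
  have hM0 : (M 0).im = 0 := by
    simp only [hM]
    rw [Complex.add_im, Complex.add_im, airyLog_zero_im]
    simp
  have hM3 : (M (Real.pi / 3)).im =
      (airyLog (Real.pi / 3) r).im + 2 / 3 * (r * √r) + Real.pi / 12 := by
    have e1 : (3 * ((Real.pi / 3 : ℝ) : ℂ) / 2 * Complex.I) = Real.pi / 2 * Complex.I := by
      push_cast
      ring
    have e2 : ((Real.pi / 3 : ℝ) : ℂ) / 4 * Complex.I = ((Real.pi / 12 : ℝ) : ℂ) * Complex.I := by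
      push_cast
      ring
    have e3 : (2 / 3 * (r * (√r : ℝ)) * Complex.I : ℂ) =
        ((2 / 3 * (r * √r) : ℝ) : ℂ) * Complex.I := by
      push_cast
      ring
    simp only [hM]
    rw [e1, e2, Complex.exp_pi_div_two_mul_I, e3]
    simp
  rw [Complex.sub_im, hM0, hM3, sub_zero] at hfin
  calc _ ≤ 4 * (4 * η) := hfin
    _ = _ := by rw [hη]; ring

/-- The phase `θ` with `Ai (-x) = 2 |Ai (x exp (i π/3))| cos (θ x)`. -/
def airyPhase (x : ℝ) : ℝ := -(Real.pi / 3) - (airyLog (Real.pi / 3) x).im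

theorem airyPhase_zero : airyPhase 0 = -(Real.pi / 3) := by
  simp [airyPhase, airyLog]

theorem continuous_airyPhase : Continuous airyPhase :=
  continuous_const.sub (Complex.continuous_im.comp
    (continuous_iff_continuousAt.2 fun x => (hasDerivAt_airyLog _ x).continuousAt))

theorem airyPhase_asymptotic : ∃ K X : ℝ, 0 < K ∧ 1 ≤ X ∧ ∀ x : ℝ, X ≤ x →
    |airyPhase x - (2 / 3 * (x * √x) - Real.pi / 4)| ≤ K / (x * √x) := by
  obtain ⟨K, X, hK, hX, h⟩ := airyLog_asymptotic
  refine ⟨K, X, hK, hX, fun x hx => ?_⟩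
  rw [← abs_neg]
  convert h x hx using 2
  rw [airyPhase]
  ring

theorem pi_div_three_mem : Real.pi / 3 ∈ Icc 0 (Real.pi / 3) :=
  ⟨by have := Real.pi_pos; positivity, le_rfl⟩

/-- With o = exp(iπ/3), the connection formula for w = o² at -x reads Ai(-x) = o·Ai(ox) + its
conjugate, that is, twice a real part. -/
theorem airyAi_neg_eq {x : ℝ} (hx : 0 ≤ x) :
    airyAi (-x) = ((2 * Real.exp (airyLog (Real.pi / 3) x).re * Real.cos (airyPhase x) : ℝ) : ℂ) := by
  set o := Complex.exp ((Real.pi / 3 : ℝ) * Complex.I) with ho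
  have ho3 : o ^ 3 = -1 := by
    rw [ho, ← Complex.exp_nat_mul, ← Complex.exp_pi_mul_I]
    congr 1
    push_cast
    ring
  have hoc : starRingEnd ℂ o * o = 1 := by
    rw [mul_comm, Complex.mul_conj, Complex.normSq_eq_norm_sq, ho, Complex.norm_exp_ofReal_mul_I]
    simp
  have hone : o + 1 ≠ 0 := fun h => by
    have := congrArg Complex.re h
    rw [ho, Complex.add_re, Complex.exp_ofReal_mul_I_re, Real.cos_pi_div_three] at this
    norm_num at this
  have ho2 : o ^ 2 - o + 1 = 0 := by
    refine (mul_eq_zero.1 (?_ : (o + 1) * (o ^ 2 - o + 1) = 0)).resolve_left hone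
    linear_combination ho3
  have hconj : starRingEnd ℂ o = -o ^ 2 := by
    linear_combination (-o ^ 2) * hoc + starRingEnd ℂ o * ho3
  have hconn := airyAi_connection (w := o ^ 2) (by linear_combination (o ^ 2 + o + 1) * ho2) (-x)
  have e4 : (o ^ 2) ^ 2 = -o := by linear_combination o * ho3
  rw [e4] at hconn
  have e1 : o ^ 2 * (-(x : ℂ)) = starRingEnd ℂ (x * o) := by
    rw [map_mul, Complex.conj_ofReal, hconj]
    ring
  rw [e1, airyAi_conj, show -o * -(x : ℂ) = x * o by ring, ← exp_airyLog pi_div_three_mem hx] at hconn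
  have h2 : airyAi (-x) = o * Complex.exp (airyLog (Real.pi / 3) x) +
      starRingEnd ℂ (o * Complex.exp (airyLog (Real.pi / 3) x)) := by
    rw [map_mul, hconj]
    linear_combination hconn
  rw [h2, Complex.add_conj, ho, ← Complex.exp_add, Complex.exp_re]
  congr 1
  have e5 : ((Real.pi / 3 : ℝ) * Complex.I + airyLog (Real.pi / 3) x).re =
      (airyLog (Real.pi / 3) x).re := by
    rw [Complex.add_re, Complex.re_ofReal_mul]; simp
  have e6 : ((Real.pi / 3 : ℝ) * Complex.I + airyLog (Real.pi / 3) x).im = -airyPhase x := by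
    rw [Complex.add_im, Complex.im_ofReal_mul, airyPhase]; simp [add_comm]
  rw [e5, e6, Real.cos_neg]
  ring

theorem airyAi_neg_eq_zero_iff {x : ℝ} (hx : 0 ≤ x) :
    airyAi (-x) = 0 ↔ Real.cos (airyPhase x) = 0 := by
  rw [airyAi_neg_eq hx, Complex.ofReal_eq_zero]
  have := Real.exp_pos (airyLog (Real.pi / 3) x).re
  simp [this.ne']

/-- The function h(x) = Ai(x·exp(iπ/3)) solves h'' = -xh, a real equation, so Im(h'·h̄) is constant.
At 0 it is negative, and θ' is minus this constant divided by |h|². -/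
theorem airyPhase_deriv_pos {x : ℝ} (hx : 0 ≤ x) :
    HasDerivAt airyPhase (-(airyLogDeriv (Real.pi / 3) x).im) x ∧
      0 < -(airyLogDeriv (Real.pi / 3) x).im := by
  refine ⟨(hasDerivAt_im (hasDerivAt_airyLog _ x)).const_sub _, ?_⟩
  set o := Complex.exp ((Real.pi / 3 : ℝ) * Complex.I) with ho
  have ho3 : o ^ 3 = -1 := by
    rw [ho, ← Complex.exp_nat_mul, ← Complex.exp_pi_mul_I]
    congr 1
    push_cast
    ring
  set h : ℝ → ℂ := fun x => airyAi (0 + o * x) with hh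
  set h₁ : ℝ → ℂ := fun x => o * deriv airyAi (0 + o * x) with hh₁
  have hd : ∀ x, HasDerivAt h (h₁ x) x := hasDerivAt_airyAi_line 0 o
  have hd1 : ∀ x : ℝ, HasDerivAt h₁ (-x * h x) x := fun x =>
    (hasDerivAt_deriv_airyAi_line 0 o x).congr_deriv (by
      simp only [hh, zero_add]
      linear_combination (x * airyAi (o * x)) * ho3)
  have hW : ∀ y : ℝ, HasDerivAt (fun y => (h₁ y * starRingEnd ℂ (h y)).im) 0 y := fun y => by
    refine (hasDerivAt_im ((hd1 y).mul (hd y).star)).congr_deriv ?_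
    change (-y * h y * starRingEnd ℂ (h y) + h₁ y * starRingEnd ℂ (h₁ y)).im = 0
    rw [mul_assoc, Complex.mul_conj, Complex.mul_conj, ← Complex.ofReal_neg, ← Complex.ofReal_mul,
      ← Complex.ofReal_add, Complex.ofReal_im]
  have hconst : (h₁ x * starRingEnd ℂ (h x)).im = (h₁ 0 * starRingEnd ℂ (h 0)).im :=
    is_const_of_deriv_eq_zero (fun y => (hW y).differentiableAt) (fun y => (hW y).deriv) x 0
  have hneg : (h₁ x * starRingEnd ℂ (h x)).im < 0 := by
    rw [hconst]
    simp only [hh, hh₁, Complex.ofReal_zero, mul_zero, add_zero, airyAi_zero, deriv_airyAi_zero,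
      Complex.conj_ofReal]
    rw [show o * -(airySlope : ℂ) * airyZero = ((-(airySlope * airyZero) : ℝ) : ℂ) * o by
      push_cast; ring, Complex.im_ofReal_mul, ho, Complex.exp_ofReal_mul_I_im,
      Real.sin_pi_div_three]
    have := mul_pos (mul_pos airySlope_pos airyZero_pos)
      (show 0 < √3 / 2 by positivity)
    linarith
  have hne : h x ≠ 0 := by
    have := airyAi_sector_ne_zero hx pi_div_three_mem
    rwa [mul_comm, ← ho, ← zero_add (o * _)] at this
  have e : airyLogDeriv (Real.pi / 3) x = h₁ x / h x := by
    simp only [airyLogDeriv, clampAngle_of_mem pi_div_three_mem, max_eq_left hx, hh, hh₁, zero_add,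
      ← ho, mul_comm (x : ℂ) o]
  have hn : 0 < Complex.normSq (h x) := Complex.normSq_pos.2 hne
  rw [e, div_eq_mul_inv, Complex.inv_def, ← mul_assoc, Complex.im_mul_ofReal]
  have := mul_pos (neg_pos.2 hneg) (inv_pos.2 hn)
  linarith

theorem strictMonoOn_airyPhase : StrictMonoOn airyPhase (Ici 0) := by
  refine strictMonoOn_of_deriv_pos (convex_Ici 0) continuous_airyPhase.continuousOn fun x hx => ?_
  have := airyPhase_deriv_pos (interior_subset hx)
  rw [this.1.deriv]
  exact this.2

theorem tendsto_airyPhase : Tendsto airyPhase atTop atTop := by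
  obtain ⟨K, X, hK, hX, h⟩ := airyPhase_asymptotic
  have h1 : Tendsto (fun x : ℝ => 2 / 3 * x - Real.pi / 4 - K) atTop atTop :=
    tendsto_atTop_add_const_right _ _ (tendsto_atTop_add_const_right _ _
      (tendsto_id.const_mul_atTop (by norm_num)))
  refine tendsto_atTop_mono' _ ?_ h1
  filter_upwards [eventually_ge_atTop X] with x hx
  have hx1 : 1 ≤ x := hX.trans hx
  have hs : 1 ≤ √x := Real.one_le_sqrt.2 hx1
  have h2 := (abs_le.1 (h x hx)).1
  have h3 : x ≤ x * √x := le_mul_of_one_le_right (by linarith) hs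
  have h4 : K / (x * √x) ≤ K := div_le_self hK.le (by linarith)
  linarith

/-! ### Enumeration and asymptotics of the zeros -/

theorem exists_airyPhase_eq {y : ℝ} (hy : 0 < y) : ∃ x, 0 < x ∧ airyPhase x = y := by
  obtain ⟨b, hb, hb0⟩ := ((tendsto_airyPhase.eventually_ge_atTop y).and
    (eventually_ge_atTop 0)).exists
  obtain ⟨x, hx, hxe⟩ := intermediate_value_Icc hb0 continuous_airyPhase.continuousOn
    (show y ∈ Icc (airyPhase 0) (airyPhase b) from
      ⟨by rw [airyPhase_zero]; have := Real.pi_pos; linarith, hb⟩)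
  refine ⟨x, lt_of_le_of_ne hx.1 ?_, hxe⟩
  rintro rfl
  rw [airyPhase_zero] at hxe
  have := Real.pi_pos
  linarith

/-- With cube roots a and b, the claim is b(a + b) ≤ a² + ab + b² times |a - b|. It transfers an
error in t^{3/2} to one in t. -/
theorem abs_rpow_two_thirds_sub_le {A B : ℝ} (hA : 0 ≤ A) (hB : 0 < B) :
    |A ^ (2 / 3 : ℝ) - B ^ (2 / 3 : ℝ)| ≤ |A - B| * B ^ (-(1 / 3) : ℝ) := by
  set a := A ^ (1 / 3 : ℝ) with ha
  set b := B ^ (1 / 3 : ℝ) with hb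
  have ha0 : 0 ≤ a := by positivity
  have hb0 : 0 < b := by positivity
  have ha2 : A ^ (2 / 3 : ℝ) = a ^ 2 := by
    rw [ha, ← Real.rpow_natCast, ← Real.rpow_mul hA]; norm_num
  have hb2 : B ^ (2 / 3 : ℝ) = b ^ 2 := by
    rw [hb, ← Real.rpow_natCast, ← Real.rpow_mul hB.le]; norm_num
  have ha3 : A = a ^ 3 := by
    rw [ha, ← Real.rpow_natCast, ← Real.rpow_mul hA]; norm_num
  have hb3 : B = b ^ 3 := by
    rw [hb, ← Real.rpow_natCast, ← Real.rpow_mul hB.le]; norm_num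
  rw [Real.rpow_neg hB.le, ← hb, ha2, hb2, ← div_eq_mul_inv, le_div_iff₀ hb0]
  have hAB : A - B = a ^ 3 - b ^ 3 := congrArg₂ (· - ·) ha3 hb3
  rw [hAB, show a ^ 2 - b ^ 2 = (a - b) * (a + b) by ring,
    show a ^ 3 - b ^ 3 = (a - b) * (a ^ 2 + a * b + b ^ 2) by ring, abs_mul, abs_mul, mul_assoc,
    abs_of_nonneg (by positivity : 0 ≤ a + b),
    abs_of_nonneg (by positivity : 0 ≤ a ^ 2 + a * b + b ^ 2)]
  refine mul_le_mul_of_nonneg_left ?_ (abs_nonneg _)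
  nlinarith [sq_nonneg a]

/-- Zeros of Ai(-x) are zeros of cos θ(x), and θ increases from -π/3 to infinity, so it meets (n -
1/2)π exactly once for each n ≥ 1 and no lower odd multiple of π/2. Inverting the phase asymptotics
gives t^{3/2} = (3π/2)(n - 1/4) + O(1/n). -/
theorem exists_airy_zeros : ∃ t : ℕ → ℝ, StrictMonoOn t (Ici 1) ∧ (∀ n ≥ 1, 0 < t n) ∧
    (∀ z : ℂ, airyAi z = 0 ↔ ∃ n ≥ 1, z = -(t n : ℂ)) ∧
    Tendsto t atTop atTop ∧
    (fun n : ℕ => t n - (3 * Real.pi / 2 * ((n : ℝ) - 1 / 4)) ^ (2 / 3 : ℝ))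
      =O[atTop] (fun n : ℕ => (n : ℝ) ^ (-(4 / 3) : ℝ)) := by
  have hpi := Real.pi_pos
  have hex : ∀ n : ℕ, ∃ x : ℝ, 1 ≤ n → 0 < x ∧ airyPhase x = ((n : ℝ) - 1 / 2) * Real.pi := by
    intro n
    rcases lt_or_ge n 1 with h | h
    -- The index 0 carries an arbitrary value.
    · exact ⟨0, fun h' => absurd h' (by omega)⟩
    · have h1 : (1 : ℝ) ≤ n := by exact_mod_cast h
      obtain ⟨x, hx⟩ := exists_airyPhase_eq (y := ((n : ℝ) - 1 / 2) * Real.pi)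
        (mul_pos (by linarith) hpi)
      exact ⟨x, fun _ => hx⟩
  choose t ht using hex
  have htop : Tendsto t atTop atTop := by
    refine tendsto_atTop.2 fun b => ?_
    obtain ⟨N, hN⟩ := exists_nat_gt (airyPhase (max b 0) / Real.pi + 1 / 2)
    filter_upwards [eventually_ge_atTop (max N 1)] with n hn
    obtain ⟨h0, h1⟩ := ht n ((le_max_right _ _).trans hn)
    have hNn : (N : ℝ) ≤ n := by exact_mod_cast (le_max_left _ _).trans hn
    refine (le_max_left b 0).trans (le_of_lt ?_)
    rw [← strictMonoOn_airyPhase.lt_iff_lt (le_max_right b 0) h0.le, h1, ← div_lt_iff₀ hpi]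
    linarith
  refine ⟨t, fun m hm n hn hmn => ?_, fun n hn => (ht n hn).1, fun z => ⟨fun hz => ?_, ?_⟩, htop, ?_⟩
  · rw [← strictMonoOn_airyPhase.lt_iff_lt (ht m hm).1.le (ht n hn).1.le, (ht m hm).2, (ht n hn).2]
    have : (m : ℝ) < n := by exact_mod_cast hmn
    gcongr
  · obtain ⟨him, hre⟩ := airyAi_zero_re_im hz
    have hzx : z = -((-z.re : ℝ) : ℂ) := Complex.ext (by simp) (by simp [him])
    have hx : 0 ≤ -z.re := by linarith
    rw [hzx, airyAi_neg_eq_zero_iff hx, Real.cos_eq_zero_iff] at hz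
    obtain ⟨j, hj⟩ := hz
    -- The phase is at least -π/3 > -π/2, which excludes negative j and fixes the numbering.
    have hj0 : 0 ≤ j := by
      have h1 : airyPhase 0 ≤ airyPhase (-z.re) :=
        strictMonoOn_airyPhase.monotoneOn self_mem_Ici hx hx
      rw [airyPhase_zero, hj] at h1
      by_contra hneg
      have : (j : ℝ) ≤ -1 := by exact_mod_cast (by omega : j ≤ -1)
      nlinarith
    obtain ⟨n, rfl⟩ := Int.eq_ofNat_of_zero_le hj0
    refine ⟨n + 1, by omega, ?_⟩
    have h1 := ht (n + 1) (by omega)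
    have : -z.re = t (n + 1) := by
      refine strictMonoOn_airyPhase.injOn hx h1.1.le ?_
      rw [h1.2, hj]
      push_cast
      ring
    rw [hzx, this]
  · rintro ⟨n, hn, rfl⟩
    rw [airyAi_neg_eq_zero_iff (ht n hn).1.le, (ht n hn).2, Real.cos_eq_zero_iff]
    exact ⟨(n : ℤ) - 1, by push_cast; ring⟩
  · obtain ⟨K, X, hK, hX, hasym⟩ := airyPhase_asymptotic
    refine Asymptotics.IsBigO.of_bound (3 * K) ?_
    filter_upwards [htop.eventually_ge_atTop (max X (3 / 2 * K)), eventually_ge_atTop 1] with n hn hn1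
    have hX' : X ≤ t n := (le_max_left _ _).trans hn
    have hK' : 3 / 2 * K ≤ t n := (le_max_right _ _).trans hn
    have ht1 : 1 ≤ t n := hX.trans hX'
    have hs1 : 1 ≤ √(t n) := Real.one_le_sqrt.2 ht1
    have hn1' : (1 : ℝ) ≤ n := by exact_mod_cast hn1
    set T := t n * √(t n) with hT
    have hTt : t n ≤ T := le_mul_of_one_le_right (by linarith) hs1
    have hT0 : 0 < T := by linarith
    set s := 3 * Real.pi / 2 * ((n : ℝ) - 1 / 4) with hs
    have hns : (n : ℝ) ≤ s := by nlinarith [Real.pi_gt_three]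
    have hs0 : 0 < s := by linarith
    have h1 := hasym (t n) hX'
    rw [(ht n hn1).2, ← hT] at h1
    have h2 : |T - s| ≤ 3 / 2 * K / T := by
      rw [show T - s = -(3 / 2) * (((n : ℝ) - 1 / 2) * Real.pi - (2 / 3 * T - Real.pi / 4)) by
        rw [hs]; ring, abs_mul, abs_neg, abs_of_pos (by norm_num : (0 : ℝ) < 3 / 2), mul_div_assoc]
      gcongr
    -- The threshold t ≥ 3K/2 makes the error at most 1, and T ≥ 1; so O(1/T) may be read as O(1/s).
    have h3 : s ≤ 2 * T := by
      have h4 : 3 / 2 * K / T ≤ 1 := by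
        rw [div_le_one hT0]
        linarith
      have := (abs_le.1 h2).1
      linarith
    have htT : t n = T ^ (2 / 3 : ℝ) := by
      have ht0 : 0 < t n := by linarith
      rw [hT, Real.sqrt_eq_rpow]
      nth_rewrite 2 [← Real.rpow_one (t n)]
      rw [← Real.rpow_add ht0, ← Real.rpow_mul ht0.le]
      norm_num
    have hnpos : 0 < (n : ℝ) ^ (-(4 / 3) : ℝ) := Real.rpow_pos_of_pos (by linarith) _
    rw [Real.norm_of_nonneg hnpos.le, Real.norm_eq_abs, htT]
    calc |T ^ (2 / 3 : ℝ) - s ^ (2 / 3 : ℝ)| ≤ |T - s| * s ^ (-(1 / 3) : ℝ) :=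
          abs_rpow_two_thirds_sub_le hT0.le hs0
      _ ≤ (3 * K * s ^ (-1 : ℝ)) * s ^ (-(1 / 3) : ℝ) := by
          gcongr
          refine h2.trans ?_
          rw [Real.rpow_neg_one, ← div_eq_mul_inv, div_le_div_iff₀ hT0 hs0]
          nlinarith
      _ = 3 * K * s ^ (-(4 / 3) : ℝ) := by
          rw [mul_assoc, ← Real.rpow_add hs0]
          norm_num
      _ ≤ 3 * K * (n : ℝ) ^ (-(4 / 3) : ℝ) := by
          gcongr 3 * K * ?_
          exact Real.rpow_le_rpow_of_nonpos (by linarith) hns (by norm_num)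

/-! ### Operators given by bounded pointwise functionals are compact -/

section HilbertSchmidt

variable {E F : Type*} [NormedAddCommGroup E] [InnerProductSpace ℂ E]

/-- Testing on f = Σ conj(l(vᵢ))vᵢ gives l(f) = ‖f‖² = A, so the bound reads A² ≤ H·A. -/
theorem sum_norm_sq_le_of_functional {ι : Type*} {v : ι → E} (hv : Orthonormal ℂ v)
    (l : E →ₗ[ℂ] ℂ) {H : ℝ} (hH : 0 ≤ H) (hl : ∀ f, ‖l f‖ ^ 2 ≤ H * ‖f‖ ^ 2) (s : Finset ι) :
    ∑ i ∈ s, ‖l (v i)‖ ^ 2 ≤ H := by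
  set A := ∑ i ∈ s, ‖l (v i)‖ ^ 2 with hA
  have hA0 : 0 ≤ A := Finset.sum_nonneg fun i _ => by positivity
  set f := ∑ i ∈ s, starRingEnd ℂ (l (v i)) • v i with hf
  have h1 : l f = (A : ℂ) := by
    rw [hf, map_sum, hA]
    push_cast
    refine Finset.sum_congr rfl fun i _ => ?_
    rw [map_smul, smul_eq_mul, mul_comm, Complex.mul_conj, Complex.normSq_eq_norm_sq]
    push_cast
    rfl
  have h2 : ‖f‖ ^ 2 = A := by
    have h3 : inner ℂ f f = (A : ℂ) := by
      rw [hf, hv.inner_sum, hA]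
      push_cast
      refine Finset.sum_congr rfl fun i _ => ?_
      rw [Complex.conj_conj, Complex.mul_conj, Complex.normSq_eq_norm_sq]
      push_cast
      rfl
    rw [← inner_self_eq_norm_sq (𝕜 := ℂ), h3]
    simp
  have h4 := hl f
  rw [h1, h2, Complex.norm_real, Real.norm_of_nonneg hA0] at h4
  rcases hA0.eq_or_lt with h0 | h0
  · rwa [← h0]
  · nlinarith

variable [NormedAddCommGroup F] [NormedSpace ℂ F] [CompleteSpace F]

/-- An operator with square summable images of an orthonormal basis is compact. -/
theorem isCompactOperator_of_summable {ι : Type*} (b : HilbertBasis ι ℂ E) (T : E →L[ℂ] F)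
    (h : Summable fun i => ‖T (b i)‖ ^ 2) : IsCompactOperator T := by
  -- Finite rank truncations. Cauchy-Schwarz and Bessel bound the norm of the remainder by the
  -- square root of the tail of Σ‖T bᵢ‖².
  set S : Finset ι → (E →L[ℂ] F) := fun s =>
    ∑ i ∈ s, (ContinuousLinearMap.toSpanSingleton ℂ (T (b i))).comp (innerSL ℂ (b i)) with hS
  have hSapp : ∀ s f, S s f = ∑ i ∈ s, inner ℂ (b i) f • T (b i) := fun s f => by
    simp [hS]
  have hcomp : ∀ s, IsCompactOperator (S s) := fun s => by
    have h1 : ∀ i, IsCompactOperator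
        ((ContinuousLinearMap.toSpanSingleton ℂ (T (b i))).comp (innerSL ℂ (b i))) := fun i =>
      (isCompactOperator_of_locallyCompactSpace_dom (innerSL ℂ (b i))).clm_comp
        (ContinuousLinearMap.toSpanSingleton ℂ (T (b i)))
    simp only [hS]
    induction s using Finset.cons_induction with
    | empty => simpa using isCompactOperator_zero
    | cons i s hi ih =>
      rw [Finset.sum_cons, FunLike.coe_add]
      exact (h1 i).add ih
  refine isCompactOperator_of_tendsto (l := atTop) (F := S) ?_ (Eventually.of_forall hcomp)
  classical
  rw [Metric.tendsto_atTop]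
  intro ε hε
  obtain ⟨s₀, hs₀⟩ := summable_iff_vanishing_norm.1 h ((ε / 2) ^ 2) (by positivity)
  refine ⟨s₀, fun s hs => ?_⟩
  rw [dist_comm, dist_eq_norm]
  refine lt_of_le_of_lt (ContinuousLinearMap.opNorm_le_bound _ (by positivity : 0 ≤ ε / 2)
    fun f => ?_) (by linarith)
  have hsum : HasSum (fun i => inner ℂ (b i) f • T (b i)) (T f) := by
    have := (b.hasSum_repr f).mapL T
    simpa [b.repr_apply_apply] using this
  have hlim : Tendsto (fun s' : Finset ι => S s' f - S s f) atTop (𝓝 (T f - S s f)) := by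
    refine Tendsto.sub_const ?_ _
    simp only [hSapp]
    rw [HasSum, SummationFilter.unconditional_filter] at hsum
    exact hsum
  refine le_of_tendsto hlim.norm ((eventually_ge_atTop s).mono fun s' hs' => ?_)
  have e : S s' f - S s f = ∑ i ∈ s' \ s, inner ℂ (b i) f • T (b i) := by
    rw [hSapp, hSapp, ← Finset.sum_sdiff hs', add_sub_cancel_right]
  rw [e]
  have hv := hs₀ (s' \ s) (Finset.disjoint_of_subset_right hs Finset.sdiff_disjoint)
  rw [Real.norm_of_nonneg (Finset.sum_nonneg fun i _ => by positivity)] at hv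
  have hB : ∑ i ∈ s' \ s, ‖inner ℂ (b i) f‖ ^ 2 ≤ ‖f‖ ^ 2 :=
    b.orthonormal.sum_inner_products_le f
  have hCS := Finset.sum_mul_sq_le_sq_mul_sq (s' \ s) (fun i => ‖inner ℂ (b i) f‖)
    (fun i => ‖T (b i)‖)
  have hn : ‖∑ i ∈ s' \ s, inner ℂ (b i) f • T (b i)‖ ≤
      ∑ i ∈ s' \ s, ‖inner ℂ (b i) f‖ * ‖T (b i)‖ :=
    (norm_sum_le _ _).trans (le_of_eq (Finset.sum_congr rfl fun i _ => norm_smul _ _))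
  refine hn.trans (abs_le_of_sq_le_sq' ?_ (by positivity)).2
  calc _ ≤ _ := hCS
    _ ≤ ‖f‖ ^ 2 * (ε / 2) ^ 2 := by gcongr
    _ = _ := by ring

variable {X : Type*} [MeasurableSpace X] {μ : Measure X}

theorem norm_toLp_sq {f : X → ℂ} (hf : MemLp f 2 μ) : ‖hf.toLp f‖ ^ 2 = ∫ x, ‖f x‖ ^ 2 ∂μ := by
  have h1 : inner ℂ (hf.toLp f) (hf.toLp f) = ((∫ x, ‖f x‖ ^ 2 ∂μ : ℝ) : ℂ) := by
    rw [L2.inner_def, ← integral_complex_ofReal]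
    refine integral_congr_ae ?_
    filter_upwards [hf.coeFn_toLp] with x hx
    rw [hx, inner_self_eq_norm_sq_to_K]
    push_cast
    rfl
  rw [← inner_self_eq_norm_sq (𝕜 := ℂ), h1]
  simp

/-- A measurable family of functionals with square integrable norms defines a compact operator. -/
theorem exists_compact_of_functionals [CompleteSpace E] (l : X → E →ₗ[ℂ] ℂ) {H : X → ℝ} (hH : Integrable H μ)
    (hm : ∀ f, AEStronglyMeasurable (fun x => l x f) μ)
    (hl : ∀ᵐ x ∂μ, ∀ f, ‖l x f‖ ^ 2 ≤ H x * ‖f‖ ^ 2) (hH0 : ∀ᵐ x ∂μ, 0 ≤ H x) :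
    ∃ T : E →L[ℂ] Lp ℂ 2 μ, (∀ f, T f =ᵐ[μ] fun x => l x f) ∧ IsCompactOperator T := by
  have hint : ∀ f, Integrable (fun x => ‖l x f‖ ^ 2) μ := fun f => by
    refine (hH.mul_const (‖f‖ ^ 2)).mono' ((hm f).norm.pow 2) ?_
    filter_upwards [hl] with x hx
    rw [Real.norm_of_nonneg (by positivity)]
    exact hx f
  have hmem : ∀ f, MemLp (fun x => l x f) 2 μ := fun f =>
    (memLp_two_iff_integrable_sq_norm (hm f)).2 (hint f)
  let T₀ : E →ₗ[ℂ] Lp ℂ 2 μ :=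
    { toFun := fun f => (hmem f).toLp _
      map_add' := fun f g => by
        rw [← MemLp.toLp_add]
        congr 1
        ext x
        simp
      map_smul' := fun a f => by
        rw [RingHom.id_apply, ← MemLp.toLp_const_smul]
        congr 1
        ext x
        simp }
  have hI : 0 ≤ ∫ x, H x ∂μ := integral_nonneg_of_ae hH0
  have hbound : ∀ f, ‖T₀ f‖ ≤ √(∫ x, H x ∂μ) * ‖f‖ := fun f => by
    refine (abs_le_of_sq_le_sq' ?_ (by positivity)).2
    rw [mul_pow, Real.sq_sqrt hI]
    change ‖(hmem f).toLp _‖ ^ 2 ≤ _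
    rw [norm_toLp_sq, ← integral_mul_const]
    refine integral_mono_ae (hint f) (hH.mul_const _) ?_
    filter_upwards [hl] with x hx using hx f
  let T : E →L[ℂ] Lp ℂ 2 μ := T₀.mkContinuous _ hbound
  refine ⟨T, fun f => (hmem f).coeFn_toLp, ?_⟩
  obtain ⟨w, b, -⟩ := exists_hilbertBasis ℂ E
  refine isCompactOperator_of_summable b T ?_
  -- Exchanging the finite sum with the integral reduces square summability to the pointwise
  -- inequality for each functional.
  refine summable_of_sum_le (c := ∫ x, H x ∂μ) (fun i => by positivity) fun s => ?_
  have e : ∀ i, ‖T (b i)‖ ^ 2 = ∫ x, ‖l x (b i)‖ ^ 2 ∂μ := fun i => norm_toLp_sq (hmem (b i))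
  simp only [e]
  rw [← integral_finsetSum _ fun i _ => hint (b i)]
  refine integral_mono_ae (integrable_finsetSum _ fun i _ => hint (b i)) hH ?_
  filter_upwards [hl, hH0] with x hx hx0
  exact sum_norm_sq_le_of_functional b.orthonormal (l x) hx0 hx s

end HilbertSchmidt

/-! ### Decaying solutions -/

theorem memLp_of_exp_decay {f : ℝ → ℂ} (hf : Continuous f) {C m : ℝ} (hm : 0 < m)
    (h : ∀ x : ℝ, 0 ≤ x → ‖f x‖ ≤ C * Real.exp (-m * x)) :
    MemLp f 2 (volume.restrict (Ioi (0 : ℝ))) := by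
  rw [memLp_two_iff_integrable_sq_norm hf.aestronglyMeasurable]
  refine ((integrableOn_exp_mul_Ioi (neg_neg_of_pos hm) 0).const_mul (C ^ 2)).mono'
    (hf.norm.pow 2).aestronglyMeasurable ?_
  filter_upwards [ae_restrict_mem measurableSet_Ioi] with x hx
  have hx0 : 0 ≤ x := le_of_lt hx
  have e1 : Real.exp (-m * x) ≤ 1 := Real.exp_le_one_iff.2 (by nlinarith)
  have e0 := Real.exp_pos (-m * x)
  rw [Real.norm_of_nonneg (by positivity)]
  calc ‖f x‖ ^ 2 ≤ (C * Real.exp (-m * x)) ^ 2 := by gcongr; exact h x hx0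
    _ = C ^ 2 * (Real.exp (-m * x) * Real.exp (-m * x)) := by ring
    _ ≤ C ^ 2 * (Real.exp (-m * x) * 1) := by gcongr
    _ = _ := by rw [mul_one]

theorem memLp_airyAi_line {β : ℂ} (h1 : 0 < β.re) (h3 : 0 < (β ^ 3).re) (z₀ : ℂ) :
    MemLp (fun x : ℝ => airyAi (z₀ + β ^ 2 * x)) 2 (volume.restrict (Ioi (0 : ℝ))) := by
  obtain ⟨C, m, hC, hm, h⟩ := airyAi_decay_line h1 h3 z₀
  have := continuous_airyAi
  exact memLp_of_exp_decay (by fun_prop) hm fun x hx => (h x hx).1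

theorem memLp_deriv_airyAi_line {β : ℂ} (h1 : 0 < β.re) (h3 : 0 < (β ^ 3).re) (z₀ : ℂ) :
    MemLp (fun x : ℝ => β ^ 2 * deriv airyAi (z₀ + β ^ 2 * x)) 2
      (volume.restrict (Ioi (0 : ℝ))) := by
  obtain ⟨C, m, hC, hm, h⟩ := airyAi_decay_line h1 h3 z₀
  have := continuous_deriv_airyAi
  exact (memLp_of_exp_decay (by fun_prop) hm fun x hx => (h x hx).2).const_mul _

/-! ### Green's identity on the half-line -/

theorem IsW22Loc.isPrimitive {u u₁ u₂ : ℝ → ℂ} (h : IsW22Loc u u₁ u₂) : IsPrimitive u u₁ :=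
  fun x hx => ⟨h.intervalIntegrable_one hx, h.eq_integral_one x hx⟩

theorem IsW22Loc.isPrimitive_one {u u₁ u₂ : ℝ → ℂ} (h : IsW22Loc u u₁ u₂) : IsPrimitive u₁ u₂ :=
  fun x hx => ⟨h.intervalIntegrable_two hx, h.eq_integral_two x hx⟩

/-- An integrable function on the half-line whose increments over unit steps have a limit: the
limit is zero. -/
theorem eq_zero_of_tendsto_increment {g : ℝ → ℂ} (hg : IntegrableOn g (Ioi 0)) {a : ℂ}
    (h : Tendsto (fun x => g (x + 1) - g x) atTop (𝓝 a)) : a = 0 := by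
  have h1 : IntegrableOn (fun x => g (x + 1)) (Ioi 0) := by
    refine (((measurePreserving_add_right volume (1 : ℝ)).integrableOn_comp_preimage
      (measurableEmbedding_addRight 1)).2 hg).mono_set fun x hx => ?_
    have : (0 : ℝ) < x := hx
    change 0 < x + 1
    linarith
  have h2 : IntegrableAtFilter (fun x => g (x + 1) - g x) atTop volume :=
    ⟨Ioi 0, Ioi_mem_atTop 0, h1.sub hg⟩
  refine h2.eq_zero_of_tendsto (fun s hs => ?_) h
  obtain ⟨b, hb⟩ := mem_atTop_sets.1 hs
  rw [← top_le_iff, ← Real.volume_Ici (a := b)]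
  exact measure_mono hb

/-- Green's identity with the decaying solution `ψ` of the homogeneous equation. -/
theorem green_identity {β z₀ : ℂ} (h1 : 0 < β.re) (h3 : 0 < (β ^ 3).re) {u u₁ u₂ f : ℝ → ℂ}
    (hu : IsPrimitive u u₁) (hu₁ : IsPrimitive u₁ u₂)
    (huL : MemLp u 2 (volume.restrict (Ioi (0 : ℝ))))
    (hfL : MemLp f 2 (volume.restrict (Ioi (0 : ℝ))))
    (hf : ∀ᵐ x ∂(volume.restrict (Ioi (0 : ℝ))),
      f x = -u₂ x + (β ^ 2) ^ 2 * (z₀ + β ^ 2 * x) * u x) :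
    ∫ x in Ioi (0 : ℝ), airyAi (z₀ + β ^ 2 * x) * f x =
      airyAi z₀ * u₁ 0 - β ^ 2 * deriv airyAi z₀ * u 0 := by
  set ψ : ℝ → ℂ := fun x => airyAi (z₀ + β ^ 2 * x) with hψ
  set ψ₁ : ℝ → ℂ := fun x => β ^ 2 * deriv airyAi (z₀ + β ^ 2 * x) with hψ₁
  have pψ : IsPrimitive ψ ψ₁ := isPrimitive_airyAi_line z₀ (β ^ 2)
  have pψ₁ := isPrimitive_deriv_airyAi_line z₀ (β ^ 2)
  have lψ := memLp_airyAi_line h1 h3 z₀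
  have lψ₁ := memLp_deriv_airyAi_line h1 h3 z₀
  have iψf : IntegrableOn (fun x => ψ x * f x) (Ioi 0) := lψ.integrable_mul hfL
  have iψu : IntegrableOn (fun x => ψ x * u x) (Ioi 0) := lψ.integrable_mul huL
  have iψ₁u : IntegrableOn (fun x => ψ₁ x * u x) (Ioi 0) := lψ₁.integrable_mul huL
  set V : ℝ → ℂ := fun x => ψ x * u₁ x - ψ₁ x * u x with hV
  have pV : IsPrimitive V fun x => -1 * (ψ x * f x) := by
    refine ((pψ.mul hu₁).sub (pψ₁.mul hu)).congr ?_
    filter_upwards [hf] with x hx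
    rw [hx]
    simp only [hψ, hψ₁]
    ring
  -- The Wronskian V has a limit because its derivative is integrable. That the limit is zero is not
  -- immediate, since nothing is known about u₁ at infinity.
  set Vinf := V 0 - ∫ x in Ioi (0 : ℝ), ψ x * f x with hVinf
  have hVlim : Tendsto V atTop (𝓝 Vinf) := by
    have h := (intervalIntegral_tendsto_integral_Ioi 0 iψf tendsto_id).const_sub (V 0)
    refine h.congr' ((eventually_ge_atTop 0).mono fun x hx => ?_)
    rw [(pV x hx).2, intervalIntegral.integral_const_mul]
    simp only [id]
    ring
  -- This primitive of V avoids u₁: it involves only ψu and the integral of ψ₁u, both controlled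
  -- because u lies in L₂.
  have pP : IsPrimitive (fun x => ψ x * u x - 2 * ∫ t in (0 : ℝ)..x, ψ₁ t * u t) V := by
    have hi : ∀ x : ℝ, 0 ≤ x → IntervalIntegrable (fun t => ψ₁ t * u t) volume 0 x := fun x hx =>
      (intervalIntegrable_iff_integrableOn_Ioc_of_le hx).2 (iψ₁u.mono_set Ioc_subset_Ioi_self)
    refine ((pψ.mul hu).sub ((isPrimitive_integral hi).const_mul 2)).congr
      (Eventually.of_forall fun x => ?_)
    simp only [hV]
    ring
  have hstep : Tendsto (fun x => ∫ t in x..(x + 1), V t) atTop (𝓝 Vinf) := by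
    rw [Metric.tendsto_atTop] at hVlim ⊢
    intro ε hε
    obtain ⟨N, hN⟩ := hVlim (ε / 2) (by positivity)
    refine ⟨max N 0, fun x hx => ?_⟩
    have hx0 : 0 ≤ x := (le_max_right _ _).trans hx
    have hi : IntervalIntegrable V volume x (x + 1) :=
      (pP x hx0).1.symm.trans (pP (x + 1) (by linarith)).1
    have e : (∫ t in x..(x + 1), V t) - Vinf = ∫ t in x..(x + 1), (V t - Vinf) := by
      rw [intervalIntegral.integral_sub hi intervalIntegrable_const]
      simp
    rw [dist_eq_norm, e]
    refine lt_of_le_of_lt (intervalIntegral.norm_integral_le_of_norm_le_const (C := ε / 2)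
      fun t ht => ?_) (by simpa using hε)
    rw [uIoc_of_le (by linarith)] at ht
    rw [← dist_eq_norm]
    exact (hN t (((le_max_left _ _).trans hx).trans ht.1.le)).le
  -- Unit increments of ψu tend to the limit of V, since the integral of ψ₁u converges; as ψu is
  -- integrable, that limit is zero.
  have hzero : Vinf = 0 := by
    refine eq_zero_of_tendsto_increment iψu ?_
    have hI := intervalIntegral_tendsto_integral_Ioi 0 iψ₁u tendsto_id
    have hI' := hI.comp (tendsto_atTop_add_const_right atTop (1 : ℝ) tendsto_id)
    have := hstep.add ((hI'.sub hI).const_mul 2)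
    rw [sub_self, mul_zero, add_zero] at this
    refine this.congr' ((eventually_ge_atTop 0).mono fun x hx => ?_)
    have e1 := (pP x hx).2
    have e2 := (pP (x + 1) (by linarith)).2
    have e3 := intervalIntegral.integral_add_adjacent_intervals (pP x hx).1
      ((pP x hx).1.symm.trans (pP (x + 1) (by linarith)).1)
    simp only [Function.comp_apply, id] at *
    linear_combination e1 - e2 + e3
  have : ∫ x in Ioi (0 : ℝ), ψ x * f x = V 0 := by
    rw [hVinf] at hzero
    linear_combination -hzero
  rw [this]
  simp [hV, hψ, hψ₁]

/-! ### Solutions of the eigenvalue equation -/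

/-- The decaying solution as an element of `L₂`. -/
def decaying {β : ℂ} (h1 : 0 < β.re) (h3 : 0 < (β ^ 3).re) (z₀ : ℂ) : L2HalfLine :=
  (memLp_airyAi_line h1 h3 z₀).toLp _

theorem memLp_Ioc_of_continuousOn {f : ℝ → ℂ} (hf : ContinuousOn f (Ici 0)) (b : ℝ) :
    MemLp f 2 (volume.restrict (Ioc 0 b)) := by
  obtain ⟨C, hC⟩ := isCompact_Icc.exists_bound_of_continuousOn (s := Icc 0 b)
    (hf.mono Icc_subset_Ici_self)
  refine MemLp.of_bound ((hf.mono fun x hx => le_of_lt hx.1).aestronglyMeasurable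
    measurableSet_Ioc) C ?_
  filter_upwards [ae_restrict_mem measurableSet_Ioc] with x hx
  exact hC x ⟨hx.1.le, hx.2⟩

theorem isW22Loc_of_isPrimitive {u u₁ u₂ : ℝ → ℂ} (h : IsPrimitive u u₁) (h₁ : IsPrimitive u₁ u₂)
    (h₂ : ∀ b : ℝ, MemLp u₂ 2 (volume.restrict (Ioc 0 b))) : IsW22Loc u u₁ u₂ :=
  ⟨h₂, fun x hx => (h x hx).2, fun x hx => (h₁ x hx).2⟩

theorem isW22Loc_airyAi_line (z₀ κ : ℂ) :
    IsW22Loc (fun x : ℝ => airyAi (z₀ + κ * x)) (fun x => κ * deriv airyAi (z₀ + κ * x))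
      fun x => κ ^ 2 * (z₀ + κ * x) * airyAi (z₀ + κ * x) := by
  refine isW22Loc_of_isPrimitive (isPrimitive_airyAi_line z₀ κ) (isPrimitive_deriv_airyAi_line z₀ κ)
    (memLp_Ioc_of_continuousOn (Continuous.continuousOn ?_))
  have := continuous_airyAi
  fun_prop

/-- Along z = z₀ + β²x the Airy equation has potential β⁴z = β⁶x + β⁴z₀, which identifies the
eigenvalue as -β⁴z₀. -/
theorem airyRel_decaying {β z₀ : ℂ} (h1 : 0 < β.re) (h3 : 0 < (β ^ 3).re) (hz : airyAi z₀ = 0) :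
    AiryRel (β ^ 6) (decaying h1 h3 z₀) ((-(β ^ 4 * z₀)) • decaying h1 h3 z₀) := by
  refine ⟨_, _, _, isW22Loc_airyAi_line z₀ (β ^ 2), by simpa using hz, MemLp.coeFn_toLp _, ?_⟩
  filter_upwards [Lp.coeFn_smul (-(β ^ 4 * z₀)) (decaying h1 h3 z₀),
    (memLp_airyAi_line h1 h3 z₀).coeFn_toLp] with x hx hx'
  rw [hx, Pi.smul_apply, smul_eq_mul, decaying, hx']
  ring

/-- Green's identity for the resolvent equation. -/
theorem AiryRel.green {β z₀ : ℂ} (h1 : 0 < β.re) (h3 : 0 < (β ^ 3).re) {y g : L2HalfLine}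
    (h : AiryRel (β ^ 6) y ((-(β ^ 4 * z₀)) • y + g)) :
    ∃ u u₁ u₂ : ℝ → ℂ, IsW22Loc u u₁ u₂ ∧ u 0 = 0 ∧ y =ᵐ[volume.restrict (Ioi 0)] u ∧
      (∀ᵐ x ∂(volume.restrict (Ioi (0 : ℝ))),
        g x = -u₂ x + (β ^ 2) ^ 2 * (z₀ + β ^ 2 * x) * u x) ∧
      ∫ x in Ioi (0 : ℝ), airyAi (z₀ + β ^ 2 * x) * g x = airyAi z₀ * u₁ 0 := by
  obtain ⟨u, u₁, u₂, hu, hu0, hy, hf⟩ := h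
  have hg : ∀ᵐ x ∂(volume.restrict (Ioi (0 : ℝ))),
      g x = -u₂ x + (β ^ 2) ^ 2 * (z₀ + β ^ 2 * x) * u x := by
    filter_upwards [hy, hf, Lp.coeFn_add ((-(β ^ 4 * z₀)) • y) g,
      Lp.coeFn_smul (-(β ^ 4 * z₀)) y] with x e1 e2 e3 e4
    rw [e3, Pi.add_apply, e4, Pi.smul_apply, smul_eq_mul, e1] at e2
    linear_combination e2
  refine ⟨u, u₁, u₂, hu, hu0, hy, hg, ?_⟩
  rw [green_identity h1 h3 hu.isPrimitive hu.isPrimitive_one ((memLp_congr_ae hy).1 (Lp.memLp y))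
    (Lp.memLp g) hg, hu0, mul_zero, sub_zero]

/-- Green's identity without right-hand side gives Ai(z₀)u'(0) = 0. Either the Cauchy data of u
vanish, or they are proportional to those of the decaying solution; no second solution at infinity
is needed. -/
theorem AiryRel.eigen {β z₀ : ℂ} (h1 : 0 < β.re) (h3 : 0 < (β ^ 3).re) {y : L2HalfLine}
    (h : AiryRel (β ^ 6) y ((-(β ^ 4 * z₀)) • y)) :
    (airyAi z₀ ≠ 0 → y = 0) ∧ (airyAi z₀ = 0 → ∃ a : ℂ, y = a • decaying h1 h3 z₀) := by
  rw [← add_zero ((-(β ^ 4 * z₀)) • y)] at h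
  obtain ⟨u, u₁, u₂, hu, hu0, hy, hg, hgreen⟩ := AiryRel.green h1 h3 h
  have hβ : β ≠ 0 := by rintro rfl; simp at h1
  have hz0 := Lp.coeFn_zero ℂ 2 (volume.restrict (Ioi (0 : ℝ)))
  have e0 : airyAi z₀ * u₁ 0 = 0 := by
    rw [← hgreen]
    refine integral_eq_zero_of_ae ?_
    filter_upwards [hz0] with x hx
    rw [hx]
    simp
  have pu₁ : IsPrimitive u₁ fun x => (β ^ 2) ^ 2 * (z₀ + β ^ 2 * x) * u x := by
    refine hu.isPrimitive_one.congr ?_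
    filter_upwards [hg, hz0] with x hx hx0
    rw [hx0, Pi.zero_apply] at hx
    linear_combination hx
  have hq : ContinuousOn (fun x : ℝ => (β ^ 2) ^ 2 * (z₀ + β ^ 2 * (x : ℂ))) (Ici 0) :=
    Continuous.continuousOn (by fun_prop)
  constructor
  · intro hne
    have hu1 : u₁ 0 = 0 := (mul_eq_zero.1 e0).resolve_left hne
    refine Lp.ext ?_
    filter_upwards [hy, hz0, ae_restrict_mem measurableSet_Ioi] with x hx hx0 hxp
    rw [hx, hx0, Pi.zero_apply]
    exact (IsPrimitive.eq_zero_of_second_order hq hu.isPrimitive pu₁ hu0 hu1 (le_of_lt hxp)).1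
  · intro hz
    have hd : β ^ 2 * deriv airyAi z₀ ≠ 0 :=
      mul_ne_zero (pow_ne_zero _ hβ) (deriv_airyAi_ne_zero hz)
    set a := u₁ 0 / (β ^ 2 * deriv airyAi z₀) with ha
    refine ⟨a, Lp.ext ?_⟩
    have pv := hu.isPrimitive.sub ((isPrimitive_airyAi_line z₀ (β ^ 2)).const_mul a)
    have pv₁ := (pu₁.sub ((isPrimitive_deriv_airyAi_line z₀ (β ^ 2)).const_mul a)).congr
      (g := fun x => (β ^ 2) ^ 2 * (z₀ + β ^ 2 * x) * (u x - a * airyAi (z₀ + β ^ 2 * x)))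
      (Eventually.of_forall fun x => by ring)
    filter_upwards [hy, Lp.coeFn_smul a (decaying h1 h3 z₀),
      (memLp_airyAi_line h1 h3 z₀).coeFn_toLp, ae_restrict_mem measurableSet_Ioi] with x e1 e2 e3 hxp
    rw [e1, e2, Pi.smul_apply, smul_eq_mul, decaying, e3]
    refine sub_eq_zero.1 (IsPrimitive.eq_zero_of_second_order hq pv pv₁ ?_ ?_ (le_of_lt hxp)).1
    · simp [hu0, hz]
    · simp only [Complex.ofReal_zero, mul_zero, add_zero]
      rw [ha, div_mul_cancel₀ _ hd, sub_self]

theorem decaying_ne_zero {β z₀ : ℂ} (h1 : 0 < β.re) (h3 : 0 < (β ^ 3).re) :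
    decaying h1 h3 z₀ ≠ 0 := fun h => by
  have hβ : β ≠ 0 := by rintro rfl; simp at h1
  have hz : ∀ x : ℝ, 0 ≤ x → airyAi (z₀ + β ^ 2 * x) = 0 := by
    refine zero_of_ae_zero (fun b _ => Continuous.continuousOn
      (by have := continuous_airyAi; fun_prop)) ?_
    filter_upwards [(memLp_airyAi_line h1 h3 z₀).coeFn_toLp,
      Lp.coeFn_zero ℂ 2 (volume.restrict (Ioi (0 : ℝ)))] with x e1 e2
    have e : decaying h1 h3 z₀ x = airyAi (z₀ + β ^ 2 * x) := e1
    rw [← e, h, e2, Pi.zero_apply]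
  have hd := hasDerivAt_airyAi_line z₀ (β ^ 2) 1
  have := hd.unique ((hasDerivAt_const (1 : ℝ) (0 : ℂ)).congr_of_eventuallyEq (by
    filter_upwards [Ioi_mem_nhds (one_pos : (0 : ℝ) < 1)] with y hy
    exact hz y (le_of_lt hy)))
  exact mul_ne_zero (pow_ne_zero 2 hβ) (deriv_airyAi_ne_zero (hz 1 zero_le_one)) this

/-! ### The square integral of the eigenfunction and associated vectors -/

theorem tendsto_zero_of_exp_decay {f : ℝ → ℂ} {C m : ℝ} (hm : 0 < m)
    (h : ∀ x : ℝ, 0 ≤ x → ‖f x‖ ≤ C * ((1 + x) * Real.exp (-m * x))) : Tendsto f atTop (𝓝 0) := by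
  have t1 : Tendsto (fun x : ℝ => m * x) atTop atTop := tendsto_id.const_mul_atTop hm
  have t2 := (Real.tendsto_pow_mul_exp_neg_atTop_nhds_zero 1).comp t1
  have t3 := (Real.tendsto_pow_mul_exp_neg_atTop_nhds_zero 0).comp t1
  have t4 := (t3.add (t2.const_mul m⁻¹)).const_mul C
  rw [mul_zero, add_zero, mul_zero] at t4
  refine squeeze_zero_norm' ((eventually_ge_atTop 0).mono fun x hx => (h x hx).trans_eq ?_) t4
  simp only [Function.comp_apply]
  rw [neg_mul]
  field_simp

theorem tendsto_primitive_airyAi_sq {β : ℂ} (h1 : 0 < β.re) (h3 : 0 < (β ^ 3).re) (z₀ : ℂ) :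
    Tendsto (fun x : ℝ => (z₀ + β ^ 2 * x) * airyAi (z₀ + β ^ 2 * x) ^ 2 -
      deriv airyAi (z₀ + β ^ 2 * x) ^ 2) atTop (𝓝 0) := by
  obtain ⟨C, m, hC, hm, hb⟩ := airyAi_decay_line h1 h3 z₀
  refine tendsto_zero_of_exp_decay (C := (‖z₀‖ + ‖β ^ 2‖ + 1) * C ^ 2) hm fun x hx => ?_
  obtain ⟨b0, b1⟩ := hb x hx
  have e0 := Real.exp_pos (-m * x)
  have e1 : Real.exp (-m * x) ≤ 1 := Real.exp_le_one_iff.2 (by nlinarith)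
  have e2 : (C * Real.exp (-m * x)) ^ 2 ≤ C ^ 2 * Real.exp (-m * x) := by
    rw [mul_pow, sq (Real.exp _)]
    exact mul_le_mul_of_nonneg_left (mul_le_of_le_one_left e0.le e1) (by positivity)
  have c0 := (pow_le_pow_left₀ (norm_nonneg _) b0 2).trans e2
  have c1 := (pow_le_pow_left₀ (norm_nonneg _) b1 2).trans e2
  have hn : ‖z₀ + β ^ 2 * x‖ ≤ ‖z₀‖ + ‖β ^ 2‖ * x := by
    refine (norm_add_le _ _).trans ?_
    rw [norm_mul, Complex.norm_real, Real.norm_of_nonneg hx]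
  refine (norm_sub_le _ _).trans ?_
  rw [norm_mul, norm_pow (airyAi _), norm_pow (deriv airyAi _)]
  refine (add_le_add (mul_le_mul hn c0 (by positivity) (by positivity)) c1).trans ?_
  have : 0 ≤ C ^ 2 * Real.exp (-m * x) := by positivity
  have h4 : ‖z₀‖ + ‖β ^ 2‖ * x + 1 ≤ (‖z₀‖ + ‖β ^ 2‖ + 1) * (1 + x) := by
    nlinarith [norm_nonneg z₀, norm_nonneg (β ^ 2), mul_nonneg (norm_nonneg z₀) hx]
  nlinarith [mul_le_mul_of_nonneg_right h4 this]

/-- The function z·Ai² - Ai'² is a primitive of Ai². The integral is taken without conjugation, so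
it is not positive for free; its explicit value shows that it is nonzero. -/
theorem integral_decaying_sq {β z₀ : ℂ} (h1 : 0 < β.re) (h3 : 0 < (β ^ 3).re)
    (hz : airyAi z₀ = 0) :
    ∫ x in Ioi (0 : ℝ), airyAi (z₀ + β ^ 2 * x) * airyAi (z₀ + β ^ 2 * x) =
      deriv airyAi z₀ ^ 2 / β ^ 2 := by
  have hβ : β ≠ 0 := by rintro rfl; simp at h1
  have hd : ∀ x : ℝ, HasDerivAt (fun x : ℝ => ((z₀ + β ^ 2 * x) * airyAi (z₀ + β ^ 2 * x) ^ 2 -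
      deriv airyAi (z₀ + β ^ 2 * x) ^ 2) / β ^ 2)
      (airyAi (z₀ + β ^ 2 * x) * airyAi (z₀ + β ^ 2 * x)) x := fun x => by
    have hl : HasDerivAt (fun x : ℝ => z₀ + β ^ 2 * (x : ℂ)) (β ^ 2) x := by
      simpa using ((hasDerivAt_id x).ofReal_comp.const_mul (β ^ 2)).const_add z₀
    have hA := hasDerivAt_airyAi_line z₀ (β ^ 2) x
    have hB := (hasDerivAt_deriv_airyAi (z₀ + β ^ 2 * x)).comp x hl
    refine (((hl.mul (hA.pow 2)).sub (hB.pow 2)).div_const (β ^ 2)).congr_deriv ?_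
    simp only [Function.comp_apply, Pi.pow_apply]
    field_simp
    push_cast
    ring
  have hlim := (tendsto_primitive_airyAi_sq h1 h3 z₀).div_const (β ^ 2)
  rw [zero_div] at hlim
  rw [integral_Ioi_of_hasDerivAt_of_tendsto' (fun x _ => hd x)
    ((memLp_airyAi_line h1 h3 z₀).integrable_mul (memLp_airyAi_line h1 h3 z₀)) hlim]
  simp only [Complex.ofReal_zero, mul_zero, add_zero, hz]
  ring

/-- There are no associated vectors. -/
theorem AiryRel.no_associated {β z₀ a : ℂ} (h1 : 0 < β.re) (h3 : 0 < (β ^ 3).re)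
    (hz : airyAi z₀ = 0) {y : L2HalfLine}
    (h : AiryRel (β ^ 6) y ((-(β ^ 4 * z₀)) • y + a • decaying h1 h3 z₀)) : a = 0 := by
  have hβ : β ≠ 0 := by rintro rfl; simp at h1
  obtain ⟨u, u₁, u₂, -, -, -, -, hgreen⟩ := AiryRel.green h1 h3 h
  have e : ∫ x in Ioi (0 : ℝ), airyAi (z₀ + β ^ 2 * x) * (a • decaying h1 h3 z₀ : L2HalfLine) x =
      a * (deriv airyAi z₀ ^ 2 / β ^ 2) := by
    rw [← integral_decaying_sq h1 h3 hz, ← integral_const_mul]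
    refine integral_congr_ae ?_
    filter_upwards [Lp.coeFn_smul a (decaying h1 h3 z₀),
      (memLp_airyAi_line h1 h3 z₀).coeFn_toLp] with x e1 e2
    rw [e1, Pi.smul_apply, smul_eq_mul, decaying, e2]
    ring
  rw [e, hz, zero_mul] at hgreen
  refine (mul_eq_zero.1 hgreen).resolve_right (div_ne_zero ?_ (pow_ne_zero _ hβ))
  exact pow_ne_zero _ (deriv_airyAi_ne_zero hz)

/-! ### Estimates for the Green kernel -/

theorem integral_exp_neg_mul_abs_sub {a : ℝ} (ha : 0 < a) (x : ℝ) :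
    ∫ t : ℝ, Real.exp (-(a * |t - x|)) = 2 / a := by
  rw [integral_sub_right_eq_self (fun t : ℝ => Real.exp (-(a * |t|))) x,
    integral_comp_abs (f := fun t => Real.exp (-(a * t)))]
  have := integral_exp_mul_Ioi (neg_lt_zero.2 ha) 0
  simp only [neg_mul] at this
  rw [this]
  simp
  ring

theorem integrable_exp_neg_mul_abs_sub {a : ℝ} (ha : 0 < a) (x : ℝ) :
    Integrable fun t : ℝ => Real.exp (-(a * |t - x|)) := by
  -- A nonintegrable function would have integral 0, but the value 2/a is already known.
  by_contra h
  have := integral_exp_neg_mul_abs_sub ha x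
  rw [integral_undef h] at this
  exact (by positivity : 2 / a ≠ 0) this.symm

/-- The variation of `x ^ (3 / 2)`. -/
theorem le_sub_mul_sqrt {s t x : ℝ} (hs : 0 ≤ s) (hst : s ≤ t) (hx : x ≤ t) :
    √(1 + x) * (t - s) / 2 - 1 ≤ t * √t - s * √s := by
  have h1 : √t * (t - s) ≤ t * √t - s * √s := by
    nlinarith [Real.sqrt_le_sqrt hst, mul_le_mul_of_nonneg_left (Real.sqrt_le_sqrt hst) hs]
  refine le_trans ?_ h1
  rcases le_or_gt (1 / 3) t with h | h
  · have : √(1 + x) ≤ 2 * √t := by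
      refine Real.sqrt_le_iff.2 ⟨by positivity, ?_⟩
      rw [mul_pow, Real.sq_sqrt (by linarith)]
      linarith
    nlinarith
  · have h2 : √(1 + x) ≤ 2 := Real.sqrt_le_iff.2 ⟨by norm_num, by linarith⟩
    have h3 : 0 ≤ √t * (t - s) := mul_nonneg (Real.sqrt_nonneg _) (by linarith)
    nlinarith [Real.sqrt_nonneg (1 + x)]

theorem sqrt_one_add_le {x t : ℝ} (ht : 0 ≤ t) :
    √(1 + x) ≤ √(1 + t) * (1 + |t - x|) := by
  have h : 0 ≤ |t - x| := abs_nonneg _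
  refine Real.sqrt_le_iff.2 ⟨by positivity, ?_⟩
  rw [mul_pow, Real.sq_sqrt (by linarith)]
  have h2 : x ≤ t + |t - x| := by
    have := neg_abs_le (t - x)
    linarith
  nlinarith [mul_nonneg ht h, mul_nonneg ht (mul_nonneg h h)]

/-- Exponential concentration of the Green kernel near the diagonal. -/
theorem kernel_weight_le {ν : ℝ} (hν : 0 < ν) {x t d : ℝ} (hx : 0 ≤ x) (ht : 0 ≤ t)
    (hd : √(1 + x) * |t - x| / 2 - 1 ≤ d) :
    Real.exp (-(2 * ν * d)) / (√(1 + x) * √(1 + t)) ≤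
      (1 + 2 / ν) * Real.exp (2 * ν) / (1 + x) * Real.exp (-(ν / 2 * √(1 + x) * |t - x|)) := by
  have hr : 1 ≤ √(1 + x) := Real.one_le_sqrt.2 (by linarith)
  have hrr : √(1 + x) * √(1 + x) = 1 + x := Real.mul_self_sqrt (by linarith)
  have hq : 0 < √(1 + t) := Real.sqrt_pos.2 (by linarith)
  set r := √(1 + x)
  set τ := |t - x| with hτ
  have hτ0 : 0 ≤ τ := abs_nonneg _
  have h1 : 1 + τ ≤ (1 + 2 / ν) * Real.exp (ν / 2 * r * τ) := by
    have e1 : 1 + ν / 2 * τ ≤ Real.exp (ν / 2 * r * τ) := by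
      have := Real.add_one_le_exp (ν / 2 * r * τ)
      nlinarith [mul_nonneg (mul_nonneg hν.le hτ0) (sub_nonneg.2 hr)]
    have e2 : (1 + 2 / ν) * (1 + ν / 2 * τ) = 1 + τ + 2 / ν + ν / 2 * τ := by
      field_simp
      ring
    have : 0 ≤ 2 / ν + ν / 2 * τ := by positivity
    nlinarith [mul_le_mul_of_nonneg_left e1 (by positivity : 0 ≤ 1 + 2 / ν)]
  -- The decay is split into two equal factors: one pays for replacing √(1 + t) by √(1 + x), the
  -- other survives.
  have h2 : Real.exp (-(2 * ν * d)) ≤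
      Real.exp (2 * ν) * (Real.exp (-(ν / 2 * r * τ)) * Real.exp (-(ν / 2 * r * τ))) := by
    rw [← Real.exp_add, ← Real.exp_add]
    refine Real.exp_le_exp.2 ?_
    nlinarith [mul_le_mul_of_nonneg_left hd hν.le]
  have h3 : Real.exp (ν / 2 * r * τ) * Real.exp (-(ν / 2 * r * τ)) = 1 := by
    rw [← Real.exp_add, add_neg_cancel, Real.exp_zero]
  have h4 : r ≤ √(1 + t) * ((1 + 2 / ν) * Real.exp (ν / 2 * r * τ)) :=
    (sqrt_one_add_le ht).trans (mul_le_mul_of_nonneg_left h1 hq.le)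
  set E := Real.exp (ν / 2 * r * τ)
  set F := Real.exp (-(ν / 2 * r * τ)) with hF
  have hF0 : 0 < F := Real.exp_pos _
  have hr0 : 0 < r := by linarith
  rw [← hrr, div_mul_eq_mul_div, div_le_div_iff₀ (by positivity) (by positivity)]
  have h5 : r * F ≤ √(1 + t) * (1 + 2 / ν) := by
    calc r * F ≤ √(1 + t) * ((1 + 2 / ν) * E) * F := mul_le_mul_of_nonneg_right h4 hF0.le
      _ = √(1 + t) * (1 + 2 / ν) * (E * F) := by ring
      _ = _ := by rw [h3, mul_one]
  calc _ ≤ Real.exp (2 * ν) * (F * F) * (r * r) := mul_le_mul_of_nonneg_right h2 (by positivity)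
    _ = Real.exp (2 * ν) * F * r * (r * F) := by ring
    _ ≤ Real.exp (2 * ν) * F * r * (√(1 + t) * (1 + 2 / ν)) :=
        mul_le_mul_of_nonneg_left h5 (by positivity)
    _ = _ := by ring

/-- The Green kernel built from two solutions. -/
def greenKernel (ψ χ : ℝ → ℂ) (x t : ℝ) : ℂ := if t ≤ x then ψ x * χ t else χ x * ψ t

/-- Decay of ψ at the larger argument beats growth of χ at the smaller one by exp(-2ν(y^{3/2} -
s^{3/2})), and the difference of 3/2 powers is at least of order √(1 + x)·|t - x|, up to a constant.
-/
theorem norm_greenKernel_sq_le {ψ χ : ℝ → ℂ} {A B ν : ℝ} (hν : 0 < ν) (hA : 0 ≤ A) (hB : 0 ≤ B)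
    (hψ : ∀ x : ℝ, 0 ≤ x → ‖ψ x‖ ^ 2 * √(1 + x) ≤ A * Real.exp (-(2 * ν * (x * √x))))
    (hχ : ∀ x : ℝ, 0 ≤ x → ‖χ x‖ ^ 2 * √(1 + x) ≤ B * Real.exp (2 * ν * (x * √x)))
    {x t : ℝ} (hx : 0 ≤ x) (ht : 0 ≤ t) :
    ‖greenKernel ψ χ x t‖ ^ 2 ≤ A * B * ((1 + 2 / ν) * Real.exp (2 * ν)) / (1 + x) *
      Real.exp (-(ν / 2 * √(1 + x) * |t - x|)) := by
  have hq : ∀ y : ℝ, 0 ≤ y → 0 < √(1 + y) := fun y hy => Real.sqrt_pos.2 (by linarith)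
  have key : ∀ s y : ℝ, 0 ≤ s → 0 ≤ y → ‖ψ y * χ s‖ ^ 2 ≤
      A * B * (Real.exp (-(2 * ν * (y * √y - s * √s))) / (√(1 + y) * √(1 + s))) := by
    intro s y hs hy
    have := mul_le_mul (hψ y hy) (hχ s hs) (by positivity) (by positivity)
    rw [← mul_div_assoc, le_div_iff₀ (mul_pos (hq y hy) (hq s hs)), norm_mul, mul_pow]
    refine le_of_eq_of_le (by ring) (this.trans_eq ?_)
    rw [mul_mul_mul_comm, ← Real.exp_add]
    congr 2
    ring
  have fin : ∀ d, √(1 + x) * |t - x| / 2 - 1 ≤ d →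
      A * B * (Real.exp (-(2 * ν * d)) / (√(1 + x) * √(1 + t))) ≤
      A * B * ((1 + 2 / ν) * Real.exp (2 * ν)) / (1 + x) *
      Real.exp (-(ν / 2 * √(1 + x) * |t - x|)) := fun d hd =>
    (mul_le_mul_of_nonneg_left (kernel_weight_le hν hx ht hd) (mul_nonneg hA hB)).trans_eq (by ring)
  unfold greenKernel
  split_ifs with h
  · refine (key t x ht hx).trans (fin _ ?_)
    rw [abs_sub_comm, abs_of_nonneg (sub_nonneg.2 h)]
    exact le_sub_mul_sqrt ht h le_rfl
  · rw [mul_comm (χ x)]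
    refine (key x t hx ht).trans ?_
    rw [mul_comm (√(1 + t))]
    refine fin _ ?_
    rw [abs_of_nonneg (by linarith)]
    exact le_sub_mul_sqrt hx (by linarith) (by linarith)

/-- Decay of `Ai` along a ray, up to the beginning of the ray. -/
theorem norm_airyAi_ray_sq_le {δ : ℂ} (hδ : 0 < δ.re) : ∃ C : ℝ, 0 ≤ C ∧ ∀ x : ℝ, 0 ≤ x →
    ‖airyAi (0 + δ ^ 2 * x)‖ ^ 2 * √(1 + x) ≤
      C * Real.exp (-(2 * (2 / 3 * (δ ^ 3).re) * (x * √x))) := by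
  obtain ⟨C, hC, h⟩ := norm_airyAi_sq_le
  have hc : Continuous fun x : ℝ => ‖airyAi (0 + δ ^ 2 * x)‖ ^ 2 * √(1 + x) *
      Real.exp (2 * (2 / 3 * (δ ^ 3).re) * (x * √x)) := by
    have := continuous_airyAi
    fun_prop
  obtain ⟨M, hM⟩ := isCompact_Icc.exists_bound_of_continuousOn (s := Icc (0 : ℝ) 1) hc.continuousOn
  -- Compactness handles [0, 1], where the saddle bound degenerates; beyond 1 the bound is used at w
  -- = √x·δ. The sign of Re δ³ is free, so growing solutions are covered too.
  refine ⟨max M (C ^ 2 * √2 / δ.re), le_max_of_le_right (by positivity), fun x hx => ?_⟩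
  rw [Real.exp_neg, ← div_eq_mul_inv, le_div_iff₀ (Real.exp_pos _)]
  rcases le_or_gt x 1 with hx1 | hx1
  · exact ((le_abs_self _).trans (hM x ⟨hx, hx1⟩)).trans (le_max_left _ _)
  · refine le_trans ?_ (le_max_right _ _)
    have hs : 0 < √x := Real.sqrt_pos.2 (by linarith)
    have hss : √x * √x = x := Real.mul_self_sqrt hx
    have hre : ((√x : ℂ) * δ).re = √x * δ.re := by simp
    have h2 := h (√x * δ) (by rw [hre]; positivity)
    have e2 : ((√x : ℂ) * δ) ^ 2 = 0 + δ ^ 2 * x := by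
      rw [mul_pow, sq (√x : ℂ), ← Complex.ofReal_mul, hss]
      ring
    have e3 : (((√x : ℂ) * δ) ^ 3).re = x * √x * (δ ^ 3).re := by
      have : ((√x : ℂ) * δ) ^ 3 = ((x * √x : ℝ) : ℂ) * δ ^ 3 := by
        rw [mul_pow, pow_succ (√x : ℂ), sq (√x : ℂ), ← Complex.ofReal_mul, hss,
          ← Complex.ofReal_mul]
      rw [this, Complex.re_ofReal_mul]
    rw [e2, e3, hre] at h2
    have h4 := pow_le_pow_left₀ (norm_nonneg _) h2 2
    rw [div_pow, Real.sq_sqrt (by positivity), mul_pow, ← Real.exp_nat_mul] at h4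
    have h5 : √(1 + x) ≤ √2 * √x := by
      rw [← Real.sqrt_mul (by norm_num)]
      exact Real.sqrt_le_sqrt (by linarith)
    have h6 : Real.exp (((2 : ℕ) : ℝ) * -(2 / 3 * (x * √x * (δ ^ 3).re))) *
        Real.exp (2 * (2 / 3 * (δ ^ 3).re) * (x * √x)) = 1 := by
      rw [← Real.exp_add, Real.exp_eq_one_iff]
      push_cast
      ring
    set E := Real.exp (2 * (2 / 3 * (δ ^ 3).re) * (x * √x))
    have hE : 0 < E := Real.exp_pos _
    calc _ ≤ C ^ 2 * Real.exp (((2 : ℕ) : ℝ) * -(2 / 3 * (x * √x * (δ ^ 3).re))) / (√x * δ.re) *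
          (√2 * √x) * E := by
          refine mul_le_mul_of_nonneg_right (mul_le_mul h4 h5 (Real.sqrt_nonneg _) ?_) hE.le
          positivity
      _ = C ^ 2 * √2 / δ.re *
          (Real.exp (((2 : ℕ) : ℝ) * -(2 / 3 * (x * √x * (δ ^ 3).re))) * E) := by
          field_simp
      _ = _ := by rw [h6, mul_one]

/-! ### The inverse of the operator -/

theorem memLp_greenKernel {ψ χ : ℝ → ℂ} {C a x : ℝ} (ha : 0 < a) (cψ : Continuous ψ)
    (cχ : Continuous χ)
    (h : ∀ t : ℝ, 0 ≤ t → ‖greenKernel ψ χ x t‖ ^ 2 ≤ C * Real.exp (-(a * |t - x|))) :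
    MemLp (greenKernel ψ χ x) 2 (volume.restrict (Ioi (0 : ℝ))) ∧
      ∫ t in Ioi (0 : ℝ), ‖greenKernel ψ χ x t‖ ^ 2 ≤ C * (2 / a) := by
  have hC : 0 ≤ C := by
    have := (sq_nonneg _).trans (h 0 le_rfl)
    exact nonneg_of_mul_nonneg_left this (Real.exp_pos _)
  have hm : AEStronglyMeasurable (greenKernel ψ χ x) (volume.restrict (Ioi (0 : ℝ))) :=
    (Measurable.ite measurableSet_Iic (cχ.measurable.const_mul _)
      (cψ.measurable.const_mul _)).aestronglyMeasurable
  have hg := (integrable_exp_neg_mul_abs_sub ha x).const_mul C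
  have hb : ∀ᵐ t ∂(volume.restrict (Ioi (0 : ℝ))),
      ‖greenKernel ψ χ x t‖ ^ 2 ≤ C * Real.exp (-(a * |t - x|)) := by
    filter_upwards [ae_restrict_mem measurableSet_Ioi] with t ht
    exact h t (le_of_lt ht)
  have hi : Integrable (fun t => ‖greenKernel ψ χ x t‖ ^ 2) (volume.restrict (Ioi (0 : ℝ))) := by
    refine hg.integrableOn.mono' (hm.norm.pow 2) ?_
    filter_upwards [hb] with t ht
    rwa [Real.norm_of_nonneg (sq_nonneg _)]
  refine ⟨(memLp_two_iff_integrable_sq_norm hm).2 hi, ?_⟩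
  refine (integral_mono_ae hi hg.integrableOn hb).trans ?_
  refine (setIntegral_le_integral hg (Eventually.of_forall fun t => by positivity)).trans_eq ?_
  rw [integral_const_mul, integral_exp_neg_mul_abs_sub ha]

theorem integral_greenKernel_mul {ψ χ f : ℝ → ℂ} {x : ℝ} (hx : 0 ≤ x)
    (hχf : IntegrableOn (fun t => χ t * f t) (Ioc 0 x))
    (hψf : IntegrableOn (fun t => ψ t * f t) (Ioi 0)) :
    ∫ t in Ioi (0 : ℝ), greenKernel ψ χ x t * f t =
      ψ x * (∫ t in (0 : ℝ)..x, χ t * f t) +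
        χ x * ((∫ t in Ioi (0 : ℝ), ψ t * f t) - ∫ t in (0 : ℝ)..x, ψ t * f t) := by
  have hψx := hψf.mono_set (Ioi_subset_Ioi hx)
  have e1 : EqOn (fun t => greenKernel ψ χ x t * f t) (fun t => ψ x * (χ t * f t)) (Ioc 0 x) :=
    fun t ht => by simp [greenKernel, ht.2, mul_assoc]
  have e2 : EqOn (fun t => greenKernel ψ χ x t * f t) (fun t => χ x * (ψ t * f t)) (Ioi x) :=
    fun t ht => by simp [greenKernel, not_le.2 (mem_Ioi.1 ht), mul_assoc]
  rw [← Ioc_union_Ioi_eq_Ioi hx, setIntegral_union (Ioc_disjoint_Ioi le_rfl) measurableSet_Ioi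
    (IntegrableOn.congr_fun (hχf.const_mul _) e1.symm measurableSet_Ioc)
    (IntegrableOn.congr_fun (hψx.const_mul _) e2.symm measurableSet_Ioi),
    setIntegral_congr_fun measurableSet_Ioc e1, setIntegral_congr_fun measurableSet_Ioi e2,
    integral_const_mul, integral_const_mul, setIntegral_union (Ioc_disjoint_Ioi le_rfl)
    measurableSet_Ioi (hψf.mono_set Ioc_subset_Ioi_self) hψx,
    intervalIntegral.integral_of_le hx, intervalIntegral.integral_of_le hx]
  ring

/-- Variation of constants. -/
theorem isW22Loc_variation_of_constants {ψ ψ₁ χ χ₁ f : ℝ → ℂ} {c W M : ℂ} (hW : W ≠ 0)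
    (pψ : IsPrimitive ψ ψ₁) (pψ₁ : IsPrimitive ψ₁ fun x => c * x * ψ x)
    (pχ : IsPrimitive χ χ₁) (pχ₁ : IsPrimitive χ₁ fun x => c * x * χ x)
    (hwr : ∀ x : ℝ, 0 ≤ x → ψ x * χ₁ x - ψ₁ x * χ x = W)
    (hf : MemLp f 2 (volume.restrict (Ioi (0 : ℝ)))) {u : ℝ → ℂ}
    (hu : u = fun x => W⁻¹ * (ψ x * (∫ t in (0 : ℝ)..x, χ t * f t) +
        χ x * (M - ∫ t in (0 : ℝ)..x, ψ t * f t))) :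
    ∃ u₁, IsW22Loc u u₁ fun x => c * x * u x - f x := by
  have hint : ∀ g : ℝ → ℂ, ContinuousOn g (Ici 0) → ∀ x : ℝ, 0 ≤ x →
      IntervalIntegrable (fun t => g t * f t) volume 0 x := fun g hg x hx =>
    (intervalIntegrable_iff_integrableOn_Ioc_of_le hx).2
      ((memLp_Ioc_of_continuousOn hg x).integrable_mul
        (hf.mono_measure (Measure.restrict_mono Ioc_subset_Ioi_self le_rfl)))
  have pP := isPrimitive_integral (hint χ pχ.continuousOn)
  have pQ := (isPrimitive_const M).sub (isPrimitive_integral (hint ψ pψ.continuousOn))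
  have pu : IsPrimitive u fun x => W⁻¹ * (ψ₁ x * (∫ t in (0 : ℝ)..x, χ t * f t) +
        χ₁ x * (M - ∫ t in (0 : ℝ)..x, ψ t * f t)) := by
    rw [hu]
    refine (((pψ.mul pP).add (pχ.mul pQ)).const_mul W⁻¹).congr (Eventually.of_forall fun x => ?_)
    ring
  refine ⟨_, isW22Loc_of_isPrimitive pu ?_ fun b => ?_⟩
  · refine (((pψ₁.mul pP).add (pχ₁.mul pQ)).const_mul W⁻¹).congr ?_
    filter_upwards [ae_restrict_mem measurableSet_Ioi] with x hx
    rw [hu]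
    have h1 : W⁻¹ * (ψ x * χ₁ x - ψ₁ x * χ x) = 1 := by
      rw [hwr x (le_of_lt hx), inv_mul_cancel₀ hW]
    linear_combination -f x * h1
  · refine (memLp_Ioc_of_continuousOn (f := fun x => c * x * u x) ?_ b).sub
      (hf.mono_measure (Measure.restrict_mono Ioc_subset_Ioi_self le_rfl))
    exact ContinuousOn.mul (by fun_prop) pu.continuousOn

/-- The integral operator with the Green kernel is compact and inverts the differential operator. -/
theorem exists_compact_inverse {ψ ψ₁ χ χ₁ : ℝ → ℂ} {c W : ℂ} {A B ν : ℝ} (hW : W ≠ 0)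
    (cψ : Continuous ψ) (cχ : Continuous χ)
    (pψ : IsPrimitive ψ ψ₁) (pψ₁ : IsPrimitive ψ₁ fun x => c * x * ψ x)
    (pχ : IsPrimitive χ χ₁) (pχ₁ : IsPrimitive χ₁ fun x => c * x * χ x)
    (hwr : ∀ x : ℝ, 0 ≤ x → ψ x * χ₁ x - ψ₁ x * χ x = W) (hχ0 : χ 0 = 0)
    (lψ : MemLp ψ 2 (volume.restrict (Ioi (0 : ℝ))))
    (hν : 0 < ν) (hA : 0 ≤ A) (hB : 0 ≤ B)
    (hψ : ∀ x : ℝ, 0 ≤ x → ‖ψ x‖ ^ 2 * √(1 + x) ≤ A * Real.exp (-(2 * ν * (x * √x))))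
    (hχ : ∀ x : ℝ, 0 ≤ x → ‖χ x‖ ^ 2 * √(1 + x) ≤ B * Real.exp (2 * ν * (x * √x))) :
    ∃ R : L2HalfLine →L[ℂ] L2HalfLine, IsCompactOperator R ∧ ∀ f, AiryRel c (R f) f := by
  set D := A * B * ((1 + 2 / ν) * Real.exp (2 * ν)) with hD
  have hD0 : 0 ≤ D := by positivity
  have hk : ∀ x : ℝ, 0 ≤ x → MemLp (greenKernel ψ χ x) 2 (volume.restrict (Ioi (0 : ℝ))) ∧
      ∫ t in Ioi (0 : ℝ), ‖greenKernel ψ χ x t‖ ^ 2 ≤ D / (1 + x) * (2 / (ν / 2 * √(1 + x))) :=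
    fun x hx => memLp_greenKernel (mul_pos (by positivity) (Real.sqrt_pos.2 (by linarith))) cψ cχ
      fun t ht => norm_greenKernel_sq_le hν hA hB hψ hχ hx ht
  have hks : ∀ x : ℝ, 0 ≤ x → MemLp (fun t => starRingEnd ℂ (greenKernel ψ χ x t)) 2
      (volume.restrict (Ioi (0 : ℝ))) := fun x hx => (hk x hx).1.star
  have hint : ∀ f : L2HalfLine, ∀ g : ℝ → ℂ, ContinuousOn g (Ici 0) → ∀ x : ℝ,
      IntegrableOn (fun t => g t * f t) (Ioc 0 x) := fun f g hg x =>
      ((memLp_Ioc_of_continuousOn hg x).integrable_mul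
        ((Lp.memLp f).mono_measure (Measure.restrict_mono Ioc_subset_Ioi_self le_rfl)))
  -- The kernel is conjugated because the inner product is conjugate linear in its first argument.
  set k : ℝ → L2HalfLine := fun x => if hx : 0 ≤ x then (hks x hx).toLp _ else 0 with hkdef
  have hkx : ∀ x (hx : 0 ≤ x), k x = (hks x hx).toLp _ := fun x hx => by simp only [hkdef, dif_pos hx]
  -- One factor 1/(1 + x) comes from the kernel bound and a further 1/√(1 + x) from its width; the
  -- resulting exponent 3/2 is what makes the operator Hilbert-Schmidt.
  have hkn : ∀ x : ℝ, 0 ≤ x → ‖k x‖ ^ 2 ≤ 4 * D / ν * (x + 1) ^ (-(3 / 2) : ℝ) := fun x hx => by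
    rw [hkx x hx, norm_toLp_sq]
    simp only [RCLike.norm_conj]
    refine (hk x hx).2.trans_eq ?_
    have hx1 : 0 < x + 1 := by linarith
    rw [Real.rpow_neg hx1.le, show (3 / 2 : ℝ) = 1 + 1 / 2 by norm_num, Real.rpow_add hx1,
      Real.rpow_one, ← Real.sqrt_eq_rpow, add_comm 1 x]
    field_simp
    norm_num
  set l : ℝ → L2HalfLine →ₗ[ℂ] ℂ := fun x => W⁻¹ • (innerₛₗ ℂ (k x)) with hl
  set U : L2HalfLine → ℝ → ℂ := fun f x => W⁻¹ * (ψ x * (∫ t in (0 : ℝ)..x, χ t * f t) +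
        χ x * ((∫ t in Ioi (0 : ℝ), ψ t * f t) - ∫ t in (0 : ℝ)..x, ψ t * f t)) with hU
  have hlU : ∀ f, ∀ x : ℝ, 0 ≤ x → l x f = U f x := fun f x hx => by
    have e : inner ℂ (k x) f = ∫ t in Ioi (0 : ℝ), greenKernel ψ χ x t * f t := by
      rw [L2.inner_def, hkx x hx]
      refine integral_congr_ae ?_
      filter_upwards [(hks x hx).coeFn_toLp] with t ht
      rw [ht, RCLike.inner_apply, RingHomCompTriple.comp_apply, RingHom.id_apply, mul_comm]
    simp only [hl, hU, LinearMap.smul_apply, innerₛₗ_apply_apply, smul_eq_mul]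
    rw [e, integral_greenKernel_mul hx (hint f χ pχ.continuousOn x)
      (lψ.integrable_mul (Lp.memLp f))]
  have hvar := fun f : L2HalfLine =>
    isW22Loc_variation_of_constants hW pψ pψ₁ pχ pχ₁ hwr (Lp.memLp f) (u := U f) rfl
  have hH : Integrable (fun x : ℝ => ‖W⁻¹‖ ^ 2 * (4 * D / ν * (x + 1) ^ (-(3 / 2) : ℝ)))
      (volume.restrict (Ioi (0 : ℝ))) :=
    ((integrableOn_add_rpow_Ioi_of_lt (by norm_num) (by norm_num)).const_mul _).const_mul _
  have hm : ∀ f, AEStronglyMeasurable (fun x => l x f) (volume.restrict (Ioi (0 : ℝ))) := fun f => by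
    obtain ⟨u₁, hw⟩ := hvar f
    refine ((hw.isPrimitive.continuousOn.mono Ioi_subset_Ici_self).aestronglyMeasurable
      measurableSet_Ioi).congr ?_
    filter_upwards [ae_restrict_mem measurableSet_Ioi] with x hx
    exact (hlU f x (le_of_lt hx)).symm
  have hb : ∀ᵐ x ∂(volume.restrict (Ioi (0 : ℝ))), ∀ f, ‖l x f‖ ^ 2 ≤
      ‖W⁻¹‖ ^ 2 * (4 * D / ν * (x + 1) ^ (-(3 / 2) : ℝ)) * ‖f‖ ^ 2 := by
    filter_upwards [ae_restrict_mem measurableSet_Ioi] with x hx f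
    simp only [hl, LinearMap.smul_apply, innerₛₗ_apply_apply, norm_smul]
    rw [mul_pow, mul_assoc]
    refine mul_le_mul_of_nonneg_left ?_ (sq_nonneg _)
    refine (pow_le_pow_left₀ (norm_nonneg _) (norm_inner_le_norm (k x) f) 2).trans ?_
    rw [mul_pow]
    exact mul_le_mul_of_nonneg_right (hkn x (le_of_lt hx)) (sq_nonneg _)
  obtain ⟨T, hT, hTc⟩ := exists_compact_of_functionals l hH hm hb (by
    filter_upwards [ae_restrict_mem measurableSet_Ioi] with x hx
    have : 0 < x + 1 := by linarith [mem_Ioi.1 hx]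
    positivity)
  refine ⟨T, hTc, fun f => ?_⟩
  obtain ⟨u₁, hw⟩ := hvar f
  refine ⟨U f, u₁, _, hw, by simp [hU, hχ0], ?_, Eventually.of_forall fun x => by ring⟩
  filter_upwards [hT f, ae_restrict_mem measurableSet_Ioi] with x hx hx0
  rw [hx, hlU f x (le_of_lt hx0)]

/-- Existence of a compact inverse of `L_c`, `c = β ^ 6`. -/
theorem exists_compact_airy_inverse {β γ : ℂ} (h1 : 0 < β.re) (h3 : 0 < (β ^ 3).re)
    (hγ : 0 < γ.re) (h : γ ^ 3 = -β ^ 3) :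
    ∃ R : L2HalfLine →L[ℂ] L2HalfLine, IsCompactOperator R ∧ ∀ f, AiryRel (β ^ 6) (R f) f := by
  have hcon := continuous_airyAi
  have hsol : ∀ δ : ℂ, δ ^ 6 = β ^ 6 →
      IsPrimitive (fun x : ℝ => δ ^ 2 * deriv airyAi (0 + δ ^ 2 * x))
        fun x => β ^ 6 * x * airyAi (0 + δ ^ 2 * x) := fun δ hδ => by
    refine (isPrimitive_deriv_airyAi_line 0 (δ ^ 2)).congr (Eventually.of_forall fun x => ?_)
    rw [← hδ]
    ring
  have h6 : γ ^ 6 = β ^ 6 := by linear_combination (γ ^ 3 - β ^ 3) * h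
  have hne : β ^ 2 - γ ^ 2 ≠ 0 := by
    intro h0
    rcases mul_eq_zero.1 (show (β - γ) * (β + γ) = 0 by linear_combination h0) with h' | h'
    · rw [← sub_eq_zero.1 h'] at h
      have : β ^ 3 = 0 := by linear_combination h / 2
      simp [this] at h3
    · have := congrArg Complex.re h'
      simp only [Complex.add_re, Complex.zero_re] at this
      linarith
  have pψ := isPrimitive_airyAi_line 0 (β ^ 2)
  have pψ₁ := hsol β rfl
  have pφ := isPrimitive_airyAi_line 0 (γ ^ 2)
  have pφ₁ := hsol γ h6
  -- This difference satisfies the Dirichlet condition. Its second term is only bounded by growth,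
  -- because Re γ³ = -Re β³ < 0.
  have pχ := pψ.sub pφ
  have pχ₁ := (pψ₁.sub pφ₁).congr
    (g := fun x => β ^ 6 * x * (airyAi (0 + β ^ 2 * x) - airyAi (0 + γ ^ 2 * x)))
    (Eventually.of_forall fun x => by ring)
  obtain ⟨A, hA, hAψ⟩ := norm_airyAi_ray_sq_le h1
  obtain ⟨B, hB, hBφ⟩ := norm_airyAi_ray_sq_le hγ
  -- The Wronskian is read off at x = 0, where the second solution vanishes; the constant 2A + 2B
  -- comes from |a - b|² ≤ 2|a|² + 2|b|².
  refine exists_compact_inverse (W := airyAi 0 * (deriv airyAi 0 * (β ^ 2 - γ ^ 2)))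
    (A := A) (B := 2 * A + 2 * B) (ν := 2 / 3 * (β ^ 3).re)
    ?_ (by fun_prop) (by fun_prop) pψ pψ₁ pχ pχ₁ ?_ (by simp) (memLp_airyAi_line h1 h3 0)
    (by positivity) hA (by positivity) hAψ ?_
  · rw [airyAi_zero, deriv_airyAi_zero]
    refine mul_ne_zero (by exact_mod_cast airyZero_pos.ne') (mul_ne_zero (neg_ne_zero.2 ?_) hne)
    exact_mod_cast airySlope_pos.ne'
  · intro x hx
    have pw := ((pψ.mul pχ₁).sub (pψ₁.mul pχ)).congr (g := fun _ => 0)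
      (Eventually.of_forall fun x => by ring)
    refine (pw x hx).2.trans ?_
    simp only [Complex.ofReal_zero, mul_zero, add_zero, intervalIntegral.integral_zero]
    ring
  · intro x hx
    have hE : Real.exp (-(2 * (2 / 3 * (β ^ 3).re) * (x * √x))) ≤
        Real.exp (2 * (2 / 3 * (β ^ 3).re) * (x * √x)) := by
      refine Real.exp_le_exp.2 ?_
      have : 0 ≤ 2 * (2 / 3 * (β ^ 3).re) * (x * √x) := by positivity
      linarith
    have e1 := hAψ x hx
    have e2 := hBφ x hx
    rw [h, Complex.neg_re, mul_neg, mul_neg, neg_mul, neg_neg] at e2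
    have e3 : ‖airyAi (0 + β ^ 2 * x) - airyAi (0 + γ ^ 2 * x)‖ ^ 2 ≤
        2 * ‖airyAi (0 + β ^ 2 * x)‖ ^ 2 + 2 * ‖airyAi (0 + γ ^ 2 * x)‖ ^ 2 := by
      refine (pow_le_pow_left₀ (norm_nonneg _) (norm_sub_le _ _) 2).trans ?_
      nlinarith [sq_nonneg (‖airyAi (0 + β ^ 2 * x)‖ - ‖airyAi (0 + γ ^ 2 * x)‖)]
    have e4 := mul_le_mul_of_nonneg_right e3 (Real.sqrt_nonneg (1 + x))
    have e5 := mul_le_mul_of_nonneg_left hE hA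
    linarith

/-! ### Resolvents -/

theorem AiryRel.sub {c : ℂ} {y f z g : L2HalfLine} (h : AiryRel c y f) (k : AiryRel c z g) :
    AiryRel c (y - z) (f - g) :=
  (airyGraph c).sub_mem (x := (y, f)) (y := (z, g)) h k

theorem AiryRel.smul {c : ℂ} {y f : L2HalfLine} (a : ℂ) (h : AiryRel c y f) :
    AiryRel c (a • y) (a • f) :=
  (airyGraph c).smul_mem a (x := (y, f)) h

/-- A right inverse of an injective map is two-sided. -/
theorem isResolventAt_of_airyRel {c z : ℂ} {R : L2HalfLine →L[ℂ] L2HalfLine}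
    (hR : ∀ f, AiryRel c (R f) (f + z • R f)) (hi : ∀ y, AiryRel c y (z • y) → y = 0) :
    IsResolventAt (airyOperator c) z R := by
  refine ⟨fun f => ⟨(mem_airyOperator_domain_iff c _).2 ⟨_, hR f⟩, ?_⟩, fun y => ?_⟩
  · rw [(airyOperator_apply_eq_iff c _ _).2 (hR f), add_sub_cancel_right]
  · have h1 := (airyOperator_apply_eq_iff c y _).1 rfl
    have h2 := (hR (airyOperator c y - z • (y : L2HalfLine))).sub h1
    refine sub_eq_zero.1 (hi _ ?_)
    rwa [sub_add_eq_add_sub, sub_right_comm, add_sub_cancel_left, ← smul_sub] at h2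

theorem IsResolventAt.airyRel {c z : ℂ} {R : L2HalfLine →L[ℂ] L2HalfLine}
    (h : IsResolventAt (airyOperator c) z R) (f : L2HalfLine) :
    AiryRel c (R f) (f + z • R f) := by
  obtain ⟨hd, hf⟩ := h.1 f
  exact (airyOperator_apply_eq_iff c ⟨R f, hd⟩ _).1 (sub_eq_iff_eq_add.1 hf)

theorem isEigenvector_airyOperator_iff {c z : ℂ} {y : L2HalfLine} :
    IsEigenvector (airyOperator c) z y ↔ y ≠ 0 ∧ AiryRel c y (z • y) := by
  refine and_congr_right fun _ => ⟨fun ⟨hd, h⟩ => ?_, fun h => ?_⟩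
  · exact (airyOperator_apply_eq_iff c ⟨y, hd⟩ _).1 h
  · exact ⟨(mem_airyOperator_domain_iff c _).2 ⟨_, h⟩, (airyOperator_apply_eq_iff c ⟨y, _⟩ _).2 h⟩

/-- The resolvent identity R = R₀(1 + zR) transfers compactness from one point to all. -/
theorem IsResolventAt.isCompactOperator {c z : ℂ} {R R₀ : L2HalfLine →L[ℂ] L2HalfLine}
    (h : IsResolventAt (airyOperator c) z R) (hc : IsCompactOperator R₀)
    (hR₀ : ∀ f, AiryRel c (R₀ f) f) (hi : ∀ y, AiryRel c y 0 → y = 0) : IsCompactOperator R := by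
  have e : R = R₀ ∘L (ContinuousLinearMap.id ℂ L2HalfLine + z • R) := by
    ext1 f
    refine sub_eq_zero.1 (hi _ ?_)
    have := (h.airyRel f).sub (hR₀ (f + z • R f))
    rwa [sub_self] at this
  rw [e]
  exact hc.comp_clm _

/-- Fredholm alternative for R₀ at 1/z: an eigenvector there would be an eigenvector of L_c for z.
Otherwise the resolvent is z⁻¹R₀(z⁻¹ - R₀)⁻¹. -/
theorem exists_isResolventAt {c z : ℂ} {R₀ : L2HalfLine →L[ℂ] L2HalfLine}
    (hc : IsCompactOperator R₀) (hR₀ : ∀ f, AiryRel c (R₀ f) f)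
    (hi : ∀ y, AiryRel c y (z • y) → y = 0) : ∃ R, IsResolventAt (airyOperator c) z R := by
  rcases eq_or_ne z 0 with rfl | hz
  · exact ⟨R₀, isResolventAt_of_airyRel (fun f => by simpa using hR₀ f) hi⟩
  rcases hc.hasEigenvalue_or_mem_resolventSet (inv_ne_zero hz) with h | h
  · obtain ⟨v, hv⟩ := h.exists_hasEigenvector
    have e : R₀ v = z⁻¹ • v := hv.apply_eq_smul
    have h1 := (hR₀ v).smul z
    rw [e, smul_inv_smul₀ hz] at h1
    exact absurd (hi v h1) hv.2
  · obtain ⟨u, hu⟩ := spectrum.mem_resolventSet_iff.1 h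
    set U : L2HalfLine →L[ℂ] L2HalfLine := ↑u⁻¹ with hU
    have key : ∀ f, U f = z • f + z • R₀ (U f) := fun f => by
      have h1 : (u : L2HalfLine →L[ℂ] L2HalfLine) (U f) = f := by
        have := u.mul_inv
        exact DFunLike.congr_fun this f
      rw [hu] at h1
      have h2 : z⁻¹ • U f - R₀ (U f) = f := h1
      rw [← smul_add, ← sub_eq_iff_eq_add.1 h2, smul_inv_smul₀ hz]
    refine ⟨z⁻¹ • (R₀ ∘L U), isResolventAt_of_airyRel (fun f => ?_) hi⟩
    have h1 := (hR₀ (U f)).smul z⁻¹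
    have e : z⁻¹ • U f = f + z • z⁻¹ • R₀ (U f) := by
      rw [smul_inv_smul₀ hz]
      nth_rw 1 [key f]
      rw [← smul_add, inv_smul_smul₀ hz]
    rwa [e] at h1

/-! ### Root subspaces -/

/-- By induction (L_c - λ)y is a multiple of the eigenfunction; that multiple is zero by
`AiryRel.no_associated`, so the kernels of the powers stop growing at the first. -/
theorem rootSpace_airyOperator {β z₀ : ℂ} (h1 : 0 < β.re) (h3 : 0 < (β ^ 3).re)
    (hz : airyAi z₀ = 0) :
    rootSpace (airyOperator (β ^ 6)) (-(β ^ 4 * z₀)) = Submodule.span ℂ {decaying h1 h3 z₀} := by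
  refine le_antisymm (iSup_le fun k => ?_) ?_
  · induction k with
    | zero => exact bot_le
    | succ k ih =>
      rintro _ ⟨y, hy, rfl⟩
      obtain ⟨a, ha⟩ := Submodule.mem_span_singleton.1 (ih hy)
      have h : AiryRel (β ^ 6) y ((-(β ^ 4 * z₀)) • y + a • decaying h1 h3 z₀) := by
        refine (airyOperator_apply_eq_iff _ y _).1 ?_
        rw [ha]
        change _ = (-(β ^ 4 * z₀)) • (y : L2HalfLine) +
          (airyOperator (β ^ 6) y - (-(β ^ 4 * z₀)) • (y : L2HalfLine))
        abel
      have ha0 := AiryRel.no_associated h1 h3 hz h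
      rw [ha0, zero_smul, add_zero] at h
      obtain ⟨b, hb⟩ := (AiryRel.eigen h1 h3 h).2 hz
      exact Submodule.mem_span_singleton.2 ⟨b, hb.symm⟩
  · rw [Submodule.span_singleton_le_iff_mem]
    refine Submodule.mem_iSup_of_mem 1 ?_
    have h := airyRel_decaying h1 h3 hz
    refine ⟨⟨decaying h1 h3 z₀, (mem_airyOperator_domain_iff _ _).2 ⟨_, h⟩⟩, ?_, rfl⟩
    have := (airyOperator_apply_eq_iff (β ^ 6)
      ⟨decaying h1 h3 z₀, (mem_airyOperator_domain_iff _ _).2 ⟨_, h⟩⟩ _).2 h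
    exact sub_eq_zero.2 this

/-- Roots of a complex number outside the negative semi-axis. -/
theorem exists_sixth_root {c : ℂ} (hc : c ∈ Complex.slitPlane) :
    ∃ β γ : ℂ, β ^ 6 = c ∧ c ^ (1 / 3 : ℂ) = β ^ 2 ∧ c ^ (2 / 3 : ℂ) = β ^ 4 ∧ 0 < β.re ∧
      0 < (β ^ 3).re ∧ 0 < γ.re ∧ γ ^ 3 = -β ^ 3 := by
  have hc0 := Complex.slitPlane_ne_zero hc
  have hlt : (Complex.log c).im < Real.pi := by
    rw [Complex.log_im]
    exact lt_of_le_of_ne (Complex.arg_le_pi c) (Complex.mem_slitPlane_iff_arg.1 hc).1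
  have hgt : -Real.pi < (Complex.log c).im := by
    rw [Complex.log_im]
    exact Complex.neg_pi_lt_arg c
  have hexp : ∀ w : ℂ, -(Real.pi / 2) < w.im → w.im < Real.pi / 2 → 0 < (Complex.exp w).re :=
    fun w h1 h2 => by
      rw [Complex.exp_re]
      exact mul_pos (Real.exp_pos _) (Real.cos_pos_of_mem_Ioo ⟨h1, h2⟩)
  set L := Complex.log c with hL
  have hpi := Real.pi_pos
  have e3 : Complex.exp (L / 6) ^ 3 = Complex.exp (L / 2) := by
    rw [← Complex.exp_nat_mul]
    congr 1
    push_cast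
    ring
  have i6 : (L / 6).im = L.im / 6 := by simp
  have i2 : (L / 2).im = L.im / 2 := by simp
  have i3 : ((Real.pi : ℂ) * Complex.I / 3).im = Real.pi / 3 := by
    rw [show (Real.pi : ℂ) * Complex.I / 3 = ((Real.pi / 3 : ℝ) : ℂ) * Complex.I by push_cast; ring]
    simp
  -- Since |arg c| < π, the arguments satisfy |arg β| < π/6 and |arg β³| < π/2. Multiplying β by
  -- exp(iπ/3) reverses the sign of its cube and moves the argument into (π/6, π/2).
  refine ⟨Complex.exp (L / 6), Complex.exp (L / 6 + Real.pi * Complex.I / 3), ?_, ?_, ?_, ?_, ?_, ?_, ?_⟩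
  · rw [← Complex.exp_nat_mul, ← Complex.exp_log hc0]
    congr 1
    push_cast
    ring
  · rw [Complex.cpow_def_of_ne_zero hc0, ← Complex.exp_nat_mul]
    congr 1
    push_cast
    ring
  · rw [Complex.cpow_def_of_ne_zero hc0, ← Complex.exp_nat_mul]
    congr 1
    push_cast
    ring
  · exact hexp _ (by rw [i6]; linarith) (by rw [i6]; linarith)
  · rw [e3]
    exact hexp _ (by rw [i2]; linarith) (by rw [i2]; linarith)
  · exact hexp _ (by rw [Complex.add_im, i6, i3]; linarith) (by rw [Complex.add_im, i6, i3]; linarith)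
  · rw [e3, ← mul_neg_one, ← Complex.exp_pi_mul_I, ← Complex.exp_add, ← Complex.exp_nat_mul]
    congr 1
    push_cast
    ring

/-- Only finitely many terms of the sequence lie in a unit ball, whereas an accumulation point would
require infinitely many. -/
theorem not_accPt_of_tendsto_norm {s : ℕ → ℂ} (hs : Tendsto (fun n => ‖s n‖) atTop atTop) {S : Set ℂ}
    (hS : S ⊆ range s) (z : ℂ) : ¬ AccPt z (𝓟 S) := fun h => by
  refine (Set.Infinite.of_accPt (h.nhds_inter (Metric.ball_mem_nhds z one_pos))) ?_
  obtain ⟨N, hN⟩ := eventually_atTop.1 (hs.eventually_ge_atTop (‖z‖ + 1))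
  refine ((finite_Iio N).image s).subset ?_
  rintro w ⟨hw, hwS⟩
  obtain ⟨n, rfl⟩ := hS hwS
  refine ⟨n, mem_Iio.2 (not_le.1 fun hn => ?_), rfl⟩
  have h1 := hN n hn
  have h2 : ‖s n - z‖ < 1 := by rwa [← dist_eq_norm]
  linarith [norm_le_norm_add_norm_sub' (s n) z]

end AirySpectrum

/-! ### The spectral theorem for the complex Airy operator -/

theorem mainTheorem3 :
    ∃ t : ℕ → ℝ,
      StrictMonoOn t (Set.Ici 1) ∧
      (∀ n ≥ 1, 0 < t n) ∧
      (∀ z : ℂ, AirySpectrum.airyAi z = 0 ↔ ∃ n ≥ 1, z = -(t n : ℂ)) ∧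
      (fun n : ℕ => t n - (3 * Real.pi / 2 * ((n : ℝ) - 1 / 4)) ^ (2 / 3 : ℝ))
        =O[Filter.atTop] (fun n : ℕ => (n : ℝ) ^ (-(4 / 3) : ℝ)) ∧
      ∀ c : ℂ, c ∈ Complex.slitPlane →
        (∀ (z : ℂ) (R : AirySpectrum.L2HalfLine →L[ℂ] AirySpectrum.L2HalfLine),
          AirySpectrum.IsResolventAt (AirySpectrum.airyOperator c) z R → IsCompactOperator R) ∧
        AirySpectrum.HasDiscreteSpectrum (AirySpectrum.airyOperator c) ∧
        AirySpectrum.spectrum (AirySpectrum.airyOperator c) =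
          {z : ℂ | ∃ n ≥ 1, z = (t n : ℂ) * c ^ (2 / 3 : ℂ)} ∧
        ∀ n ≥ 1,
          AirySpectrum.IsSimpleEigenvalue (AirySpectrum.airyOperator c)
            ((t n : ℂ) * c ^ (2 / 3 : ℂ)) ∧
          ∃ hy : MeasureTheory.MemLp
              (fun x : ℝ => AirySpectrum.airyAi (-(t n : ℂ) + (x : ℂ) * c ^ (1 / 3 : ℂ))) 2
              (MeasureTheory.volume.restrict (Set.Ioi 0)),
            AirySpectrum.IsEigenvector (AirySpectrum.airyOperator c)
              ((t n : ℂ) * c ^ (2 / 3 : ℂ)) (hy.toLp _) := by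
  open AirySpectrum in
  obtain ⟨t, hmono, hpos, hzero, hdiv, hasym⟩ := exists_airy_zeros
  refine ⟨t, hmono, hpos, hzero, hasym, fun c hc => ?_⟩
  obtain ⟨β, γ, rfl, hp1, hp2, h1, h3, hγ, h⟩ := exists_sixth_root hc
  rw [hp1, hp2]
  have hβ : β ≠ 0 := by rintro rfl; simp at h1
  have hβ4 : β ^ 4 ≠ 0 := pow_ne_zero 4 hβ
  obtain ⟨R₀, hR₀c, hR₀⟩ := exists_compact_airy_inverse h1 h3 hγ h
  have hz : ∀ n ≥ 1, airyAi (-(t n : ℂ)) = 0 := fun n hn => (hzero _).2 ⟨n, hn, rfl⟩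
  have hval : ∀ n, -(β ^ 4 * -(t n : ℂ)) = t n * β ^ 4 := fun n => by ring
  have heig : ∀ n ≥ 1, IsEigenvector (airyOperator (β ^ 6)) (t n * β ^ 4)
      (decaying h1 h3 (-(t n : ℂ))) := fun n hn => by
    rw [← hval]
    exact isEigenvector_airyOperator_iff.2 ⟨decaying_ne_zero h1 h3, airyRel_decaying h1 h3 (hz n hn)⟩
  have hroot : ∀ n ≥ 1, rootSpace (airyOperator (β ^ 6)) (t n * β ^ 4) =
      Submodule.span ℂ {decaying h1 h3 (-(t n : ℂ))} := fun n hn => by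
    rw [← hval, rootSpace_airyOperator h1 h3 (hz n hn)]
  have hi : ∀ z, (¬ ∃ n ≥ 1, z = (t n : ℂ) * β ^ 4) → ∀ y, AiryRel (β ^ 6) y (z • y) → y = 0 := by
    intro z hne y hy
    -- The point z₀ = -z/β⁴ is a zero of Ai exactly when z is one of the listed numbers.
    have e : z = -(β ^ 4 * (-z / β ^ 4)) := by field_simp
    rw [e] at hy
    refine (AiryRel.eigen h1 h3 hy).1 fun h0 => hne ?_
    obtain ⟨n, hn, hzn⟩ := (hzero _).1 h0
    refine ⟨n, hn, ?_⟩
    rw [div_eq_iff hβ4] at hzn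
    linear_combination -hzn
  have hspec : AirySpectrum.spectrum (airyOperator (β ^ 6)) =
      {z : ℂ | ∃ n ≥ 1, z = (t n : ℂ) * β ^ 4} := by
    ext z
    refine ⟨fun hzs => ?_, ?_⟩
    · by_contra hne
      exact hzs (exists_isResolventAt hR₀c hR₀ (hi z hne))
    · rintro ⟨n, hn, rfl⟩ ⟨R, hR⟩
      obtain ⟨hd0, hd, hT⟩ := heig n hn
      have := hR.2 ⟨_, hd⟩
      rw [hT, sub_self, map_zero] at this
      exact hd0 this.symm
  -- Zero is not listed because every tₙ is positive; this is what legitimates R₀ as the inverse.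
  have hi0 : ∀ y, AiryRel (β ^ 6) y 0 → y = 0 := fun y hy => by
    refine hi 0 (fun ⟨n, hn, h0⟩ => ?_) y (by rwa [zero_smul])
    rcases mul_eq_zero.1 h0.symm with h' | h'
    · exact (hpos n hn).ne' (by exact_mod_cast h')
    · exact hβ4 h'
  refine ⟨fun z R hR => hR.isCompactOperator hR₀c hR₀ hi0, ⟨?_, ?_⟩, hspec,
    fun n hn => ⟨⟨⟨_, heig n hn⟩, ?_⟩, ?_⟩⟩
  · rw [hspec]
    refine not_accPt_of_tendsto_norm (s := fun n => (t n : ℂ) * β ^ 4) ?_ ?_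
    · simp only [norm_mul, Complex.norm_real]
      exact (tendsto_norm_atTop_atTop.comp hdiv).atTop_mul_const (norm_pos_iff.2 hβ4)
    · rintro _ ⟨n, -, rfl⟩
      exact ⟨n, rfl⟩
  · rw [hspec]
    rintro _ ⟨n, hn, rfl⟩
    refine ⟨⟨_, heig n hn⟩, ?_⟩
    rw [hroot n hn]
    infer_instance
  · rw [hroot n hn]
    exact finrank_span_singleton (decaying_ne_zero h1 h3)
  · simp only [mul_comm _ (β ^ 2)]
    exact ⟨memLp_airyAi_line h1 h3 _, heig n hn⟩

end
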